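/- For $u=(u_0,u_1,u_2,u_3)\in\mathbb C^4$ (homogeneous coordinates of a point of $P_3(\mathbb C)$), let $\mathcal A_u$ be the quadratic algebra with generators $y_0,\dots,y_3$ and the six relations $$u_ky_ky_0-u_0y_0y_k+u_\ell y_\ell y_m-u_my_my_\ell=0,\qquad u_ky_0y_k-u_0y_ky_0+u_my_\ell y_m-u_\ell y_my_\ell=0,$$ where here and below $(k,\ell,m)$ runs through the cyclic permutations of $(1,2,3)$. Call $u$ generic if $u_\mu\neq\pm u_\nu$ for all $\mu\ne\nu$. Let $$\Phi(u)=(a,b,c)=\big((u_0+u_1)(u_2+u_3),\,(u_0+u_2)(u_3+u_1),\,(u_0+u_3)(u_1+u_2)\big),\qquad J_{12}=\tfrac{a-b}{c},\;J_{23}=\tfrac{b-c}{a},\;J_{31}=\tfrac{c-a}{b}.$$ Let $S$ be the set of the eight points $(1,0,0,0),\dots,(0,0,0,1)$, $(-1,1,1,1),\dots,(1,1,1,-1)$ of $P_3(\mathbb C)$, and let $F_u\subset P_3(\mathbb C)$ be the union of $S$ and the fiber through $u$ of $\Phi:P_3(\mathbb C)\setminus S\to P_2(\mathbb C)$. It is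 considered in the coordinates $Z=Mu$ with $$M=\tfrac12\begin{pmatrix}1&1&1&1\\1&1&-1&-1\\1&-1&1&-1\\1&-1&-1&1\end{pmatrix}.$$ Let $e_\nu$ ($0\le\nu\le3$) be the point of $P_3(\mathbb C)$ whose coordinates $Z_\mu$ vanish except for $\mu=\nu$. For a quadratic algebra $T(V)/(R)$, $R\subset V\otimes V$, let $\Gamma\subset P(V^*)\times P(V^*)$ be the set of pairs $([\alpha],[\beta])$ with $\langle\omega,\alpha\otimes\beta\rangle=0$ for all $\omega\in R$. If both projections of $\Gamma$ are the same set $E$ and $\Gamma$ is the graph of an automorphism $\sigma$ of $E$, then $E$ is called the characteristic variety and $\sigma$ its automorphism. For $\operatorname{Im}\tau>0$ and $q=e^{\pi i\tau}$ let $\vartheta_3(z)=\sum_{n\in\mathbb Z}q^{n^2}e^{2\pi inz}$, $i\vartheta_1(z)=q^{1/4}e^{\pi iz}\vartheta_3(z+\frac12+\frac\tau2)$ with $q^{1/4}=e^{\pi i\tau/4}$, $\vartheta_2(z)=\vartheta_1(z+\frac12)$, $\vartheta_4(z)=\vartheta_3(z+\frac12)$. Call $(\tau,\eta)$, with $\operatorname{Im}\tau>0$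 and $\eta\in\mathbb C$, elliptic parameters of $u$ if $(a,b,c)$ is a nonzero multiple of $\big(\frac{\vartheta_2(0)^2}{\vartheta_2(\eta)^2},\frac{\vartheta_3(0)^2}{\vartheta_3(\eta)^2},\frac{\vartheta_4(0)^2}{\vartheta_4(\eta)^2}\big)$, and let, in the coordinates $Z_\mu$, $$\psi(z)=\Big(\tfrac{\vartheta_1(2z-\eta)}{\vartheta_1(\eta)},\tfrac{\vartheta_2(2z-\eta)}{\vartheta_2(\eta)},\tfrac{\vartheta_3(2z-\eta)}{\vartheta_3(\eta)},\tfrac{\vartheta_4(2z-\eta)}{\vartheta_4(\eta)}\Big).$$ **Theorem.** Let $u$ be generic. For every choice of the square roots, define generators $Y_\mu$ of $\mathcal A_u$ by $$\begin{aligned}y_0&=\sqrt{u_1-u_2}\sqrt{u_2-u_3}\sqrt{u_3-u_1}\;Y_0,& y_1&=\sqrt{u_0+u_2}\sqrt{u_2-u_3}\sqrt{u_0+u_3}\;Y_1,\\ y_2&=\sqrt{u_0+u_3}\sqrt{u_3-u_1}\sqrt{u_0+u_1}\;Y_2,& y_3&=\sqrt{u_0+u_1}\sqrt{u_1-u_2}\sqrt{u_0+u_2}\;Y_3,\end{aligned}$$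 and use on $P(V^*)$, where $V$ is the span of the generators, the homogeneous coordinates $Z_\mu=\alpha(Y_\mu)$. Then: 1. In terms of the $Y_\mu$ the relations of $\mathcal A_u$ take the form $[Y_0,Y_k]=[Y_\ell,Y_m]_+$ and $[Y_\ell,Y_m]=-J_{\ell m}[Y_0,Y_k]_+$, that is, these six relations hold in $\mathcal A_u$ and span its space of relations. 2. Both projections of $\Gamma$ are equal to the characteristic variety $E_u$, and $E_u=F_u\cup\{e_0,e_1,e_2,e_3\}$. 3. $\Gamma$ is the graph of an automorphism $\sigma$ of $E_u$ (a bijection, regular together with its inverse). Elliptic parameters of $u$ exist, and for all elliptic parameters $(\tau,\eta)$ of $u$ the map $\psi$ induces a bijection of $\mathbb C/(\mathbb Z+\mathbb Z\tau)$ onto $F_u$ under which $\sigma$ is the translation by $-\eta$, that is, $\sigma(\psi(z))=\psi(z-\eta)$ for all $z$. Moreover $\sigma(e_\nu)=e_\nu$ for each $\nu$. 4. There is a birational automorphism of $P_3$, cubic, defined over $\mathbb Q$ and independent of $u$ (in the coordinates $Z_\mu$), whose restriction to $E_u$ is $\sigma$ for every generic $u$: it is given by four cubic forms over $\mathbb Q$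 without common factor, which have only finitely many common zeros on $E_u$ and give $\sigma$ at every other point of $E_u$. -/

import Mathlib

open scoped TensorProduct

namespace NCSphere

noncomputable section

/-! ### Quadratic algebras and their geometric data -/

section Quadratic

variable {V : Type} [AddCommGroup V] [Module ℂ V]

/-- The inclusion of `V ⊗ V` in the tensor algebra `T(V)` as its degree two part. -/
def toTensorAlgebra : V ⊗[ℂ] V →ₗ[ℂ] TensorAlgebra ℂ V :=
  (LinearMap.mul' ℂ (TensorAlgebra ℂ V)).comp
    (TensorProduct.map (TensorAlgebra.ι ℂ) (TensorAlgebra.ι ℂ))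

/-- The quadratic algebra `A(V, R) = T(V) / (R)`, where `(R)` is the two-sided ideal generated by
the subspace `R` of `V ⊗ V`. -/
abbrev QuadraticAlg (R : Submodule ℂ (V ⊗[ℂ] V)) : Type :=
  RingQuot (fun s t : TensorAlgebra ℂ V => (∃ ω ∈ R, s = toTensorAlgebra ω) ∧ t = 0)

/-- The class in `A(V, R)` of an element of `V`. -/
def gen (R : Submodule ℂ (V ⊗[ℂ] V)) (v : V) : QuadraticAlg R :=
  RingQuot.mkAlgHom ℂ _ (TensorAlgebra.ι ℂ v)

/-- The set `Γ ⊆ P(V*) × P(V*)` of the pairs `(α, β)` such that `⟨ω, α ⊗ β⟩ = 0` for all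
`ω ∈ R`. -/
def charGraph (R : Submodule ℂ (V ⊗[ℂ] V)) :
    Set (Projectivization ℂ (Module.Dual ℂ V) × Projectivization ℂ (Module.Dual ℂ V)) :=
  {p | ∀ ω ∈ R, TensorProduct.dualDistrib ℂ V V (p.1.rep ⊗ₜ[ℂ] p.2.rep) ω = 0}

/-- The complex projective space of dimension three, with its homogeneous coordinates. -/
abbrev P3 : Type := Projectivization ℂ (Fin 4 → ℂ)

/-- The homogeneous coordinates `Z_μ = α(Y_μ)` of `[α] ∈ P(V*)` given by a basis `Y` of `V`. -/
def homCoord (Y : Module.Basis (Fin 4) ℂ V) : Projectivization ℂ (Module.Dual ℂ V) → P3 :=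
  Projectivization.map (Y.constr ℂ).symm.toLinearMap (Y.constr ℂ).symm.injective

/-- The set `Γ`, written in the homogeneous coordinates given by the basis `Y` of `V`. -/
def charGraphIn (Y : Module.Basis (Fin 4) ℂ V) (R : Submodule ℂ (V ⊗[ℂ] V)) : Set (P3 × P3) :=
  Prod.map (homCoord Y) (homCoord Y) '' charGraph R

/-- The characteristic variety: the first projection of `Γ`. -/
def charVariety (Y : Module.Basis (Fin 4) ℂ V) (R : Submodule ℂ (V ⊗[ℂ] V)) : Set P3 :=
  Prod.fst '' charGraphIn Y R

/-- `x ⊗ y - y ⊗ x`. -/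
def comm (x y : V) : V ⊗[ℂ] V := x ⊗ₜ[ℂ] y - y ⊗ₜ[ℂ] x

/-- `x ⊗ y + y ⊗ x`. -/
def acomm (x y : V) : V ⊗[ℂ] V := x ⊗ₜ[ℂ] y + y ⊗ₜ[ℂ] x

end Quadratic

/-! ### Points, regular maps and birational maps of projective space -/

/-- `v` is a system of homogeneous coordinates of the point `x`. -/
def Represents (x : P3) (v : Fin 4 → ℂ) : Prop :=
  ∃ hv : v ≠ 0, x = Projectivization.mk ℂ v hv

/-- A self-map of a subset `E` of projective space is regular if near each point of `E` it is given
by four homogeneous polynomials of the same degree without common zero at that point. -/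
def IsRegularMap {E : Set P3} (f : E → E) : Prop :=
  ∀ x : E, ∃ (d : ℕ) (F : Fin 4 → MvPolynomial (Fin 4) ℂ),
    (∀ i, (F i).IsHomogeneous d) ∧
    (fun i => MvPolynomial.eval x.1.rep (F i)) ≠ 0 ∧
    ∀ y : E, (fun i => MvPolynomial.eval y.1.rep (F i)) ≠ 0 →
      Represents (f y).1 (fun i => MvPolynomial.eval y.1.rep (F i))

/-- The value at `v ∈ ℂ⁴` of a four-tuple of polynomials with rational coefficients. -/
def evalTuple (P : Fin 4 → MvPolynomial (Fin 4) ℚ) (v : Fin 4 → ℂ) : Fin 4 → ℂ :=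
  fun i => MvPolynomial.aeval v (P i)

/-- `P` defines a birational automorphism of the projective space of dimension three, of degree
`d` and defined over `ℚ`: its components are homogeneous of degree `d` without common factor, and
there is an inverse rational map, also over `ℚ`. -/
def IsBirationalAut (d : ℕ) (P : Fin 4 → MvPolynomial (Fin 4) ℚ) : Prop :=
  (∀ i, (P i).IsHomogeneous d) ∧
  (∀ D : MvPolynomial (Fin 4) ℚ, (∀ i, D ∣ P i) → IsUnit D) ∧
  ∃ (e : ℕ) (Q : Fin 4 → MvPolynomial (Fin 4) ℚ) (H K : MvPolynomial (Fin 4) ℚ),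
    (∀ i, (Q i).IsHomogeneous e) ∧ H ≠ 0 ∧ K ≠ 0 ∧
    (∀ i, MvPolynomial.bind₁ P (Q i) = H * MvPolynomial.X i) ∧
    (∀ i, MvPolynomial.bind₁ Q (P i) = K * MvPolynomial.X i)

/-! ### The algebras `A_u` -/

/-- `(k, l, m)` is a cyclic permutation of `(1, 2, 3)`. -/
def IsCyclic123 (k l m : Fin 4) : Prop :=
  (k, l, m) = (1, 2, 3) ∨ (k, l, m) = (2, 3, 1) ∨ (k, l, m) = (3, 1, 2)

/-- The generators `y_μ` of `A_u`: the standard basis of `V = ℂ⁴`. -/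
def yGen (μ : Fin 4) : Fin 4 → ℂ := Pi.single μ 1

/-- The six relations of `A_u`. -/
def uRelations (u : Fin 4 → ℂ) : Set ((Fin 4 → ℂ) ⊗[ℂ] (Fin 4 → ℂ)) :=
  {ω | ∃ k l m, IsCyclic123 k l m ∧
    (ω = u k • (yGen k ⊗ₜ[ℂ] yGen 0) - u 0 • (yGen 0 ⊗ₜ[ℂ] yGen k)
        + u l • (yGen l ⊗ₜ[ℂ] yGen m) - u m • (yGen m ⊗ₜ[ℂ] yGen l) ∨
     ω = u k • (yGen 0 ⊗ₜ[ℂ] yGen k) - u 0 • (yGen k ⊗ₜ[ℂ] yGen 0)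
        + u m • (yGen l ⊗ₜ[ℂ] yGen m) - u l • (yGen m ⊗ₜ[ℂ] yGen l))}

/-- The space of relations of `A_u`. -/
def uRel (u : Fin 4 → ℂ) : Submodule ℂ ((Fin 4 → ℂ) ⊗[ℂ] (Fin 4 → ℂ)) :=
  Submodule.span ℂ (uRelations u)

/-- The quadratic algebra `A_u`. -/
abbrev AlgU (u : Fin 4 → ℂ) : Type := QuadraticAlg (uRel u)

/-- The parameter `u` is generic: `u_μ ≠ ± u_ν` for `μ ≠ ν`. -/
def Generic (u : Fin 4 → ℂ) : Prop :=
  ∀ μ ν, μ ≠ ν → u μ ≠ u ν ∧ u μ ≠ -u ν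

/-- `J_{l m}(u)`, where `(k, l, m)` is a cyclic permutation of `(1, 2, 3)`. -/
def J (u : Fin 4 → ℂ) (k l m : Fin 4) : ℂ :=
  ((u 0 + u l) * (u m + u k) - (u 0 + u m) * (u k + u l)) / ((u 0 + u k) * (u l + u m))

/-- The six relations in terms of generators `Y_μ`. -/
def yRelations (u : Fin 4 → ℂ) (Y : Fin 4 → (Fin 4 → ℂ)) :
    Set ((Fin 4 → ℂ) ⊗[ℂ] (Fin 4 → ℂ)) :=
  {ω | ∃ k l m, IsCyclic123 k l m ∧
    (ω = comm (Y 0) (Y k) - acomm (Y l) (Y m) ∨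
     ω = comm (Y l) (Y m) + J u k l m • acomm (Y 0) (Y k))}

/-- The scalars `ρ_μ` of the change of generators `y_μ = ρ_μ Y_μ`, in terms of square roots
`d_{kl}` of `u_k - u_l` and `s_k` of `u_0 + u_k`. -/
def changeScale (d₁₂ d₂₃ d₃₁ s₁ s₂ s₃ : ℂ) : Fin 4 → ℂ :=
  ![d₁₂ * d₂₃ * d₃₁, s₂ * d₂₃ * s₃, s₃ * d₃₁ * s₁, s₁ * d₁₂ * s₂]

/-! ### The fibers `F_u` -/

/-- `Φ(u) = (a, b, c)`. -/
def Phi (u : Fin 4 → ℂ) : Fin 3 → ℂ :=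
  ![(u 0 + u 1) * (u 2 + u 3), (u 0 + u 2) * (u 3 + u 1), (u 0 + u 3) * (u 1 + u 2)]

/-- The eight points `p_j = (1, 0, 0, 0), …` and `q_j = (-1, 1, 1, 1), …`. -/
def baseS : Set P3 :=
  {x | ∃ j : Fin 4, Represents x (Pi.single j 1) ∨
    Represents x (fun i => if i = j then -1 else 1)}

/-- `F_u`: the union of `S` with the fiber through `u` of `Φ : P₃(ℂ) \ S → P₂(ℂ)`. -/
def fiberF (u : Fin 4 → ℂ) : Set P3 :=
  baseS ∪ {v | v ∉ baseS ∧ ∃ t : ℂ, t ≠ 0 ∧ Phi v.rep = t • Phi u}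

/-- The involution `M` with `Z = M u`. -/
def matM : Matrix (Fin 4) (Fin 4) ℂ :=
  (1 / 2 : ℂ) • !![1, 1, 1, 1; 1, 1, -1, -1; 1, -1, 1, -1; 1, -1, -1, 1]

theorem matM_mul_self : matM * matM = 1 := by
  ext i j
  fin_cases i <;> fin_cases j <;>
    simp [matM, Matrix.mul_apply, Fin.sum_univ_four] <;> norm_num

theorem matM_injective : Function.Injective (Matrix.toLin' matM) := by
  apply Function.LeftInverse.injective (g := Matrix.toLin' matM)
  intro v
  rw [← Matrix.toLin'_mul_apply, matM_mul_self, Matrix.toLin'_one]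
  rfl

/-- `M`, as a map from the coordinates `u_μ` to the coordinates `Z_μ` of projective space. -/
def projM : P3 → P3 := Projectivization.map (Matrix.toLin' matM) matM_injective

/-- The four points `e_ν`, with all homogeneous coordinates but one equal to `0`. -/
def pointsE : Set P3 := {x | ∃ ν : Fin 4, Represents x (Pi.single ν 1)}

/-! ### Theta functions -/

/-- `ϑ₃(z) = ∑ q^{n²} e^{2πinz}` with `q = e^{πiτ}`. -/
def theta3 (τ z : ℂ) : ℂ := jacobiTheta₂ z τ

/-- `i ϑ₁(z) = q^{1/4} e^{πiz} ϑ₃(z + 1/2 + τ/2)`. -/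
def theta1 (τ z : ℂ) : ℂ :=
  -Complex.I * Complex.exp (Real.pi * Complex.I * τ / 4) *
    Complex.exp (Real.pi * Complex.I * z) * theta3 τ (z + (1 / 2 + τ / 2))

/-- `ϑ₂(z) = ϑ₁(z + 1/2)`. -/
def theta2 (τ z : ℂ) : ℂ := theta1 τ (z + 1 / 2)

/-- `ϑ₄(z) = ϑ₃(z + 1/2)`. -/
def theta4 (τ z : ℂ) : ℂ := theta3 τ (z + 1 / 2)

/-- `(τ, η)` are elliptic parameters for `u`: `Im τ > 0` and `Φ(u) = (a, b, c)` is projectively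
equal to `(ϑ₂(0)²/ϑ₂(η)², ϑ₃(0)²/ϑ₃(η)², ϑ₄(0)²/ϑ₄(η)²)`. -/
def IsEllipticParam (u : Fin 4 → ℂ) (τ η : ℂ) : Prop :=
  0 < τ.im ∧ ∃ t : ℂ, t ≠ 0 ∧ Phi u = t •
    ![theta2 τ 0 ^ 2 / theta2 τ η ^ 2, theta3 τ 0 ^ 2 / theta3 τ η ^ 2,
      theta4 τ 0 ^ 2 / theta4 τ η ^ 2]

/-- `φ(z)`, in the coordinates `Z_μ`. -/
def phiTheta (τ η z : ℂ) : Fin 4 → ℂ :=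
  ![theta1 τ (2 * z) / theta1 τ η, theta2 τ (2 * z) / theta2 τ η,
    theta3 τ (2 * z) / theta3 τ η, theta4 τ (2 * z) / theta4 τ η]

/-- `ψ(z) = φ(z - η/2)`. -/
def psi (τ η z : ℂ) : Fin 4 → ℂ := phiTheta τ η (z - η / 2)

/-- The lattice `L = ℤ + ℤτ`. -/
def latticeL (τ : ℂ) : Set ℂ := {z | ∃ m n : ℤ, z = m + n * τ}

end

end NCSphere

open NCSphere

/-!
A point `([α], [β])` of `Γ` is a pair of vectors `x`, `y` in the coordinates `Z` which satisfy six
equations, linear in each of them (`GammaRel`):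
`x₀ y_k - x_k y₀ = x_l y_m + x_m y_l` and `x_l y_m - x_m y_l = -J_{lm} (x₀ y_k + x_k y₀)`.

*Algebra.* The first three equations are linear in `y`, and their vector of maximal minors is a
cubic map `x ↦ cubicMap x` with integral coefficients; hence `y` is proportional to it where it is
not zero. Up to linear substitutions this is the standard Cremona transformation of `P₃`
(`cubicForms_mul`), so it is birational (`isBirationalAut_cubicPoly`) and vanishes on six lines
only (`lines_of_cubicMap_eq_zero`). With `y = cubicMap x` the other three equations become
products of `x₀ x_k + x_l x_m` and `x_l² - x_m² + J_{lm} (x₀² - x_k²)`; an elementary discussion of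
these, and of the six lines, shows that `x` is one of the `e_ν` or satisfies
`(x₀² - x₁², x₀² - x₂², x₀² - x₃²) ∈ ℂ (a, b, c)`
(`GammaRel.onCurve_or_onAxis`). These quadrics define `F_u` (`projM_image_fiberF`), by the
identities `Z₀² - Z_k² = (u₀ + u_k)(u_l + u_m)`. On this set the cubic map has at most four zeros,
which are points `(1, ±1, ±1, ±1)`, and a second cubic map obtained from another choice of three
equations gives `y` there (`cubicMapAux_ne_zero`). So `y` exists and is unique. Since the equations
are invariant under the exchange of `x` and `y` followed by the reflection `Z₀ ↦ -Z₀`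
(`GammaRel.reflect_swap`), the same holds for `x` in terms of `y`.

*Theta functions.* All identities between the `ϑ_k` come from the expansion of the product of two
values of `ϑ₃` in two theta functions of double period (`theta3_mul_theta3`). They show that
`ψ(z)` lies on the quadrics, and that `(ψ(z), ψ(z - η))` satisfies the six equations
(`GammaRel.psi`); as `y` is unique, `σ` is the translation. That `ψ` is onto and that it is
injective modulo the lattice follows from the zeros of theta functions; the basic tool is that an
entire function without zeros which is multiplied by a constant under `z ↦ z + 1` and by an
exponential under `z ↦ z + τ` is the exponential of a linear function, and its second multiplier
is constant too (`quasiperiodic_zero_free`). Elliptic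
parameters exist since `ϑ₄(0)⁴ / ϑ₃(0)⁴` takes all values different from `0` and `1`
(`exists_thetaY_eq_mul_thetaX`): otherwise a quotient of theta constants would give a nonconstant
modular form of weight zero.
-/

namespace NCSphere

section Theta

open Complex

/-! ### Theta functions of double period and the addition formulas -/

/-- The theta function `∑ q^{2n²} e^{4πinx}` of nome `q²`, at the argument `2x`. -/
noncomputable def thetaA (τ x : ℂ) : ℂ := jacobiTheta₂ (2 * x) (2 * τ)

/-- The theta function `∑ q^{2(n+1/2)²} e^{2πi(2n+1)x}` of nome `q²` and of half-integral
characteristic, at the argument `2x`. -/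
noncomputable def thetaB (τ x : ℂ) : ℂ :=
  exp (Real.pi * I * τ / 2 + 2 * Real.pi * I * x) * jacobiTheta₂ (2 * x + τ) (2 * τ)

/-- Pairs of integers, written `(r + s, r - s)` or `(r + s + 1, r - s)` according to the parity
of their sum. -/
def sumDiffEquiv : (ℤ × ℤ) ⊕ (ℤ × ℤ) ≃ ℤ × ℤ where
  toFun := Sum.elim (fun p => (p.1 + p.2, p.1 - p.2)) (fun p => (p.1 + p.2 + 1, p.1 - p.2))
  invFun p := if (p.1 + p.2) % 2 = 0 then .inl ((p.1 + p.2) / 2, (p.1 - p.2) / 2)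
    else .inr ((p.1 + p.2) / 2, (p.1 - p.2) / 2)
  left_inv := by
    rintro (⟨r, s⟩ | ⟨r, s⟩)
    · have h : (r + s + (r - s)) % 2 = 0 := by omega
      simp only [Sum.elim_inl, h, if_true, Sum.inl.injEq, Prod.mk.injEq]
      omega
    · have h : (r + s + 1 + (r - s)) % 2 ≠ 0 := by omega
      simp only [Sum.elim_inr, h, if_false, Sum.inr.injEq, Prod.mk.injEq]
      omega
  right_inv := by
    rintro ⟨m, n⟩
    by_cases h : (m + n) % 2 = 0
    · simp only [h, if_true, Sum.elim_inl, Prod.mk.injEq]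
      omega
    · simp only [h, if_false, Sum.elim_inr, Prod.mk.injEq]
      omega

lemma hasSum_thetaA {τ : ℂ} (hτ : 0 < τ.im) (x : ℂ) :
    HasSum (fun n : ℤ => jacobiTheta₂_term n (2 * x) (2 * τ)) (thetaA τ x) :=
  hasSum_jacobiTheta₂_term _ (by simpa using hτ)

lemma hasSum_thetaB {τ : ℂ} (hτ : 0 < τ.im) (x : ℂ) :
    HasSum (fun n : ℤ => exp (Real.pi * I * τ / 2 + 2 * Real.pi * I * x) *
      jacobiTheta₂_term n (2 * x + τ) (2 * τ)) (thetaB τ x) :=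
  (hasSum_jacobiTheta₂_term _ (by simpa using hτ)).mul_left _

/-- The product of two absolutely convergent series, as a series indexed by pairs. -/
lemma hasSum_mul_of_summable {f g : ℤ → ℂ} {a b : ℂ} (hf : HasSum f a) (hg : HasSum g b) :
    HasSum (fun p : ℤ × ℤ => f p.1 * g p.2) (a * b) :=
  hf.mul hg (summable_mul_of_summable_norm hf.summable.norm hg.summable.norm)

/-- The addition formula from which all the others follow: in the product of the two series the
pairs of indices are sorted by the parity of their sum. -/
theorem theta3_mul_theta3 {τ : ℂ} (hτ : 0 < τ.im) (x y : ℂ) :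
    theta3 τ (x + y) * theta3 τ (x - y) =
      thetaA τ x * thetaA τ y + thetaB τ x * thetaB τ y := by
  have h1 := hasSum_mul_of_summable (hasSum_jacobiTheta₂_term (x + y) hτ)
    (hasSum_jacobiTheta₂_term (x - y) hτ)
  have h2 := hasSum_mul_of_summable (hasSum_thetaA hτ x) (hasSum_thetaA hτ y)
  have h3 := hasSum_mul_of_summable (hasSum_thetaB hτ x) (hasSum_thetaB hτ y)
  have h4 := HasSum.sum (f := (fun p : ℤ × ℤ => jacobiTheta₂_term p.1 (x + y) τ *
    jacobiTheta₂_term p.2 (x - y) τ) ∘ sumDiffEquiv) (h2.congr_fun ?_) (h3.congr_fun ?_)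
  · exact h1.unique (sumDiffEquiv.hasSum_iff.1 h4)
  · rintro ⟨r, s⟩
    simp only [Function.comp_apply, sumDiffEquiv, Equiv.coe_fn_mk, Sum.elim_inl,
      jacobiTheta₂_term, ← Complex.exp_add]
    congr 1
    push_cast
    ring
  · rintro ⟨r, s⟩
    simp only [Function.comp_apply, sumDiffEquiv, Equiv.coe_fn_mk, Sum.elim_inr,
      jacobiTheta₂_term, ← Complex.exp_add]
    congr 1
    push_cast
    ring

lemma thetaA_neg (τ x : ℂ) : thetaA τ (-x) = thetaA τ x := by
  simp [thetaA]

lemma thetaA_add_half (τ x : ℂ) : thetaA τ (x + 1 / 2) = thetaA τ x := by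
  rw [thetaA, thetaA, show 2 * (x + 1 / 2) = 2 * x + 1 by ring, jacobiTheta₂_add_left]

lemma thetaA_add_half_period (τ x : ℂ) :
    thetaA τ (x + τ / 2) = exp (-(Real.pi * I * τ / 2) - 2 * Real.pi * I * x) * thetaB τ x := by
  rw [thetaA, thetaB, ← mul_assoc, ← exp_add]
  ring_nf
  simp

lemma thetaB_neg (τ x : ℂ) : thetaB τ (-x) = thetaB τ x := by
  rw [thetaB, thetaB, ← jacobiTheta₂_neg_left (2 * -x + τ),
    show 2 * x + τ = -(2 * -x + τ) + 2 * τ by ring, jacobiTheta₂_add_left', ← mul_assoc, ← exp_add]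
  congr 2
  ring

lemma thetaB_add_half (τ x : ℂ) : thetaB τ (x + 1 / 2) = -thetaB τ x := by
  rw [thetaB, thetaB, show 2 * (x + 1 / 2) + τ = 2 * x + τ + 1 by ring, jacobiTheta₂_add_left,
    show (Real.pi : ℂ) * I * τ / 2 + 2 * Real.pi * I * (x + 1 / 2) =
      (Real.pi * I * τ / 2 + 2 * Real.pi * I * x) + Real.pi * I by ring, exp_add _ (Real.pi * I),
    exp_pi_mul_I]
  ring

lemma thetaB_add_half_period (τ x : ℂ) :
    thetaB τ (x + τ / 2) = exp (-(Real.pi * I * τ / 2) - 2 * Real.pi * I * x) * thetaA τ x := by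
  rw [thetaA, thetaB, show 2 * (x + τ / 2) + τ = 2 * x + 2 * τ by ring, jacobiTheta₂_add_left',
    ← mul_assoc, ← exp_add]
  congr 2
  ring

lemma exp_half_pi_mul_I : exp (Real.pi * I * (1 / 2)) = I := by
  rw [show (Real.pi : ℂ) * I * (1 / 2) = Real.pi / 2 * I by ring, exp_pi_div_two_mul_I]

lemma theta1_eq (τ z : ℂ) : theta1 τ z =
    -I * exp (Real.pi * I * τ / 4 + Real.pi * I * z) * theta3 τ (z + 1 / 2 + τ / 2) := by
  rw [theta1, exp_add, add_assoc z]
  ring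

lemma theta2_eq (τ z : ℂ) : theta2 τ z =
    exp (Real.pi * I * τ / 4 + Real.pi * I * z) * theta3 τ (z + τ / 2) := by
  rw [theta2, theta1_eq, theta3, theta3,
    show z + 1 / 2 + 1 / 2 + τ / 2 = z + τ / 2 + 1 by ring, jacobiTheta₂_add_left,
    show (Real.pi : ℂ) * I * τ / 4 + Real.pi * I * (z + 1 / 2) =
      Real.pi * I * τ / 4 + Real.pi * I * z + Real.pi * I * (1 / 2) by ring,
    exp_add _ (Real.pi * I * (1 / 2)), exp_half_pi_mul_I]
  linear_combination (-exp (Real.pi * I * τ / 4 + Real.pi * I * z) *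
    jacobiTheta₂ (z + τ / 2) τ) * I_mul_I

/-- The four theta functions, in the order of the coordinates `Z_μ`. -/
noncomputable def thetas (τ : ℂ) : Fin 4 → ℂ → ℂ :=
  ![theta1 τ, theta2 τ, theta3 τ, theta4 τ]

/-- The signs by which `ϑ₁, …, ϑ₄` are multiplied under `z ↦ z + 1`. -/
def signOne : Fin 4 → ℂ := ![-1, -1, 1, 1]

/-- The signs of the multipliers of `ϑ₁, …, ϑ₄` under `z ↦ z + τ`. -/
def signTau : Fin 4 → ℂ := ![-1, 1, 1, -1]

lemma theta3_add_one (τ z : ℂ) : theta3 τ (z + 1) = theta3 τ z := jacobiTheta₂_add_left z τ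

lemma theta3_add_tau (τ z : ℂ) :
    theta3 τ (z + τ) = exp (-Real.pi * I * (τ + 2 * z)) * theta3 τ z := jacobiTheta₂_add_left' z τ

lemma theta3_neg (τ z : ℂ) : theta3 τ (-z) = theta3 τ z := jacobiTheta₂_neg_left z τ

lemma theta2_neg (τ z : ℂ) : theta2 τ (-z) = theta2 τ z := by
  rw [theta2_eq, theta2_eq, ← theta3_neg, show z + τ / 2 = -(-z + τ / 2) + τ by ring,
    theta3_add_tau, ← mul_assoc, ← exp_add]
  congr 2
  ring

lemma theta1_neg (τ z : ℂ) : theta1 τ (-z) = -theta1 τ z := by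
  have h : ∀ w, theta1 τ w = -theta2 τ (w + 1 / 2) := fun w => by
    rw [theta2_eq, theta1_eq, show (Real.pi : ℂ) * I * τ / 4 + Real.pi * I * (w + 1 / 2) =
      Real.pi * I * τ / 4 + Real.pi * I * w + Real.pi * I * (1 / 2) by ring,
      exp_add _ (Real.pi * I * (1 / 2)), exp_half_pi_mul_I]
    ring
  rw [h, ← theta2_neg, theta2]
  ring_nf

lemma theta4_neg (τ z : ℂ) : theta4 τ (-z) = theta4 τ z := by
  rw [theta4, theta4, ← theta3_neg, ← theta3_add_one]
  ring_nf

lemma thetas_add_one (τ : ℂ) (k : Fin 4) (z : ℂ) :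
    thetas τ k (z + 1) = signOne k * thetas τ k z := by
  have h1 : ∀ z, theta1 τ (z + 1) = -theta1 τ z := fun z => by
    rw [theta1_eq, theta1_eq, show z + 1 + 1 / 2 + τ / 2 = z + 1 / 2 + τ / 2 + 1 by ring,
      theta3_add_one, show (Real.pi : ℂ) * I * τ / 4 + Real.pi * I * (z + 1) =
      Real.pi * I * τ / 4 + Real.pi * I * z + Real.pi * I by ring, exp_add _ (Real.pi * I),
      exp_pi_mul_I]
    ring
  fin_cases k
  · simp [thetas, signOne, h1]
  · simp [thetas, signOne, theta2, ← h1, add_right_comm z 1]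
  · simp [thetas, signOne, theta3_add_one]
  · simp only [thetas, signOne, theta4, Matrix.cons_val, one_mul, Fin.reduceFinMk]
    rw [add_right_comm, theta3_add_one]

lemma thetas_add_tau (τ : ℂ) (k : Fin 4) (z : ℂ) :
    thetas τ k (z + τ) = signTau k * exp (-Real.pi * I * (τ + 2 * z)) * thetas τ k z := by
  have hpi : exp (-(Real.pi * I)) = -1 := by rw [exp_neg, exp_pi_mul_I]; norm_num
  have h4 : theta4 τ (z + τ) = -exp (-Real.pi * I * (τ + 2 * z)) * theta4 τ z := by
    rw [theta4, theta4, add_right_comm, theta3_add_tau,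
      show -(Real.pi : ℂ) * I * (τ + 2 * (z + 1 / 2)) = -Real.pi * I * (τ + 2 * z) + -(Real.pi * I)
        by ring, exp_add _ (-(Real.pi * I)), hpi]
    ring
  have h2 : theta2 τ (z + τ) = exp (-Real.pi * I * (τ + 2 * z)) * theta2 τ z := by
    rw [theta2_eq, theta2_eq, add_right_comm, theta3_add_tau, ← mul_assoc, ← mul_assoc, ← exp_add,
      ← exp_add]
    congr 2
    ring
  have h1 : theta1 τ (z + τ) = -exp (-Real.pi * I * (τ + 2 * z)) * theta1 τ z := by
    rw [theta1_eq, theta1_eq, show z + τ + 1 / 2 + τ / 2 = z + 1 / 2 + τ / 2 + τ by ring,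
      theta3_add_tau, show -(Real.pi : ℂ) * I * (τ + 2 * (z + 1 / 2 + τ / 2)) =
        -Real.pi * I * (τ + 2 * z) + (-(Real.pi * I) + -(Real.pi * I * τ)) by ring,
        exp_add _ (_ + _), exp_add (-(Real.pi * I)), hpi, show (Real.pi : ℂ) * I * τ / 4 + Real.pi * I * (z + τ) =
        Real.pi * I * τ / 4 + Real.pi * I * z + Real.pi * I * τ by ring,
        exp_add _ (Real.pi * I * τ), exp_neg (Real.pi * I * τ)]
    have := exp_ne_zero (Real.pi * I * τ)
    field_simp
  fin_cases k
  · simp [thetas, signTau, h1]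
  · simp [thetas, signTau, h2]
  · simp [thetas, signTau, theta3_add_tau]
  · simp [thetas, signTau, h4]

section Addition

variable {τ : ℂ}

lemma theta4_mul_theta4 (hτ : 0 < τ.im) (x y : ℂ) :
    theta4 τ (x + y) * theta4 τ (x - y) =
      thetaA τ x * thetaA τ y - thetaB τ x * thetaB τ y := by
  have h := theta3_mul_theta3 hτ (x + 1 / 2) y
  rw [thetaA_add_half, thetaB_add_half] at h
  rw [theta4, theta4, add_right_comm, sub_add_eq_add_sub, h]
  ring

lemma theta2_mul_theta2 (hτ : 0 < τ.im) (x y : ℂ) :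
    theta2 τ (x + y) * theta2 τ (x - y) =
      thetaA τ x * thetaB τ y + thetaB τ x * thetaA τ y := by
  have h := theta3_mul_theta3 hτ (x + τ / 2) y
  rw [thetaA_add_half_period, thetaB_add_half_period] at h
  rw [theta2_eq, theta2_eq, add_right_comm, sub_add_eq_add_sub, mul_mul_mul_comm, h, ← exp_add,
    show (Real.pi : ℂ) * I * τ / 4 + Real.pi * I * (x + y) +
      (Real.pi * I * τ / 4 + Real.pi * I * (x - y)) =
      -(-(Real.pi * I * τ / 2) - 2 * Real.pi * I * x) by ring, exp_neg]
  have := exp_ne_zero (-(Real.pi * I * τ / 2) - 2 * Real.pi * I * x)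
  field_simp
  ring

lemma theta1_mul_theta1 (hτ : 0 < τ.im) (x y : ℂ) :
    theta1 τ (x + y) * theta1 τ (x - y) =
      thetaA τ x * thetaB τ y - thetaB τ x * thetaA τ y := by
  have h := theta2_mul_theta2 hτ (x - 1 / 2) y
  have h1 := thetaA_add_half τ (x - 1 / 2)
  have h2 := thetaB_add_half τ (x - 1 / 2)
  rw [sub_add_cancel] at h1 h2
  rw [theta2, theta2, show x - 1 / 2 + y + 1 / 2 = x + y by ring,
    show x - 1 / 2 - y + 1 / 2 = x - y by ring] at h
  rw [h, h1, h2]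
  ring

lemma theta1_sq (hτ : 0 < τ.im) (x : ℂ) :
    theta1 τ x ^ 2 = thetaA τ x * thetaB τ 0 - thetaB τ x * thetaA τ 0 := by
  simpa [sq] using theta1_mul_theta1 hτ x 0

lemma theta2_sq (hτ : 0 < τ.im) (x : ℂ) :
    theta2 τ x ^ 2 = thetaA τ x * thetaB τ 0 + thetaB τ x * thetaA τ 0 := by
  simpa [sq] using theta2_mul_theta2 hτ x 0

lemma theta3_sq (hτ : 0 < τ.im) (x : ℂ) :
    theta3 τ x ^ 2 = thetaA τ x * thetaA τ 0 + thetaB τ x * thetaB τ 0 := by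
  simpa [sq] using theta3_mul_theta3 hτ x 0

lemma theta4_sq (hτ : 0 < τ.im) (x : ℂ) :
    theta4 τ x ^ 2 = thetaA τ x * thetaA τ 0 - thetaB τ x * thetaB τ 0 := by
  simpa [sq] using theta4_mul_theta4 hτ x 0

end Addition

/-! ### Addition formulas with two pairs of theta functions -/

section MixedAddition

/-- Addition formulas for two pairs `f, g` and `p, r` of theta functions, where `p` is odd and
the other three are even. The first two, divided by the values at `t`, are two of the six bilinear
equations for the points with coordinates `ϑ_k(s + t) / ϑ_k(t)` and `ϑ_k(s - t) / ϑ_k(t)`; the third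
expresses `p (s - t) * r (s + t)` in terms of the values at `s` and `t`. The sign `δ` depends on the
pairs. -/
structure MixedAddition (f g p r : ℂ → ℂ) (δ : ℂ) : Prop where
  sub_mul : ∀ s t, (p (s + t) * r (s - t) - r (s + t) * p (s - t)) * (f t * g t) =
    (f (s + t) * g (s - t) + g (s + t) * f (s - t)) * (p t * r t)
  add_mul : ∀ s t, (f (s + t) * g (s - t) - g (s + t) * f (s - t)) * (f t * g t) =
    -δ * (p (s + t) * r (s - t) + r (s + t) * p (s - t)) * (p t * r t)
  diff_mul : ∀ s t, p (s - t) * r (s + t) * (f 0 * g 0) =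
    p s * r s * (f t * g t) - f s * g s * (p t * r t)

/-- The formulas hold if the products separate the variables by means of an even function `C`
and an odd function `D`. -/
lemma MixedAddition.of_separation {f g p r C D : ℂ → ℂ} {κ κ' ε δ : ℂ}
    (hC : ∀ x, C (-x) = C x) (hD : ∀ x, D (-x) = -D x)
    (h1 : ∀ x y, f (x + y) * g (x - y) = κ' * (C x * C y + ε * (D x * D y)))
    (h2 : ∀ x y, p (x + y) * r (x - y) = κ * (D x * C y + C x * D y))
    (hδ : ε * κ' ^ 2 = -δ * κ ^ 2) : MixedAddition f g p r δ := by
  have hD0 : D 0 = 0 := self_eq_neg.1 (by simpa using hD 0)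
  have h1' : ∀ x y, g (x + y) * f (x - y) = κ' * (C x * C y - ε * (D x * D y)) := fun x y => by
    have := h1 x (-y)
    rw [hC, hD, sub_neg_eq_add, ← sub_eq_add_neg] at this
    linear_combination this
  have h2' : ∀ x y, r (x + y) * p (x - y) = κ * (D x * C y - C x * D y) := fun x y => by
    have := h2 x (-y)
    rw [hC, hD, sub_neg_eq_add, ← sub_eq_add_neg] at this
    linear_combination this
  have h3 : ∀ x, f x * g x = κ' * (C x * C 0) := fun x => by
    simpa [hD0] using h1 x 0
  have h4 : ∀ x, p x * r x = κ * (D x * C 0) := fun x => by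
    simpa [hD0] using h2 x 0
  refine ⟨fun s t => ?_, fun s t => ?_, fun s t => ?_⟩
  · rw [h1, h1', h2, h2', h3, h4]
    ring
  · rw [h1, h1', h2, h2', h3, h4]
    linear_combination (2 * D s * D t * C t * C 0) * hδ
  · rw [h3, h3, h3, h4, h4, mul_comm (p (s - t)), h2']
    ring

variable {τ : ℂ}

lemma mixedAddition_one (hτ : 0 < τ.im) :
    MixedAddition (theta3 τ) (theta4 τ) (theta1 τ) (theta2 τ) 1 := by
  have hC : ∀ x, thetaA τ (-x + 1 / 4) = thetaA τ (x + 1 / 4) := fun x => by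
    rw [← thetaA_neg, ← thetaA_add_half]
    ring_nf
  have hD : ∀ x, thetaB τ (-x + 1 / 4) = -thetaB τ (x + 1 / 4) := fun x => by
    rw [← thetaB_neg τ (-x + 1 / 4), ← neg_neg (thetaB τ (-_)), ← thetaB_add_half]
    ring_nf
  refine .of_separation (C := fun x => thetaA τ (x + 1 / 4)) (D := fun x => thetaB τ (x + 1 / 4))
    (κ := -1) (κ' := 1) (ε := -1) hC hD (fun x y => ?_) (fun x y => ?_) (by norm_num)
  · have h := theta3_mul_theta3 hτ (x + 1 / 4) (y - 1 / 4)
    rw [show x + 1 / 4 + (y - 1 / 4) = x + y by ring,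
      show x + 1 / 4 - (y - 1 / 4) = x - y + 1 / 2 by ring,
      show y - 1 / 4 = -(-y + 1 / 4) by ring, thetaA_neg, thetaB_neg, hC, hD] at h
    rw [theta4, h]
    ring
  · have h := theta3_mul_theta3 hτ (x + 1 / 4 + τ / 2) (y + 1 / 4)
    rw [thetaA_add_half_period, thetaB_add_half_period,
      show x + 1 / 4 + τ / 2 + (y + 1 / 4) = x + y + 1 / 2 + τ / 2 by ring,
      show x + 1 / 4 + τ / 2 - (y + 1 / 4) = x - y + τ / 2 by ring] at h
    rw [theta1_eq, theta2_eq, mul_mul_mul_comm, h, mul_assoc (-I), ← exp_add,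
      show (Real.pi : ℂ) * I * τ / 4 + Real.pi * I * (x + y) +
      (Real.pi * I * τ / 4 + Real.pi * I * (x - y)) = -(-(Real.pi * I * τ / 2) -
        2 * Real.pi * I * (x + 1 / 4)) - Real.pi * I * (1 / 2) by ring, exp_sub (-_),
      exp_half_pi_mul_I, exp_neg]
    have := exp_ne_zero (-(Real.pi * I * τ / 2) - 2 * Real.pi * I * (x + 1 / 4))
    have := I_ne_zero
    field_simp

/-- Both remaining cases follow from formulas in terms of one function `S`, of which the even and
the odd part separate the variables. -/
lemma MixedAddition.of_reflection {f g p r S : ℂ → ℂ} {κ κ' ε δ : ℂ}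
    (h1 : ∀ x y, f (x + y) * g (x - y) = κ' *
      ((1 + ε) * (S x * S y + S (-x) * S (-y)) + (1 - ε) * (S x * S (-y) + S (-x) * S y)))
    (h2 : ∀ x y, p (x + y) * r (x - y) = κ * (S x * S y - S (-x) * S (-y)))
    (hδ : ε * (κ' * 2) ^ 2 = -δ * κ ^ 2) : MixedAddition f g p r δ := by
  refine .of_separation (C := fun x => S x + S (-x)) (D := fun x => S x - S (-x)) (ε := ε)
    (κ := κ / 2) (κ' := κ')
    (fun x => by rw [neg_neg]; ring) (fun x => by rw [neg_neg]; ring) (fun x y => ?_)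
    (fun x y => ?_) (by linear_combination hδ / 4)
  · rw [h1]
    ring
  · rw [h2]
    ring

lemma mixedAddition_two (hτ : 0 < τ.im) :
    MixedAddition (theta4 τ) (theta2 τ) (theta1 τ) (theta3 τ) (-1) := by
  set S : ℂ → ℂ := fun x => exp (Real.pi * I * x) * thetaA τ (x + (1 + τ) / 4) with hS
  have hR : ∀ x, exp (Real.pi * I * x) * thetaB τ (x + (1 + τ) / 4) = -I * S (-x) := fun x => by
    have h := thetaB_add_half_period τ (x + (1 - τ) / 4)
    rw [show x + (1 - τ) / 4 + τ / 2 = x + (1 + τ) / 4 by ring, ← thetaA_neg,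
      ← thetaA_add_half, show -(x + (1 - τ) / 4) + 1 / 2 = -x + (1 + τ) / 4 by ring] at h
    rw [h, hS, ← mul_assoc, ← mul_assoc, ← exp_add,
      show (Real.pi : ℂ) * I * x + (-(Real.pi * I * τ / 2) - 2 * Real.pi * I * (x + (1 - τ) / 4)) =
        Real.pi * I * -x - Real.pi * I * (1 / 2) by ring, exp_sub, exp_half_pi_mul_I, div_I]
    ring
  refine .of_reflection (S := S) (κ := -I * exp (Real.pi * I * τ / 4))
    (κ' := exp (Real.pi * I * τ / 4) / 2) (ε := -1) (fun x y => ?_) (fun x y => ?_)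
    (by linear_combination -(exp (Real.pi * I * τ / 4)) ^ 2 * I_sq)
  · have h := theta3_mul_theta3 hτ (x + (1 + τ) / 4) (y + (1 - τ) / 4)
    rw [show x + (1 + τ) / 4 + (y + (1 - τ) / 4) = x + y + 1 / 2 by ring,
      show x + (1 + τ) / 4 - (y + (1 - τ) / 4) = x - y + τ / 2 by ring] at h
    have h3 : exp (-(Real.pi * I * y)) * thetaA τ (y + (1 - τ) / 4) = S (-y) := by
      rw [hS, ← thetaA_neg, ← thetaA_add_half]
      ring_nf
    have h4 : exp (-(Real.pi * I * y)) * thetaB τ (y + (1 - τ) / 4) = I * S y := by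
      have := hR (-y)
      rw [neg_neg] at this
      rw [show (1 + τ) / 4 = -((1 - τ) / 4) + 1 / 2 by ring, ← add_assoc, ← neg_add,
        thetaB_add_half, thetaB_neg, mul_neg (Real.pi * I) y] at this
      linear_combination -this
    have h5 : exp (Real.pi * I * τ / 4 + Real.pi * I * (x - y)) =
        exp (Real.pi * I * τ / 4) * (exp (Real.pi * I * x) * exp (-(Real.pi * I * y))) := by
      rw [← exp_add, ← exp_add]
      ring_nf
    have h6 : exp (Real.pi * I * x) * thetaA τ (x + (1 + τ) / 4) = S x := rfl
    rw [theta4, theta2_eq, mul_left_comm, h, h5]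
    linear_combination exp (Real.pi * I * τ / 4) * (h6 *
      (exp (-(Real.pi * I * y)) * thetaA τ (y + (1 - τ) / 4)) + S x * h3 +
      hR x * (exp (-(Real.pi * I * y)) * thetaB τ (y + (1 - τ) / 4)) - I * S (-x) * h4 -
      S (-x) * S y * I_sq)
  · have h := theta3_mul_theta3 hτ (x + (1 + τ) / 4) (y + (1 + τ) / 4)
    rw [show x + (1 + τ) / 4 + (y + (1 + τ) / 4) = x + y + 1 / 2 + τ / 2 by ring,
      show x + (1 + τ) / 4 - (y + (1 + τ) / 4) = x - y by ring] at h
    have h5 : exp (Real.pi * I * τ / 4 + Real.pi * I * (x + y)) =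
        exp (Real.pi * I * τ / 4) * (exp (Real.pi * I * x) * exp (Real.pi * I * y)) := by
      rw [← exp_add, ← exp_add]
      ring_nf
    have h6 : ∀ x, exp (Real.pi * I * x) * thetaA τ (x + (1 + τ) / 4) = S x := fun _ => rfl
    rw [theta1_eq, mul_assoc, h, h5]
    linear_combination -I * exp (Real.pi * I * τ / 4) * (h6 x *
      (exp (Real.pi * I * y) * thetaA τ (y + (1 + τ) / 4)) + S x * h6 y +
      hR x * (exp (Real.pi * I * y) * thetaB τ (y + (1 + τ) / 4)) - I * S (-x) * hR y +
      S (-x) * S (-y) * I_sq)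

lemma mixedAddition_three (hτ : 0 < τ.im) :
    MixedAddition (theta2 τ) (theta3 τ) (theta1 τ) (theta4 τ) 1 := by
  set S : ℂ → ℂ := fun x => exp (Real.pi * I * x) * thetaA τ (x + τ / 4) with hS
  have hR : ∀ x, exp (Real.pi * I * x) * thetaB τ (x + τ / 4) = S (-x) := fun x => by
    have h := thetaB_add_half_period τ (x - τ / 4)
    rw [show x - τ / 4 + τ / 2 = x + τ / 4 by ring, ← thetaA_neg,
      show -(x - τ / 4) = -x + τ / 4 by ring] at h
    rw [h, hS, ← mul_assoc, ← exp_add]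
    ring_nf
  have h5 : ∀ x y, exp (Real.pi * I * τ / 4 + Real.pi * I * (x + y)) =
      exp (Real.pi * I * τ / 4) * (exp (Real.pi * I * x) * exp (Real.pi * I * y)) := fun x y => by
    rw [← exp_add, ← exp_add]
    ring_nf
  have h6 : ∀ x, exp (Real.pi * I * x) * thetaA τ (x + τ / 4) = S x := fun _ => rfl
  refine .of_reflection (S := S) (κ := -I * exp (Real.pi * I * τ / 4))
    (κ' := exp (Real.pi * I * τ / 4) / 2) (ε := 1) (fun x y => ?_) (fun x y => ?_)
    (by linear_combination (exp (Real.pi * I * τ / 4)) ^ 2 * I_sq)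
  · have h := theta3_mul_theta3 hτ (x + τ / 4) (y + τ / 4)
    rw [show x + τ / 4 + (y + τ / 4) = x + y + τ / 2 by ring, add_sub_add_right_eq_sub] at h
    rw [theta2_eq, mul_assoc, h, h5]
    linear_combination exp (Real.pi * I * τ / 4) * (h6 x *
      (exp (Real.pi * I * y) * thetaA τ (y + τ / 4)) + S x * h6 y +
      hR x * (exp (Real.pi * I * y) * thetaB τ (y + τ / 4)) + S (-x) * hR y)
  · have h := theta3_mul_theta3 hτ (x + τ / 4 + 1 / 2) (y + τ / 4)
    rw [thetaA_add_half, thetaB_add_half,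
      show x + τ / 4 + 1 / 2 + (y + τ / 4) = x + y + 1 / 2 + τ / 2 by ring,
      show x + τ / 4 + 1 / 2 - (y + τ / 4) = x - y + 1 / 2 by ring] at h
    rw [theta1_eq, theta4, mul_assoc, h, h5]
    linear_combination -I * exp (Real.pi * I * τ / 4) * (h6 x *
      (exp (Real.pi * I * y) * thetaA τ (y + τ / 4)) + S x * h6 y -
      hR x * (exp (Real.pi * I * y) * thetaB τ (y + τ / 4)) - S (-x) * hR y)

end MixedAddition

/-! ### Entire functions with two quasi-periods -/

lemma entire_mul_eq_zero {f g : ℂ → ℂ} (hf : Differentiable ℂ f) (hg : Differentiable ℂ g)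
    (h : ∀ z, f z * g z = 0) : (∀ z, f z = 0) ∨ ∀ z, g z = 0 := by
  have := AnalyticOnNhd.eq_zero_or_eq_zero_of_smul_eq_zero
    (hf.differentiableOn.analyticOnNhd isOpen_univ) (hg.differentiableOn.analyticOnNhd isOpen_univ)
    (fun z _ => h z) isPreconnected_univ
  simpa using this

/-- Liouville's theorem for a function on the torus `ℂ / (ℤ + ℤτ)`. -/
lemma entire_doubly_periodic_const {τ : ℂ} (hτ : 0 < τ.im) {f : ℂ → ℂ} (hf : Differentiable ℂ f)
    (h1 : ∀ z, f (z + 1) = f z) (h2 : ∀ z, f (z + τ) = f z) (z w : ℂ) : f z = f w := by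
  have h1' : ∀ (n : ℤ) z, f (z + n) = f z := fun n z => by
    simpa using (Function.Periodic.int_mul (show Function.Periodic f 1 from h1) n) z
  have h2' : ∀ (n : ℤ) z, f (z + n * τ) = f z := fun n z =>
    (Function.Periodic.int_mul (show Function.Periodic f τ from h2) n) z
  apply hf.apply_eq_apply_of_bounded
  have hK : IsCompact ((fun p : ℝ × ℝ => f (p.1 + p.2 * τ)) '' (Set.Icc 0 1 ×ˢ Set.Icc 0 1)) := by
    apply (isCompact_Icc.prod isCompact_Icc).image
    have := hf.continuous
    fun_prop
  refine hK.isBounded.subset ?_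
  rintro _ ⟨z, rfl⟩
  -- the real coordinates of `z` with respect to `1, τ`
  set y := z.im / τ.im
  set x := z.re - y * τ.re
  have hz : z = x + y * τ := by
    apply Complex.ext
    · simp [x]
    · simp [y, hτ.ne']
  refine ⟨(Int.fract x, Int.fract y), ⟨⟨Int.fract_nonneg _, (Int.fract_lt_one _).le⟩,
    ⟨Int.fract_nonneg _, (Int.fract_lt_one _).le⟩⟩, ?_⟩
  have hx := Int.floor_add_fract x
  have hy := Int.floor_add_fract y
  have hx' : (x : ℂ) = ⌊x⌋ + (Int.fract x : ℝ) := by exact_mod_cast hx.symm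
  have hy' : (y : ℂ) = ⌊y⌋ + (Int.fract y : ℝ) := by exact_mod_cast hy.symm
  simp only
  rw [← h1' ⌊x⌋, ← h2' ⌊y⌋, hz, hx', hy']
  ring_nf

/-- An entire function without zeros which has multipliers `ε` and `exp (a + b z)` for the periods
`1` and `τ` is an exponential, and the second multiplier is constant: its logarithmic derivative
`G` satisfies `G (z + 1) = G z` and `G (z + τ) = G z + b`, so that first `G'` and then `G` is
constant. -/
lemma quasiperiodic_zero_free {τ : ℂ} (hτ : 0 < τ.im) {g : ℂ → ℂ} (hg : Differentiable ℂ g)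
    {ε a b : ℂ} (h1 : ∀ z, g (z + 1) = ε * g z) (h2 : ∀ z, g (z + τ) = exp (a + b * z) * g z)
    (h0 : ∀ z, g z ≠ 0) : b = 0 ∧ ∃ c, ∀ z, g z = g 0 * exp (c * z) := by
  have hε : ε ≠ 0 := by
    rintro rfl
    exact h0 1 (by simpa using h1 0)
  set G : ℂ → ℂ := fun z => deriv g z / g z
  have hg' : Differentiable ℂ (deriv g) :=
    (hg.contDiff (n := 2)).differentiable_deriv_two
  have hG : Differentiable ℂ G := hg'.div hg h0
  have hd1 : ∀ z, deriv g (z + 1) = ε * deriv g z := fun z => by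
    rw [← deriv_comp_add_const, funext h1, deriv_const_mul _ (hg z)]
  have hd2 : ∀ z, deriv g (z + τ) = exp (a + b * z) * (b * g z + deriv g z) := fun z => by
    rw [← deriv_comp_add_const, funext h2]
    have h : HasDerivAt (fun z => exp (a + b * z)) (exp (a + b * z) * b) z := by
      simpa using (((hasDerivAt_id z).const_mul b).const_add a).cexp
    rw [(h.fun_mul (hg z).hasDerivAt).deriv]
    ring
  have hG1 : ∀ z, G (z + 1) = G z := fun z => by
    simp only [G, h1, hd1]
    exact mul_div_mul_left _ _ hε
  have hG2 : ∀ z, G (z + τ) = b + G z := fun z => by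
    simp only [G, h2, hd2]
    rw [mul_div_mul_left _ _ (exp_ne_zero _), add_div, mul_div_cancel_right₀ _ (h0 z)]
  have hG' : Differentiable ℂ (deriv G) := (hG.contDiff (n := 2)).differentiable_deriv_two
  have hc : ∀ z, deriv G z = deriv G 0 := fun z => by
    refine entire_doubly_periodic_const hτ hG' (fun z => ?_) (fun z => ?_) z 0
    · rw [← deriv_comp_add_const, funext hG1]
    · rw [← deriv_comp_add_const, funext hG2, deriv_const_add]
  have hlin : ∀ z, G z = deriv G 0 * z + G 0 := fun z => by
    have h : ∀ z, HasDerivAt (fun z => G z - deriv G 0 * z) 0 z := fun z => by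
      simpa [hc z] using (hG z).hasDerivAt.fun_sub ((hasDerivAt_id z).const_mul (deriv G 0))
    have := is_const_of_deriv_eq_zero (fun z => (h z).differentiableAt) (fun z => (h z).deriv) z 0
    linear_combination this
  have hc0 : deriv G 0 = 0 := by
    have := hlin 1
    rw [show (1 : ℂ) = 0 + 1 by ring, hG1] at this
    linear_combination -this
  have hconst : ∀ z, G z = G 0 := fun z => by rw [hlin, hc0]; ring
  refine ⟨?_, G 0, fun z => ?_⟩
  · have := hG2 0
    rw [hconst (0 + τ)] at this
    linear_combination -this
  · have h : ∀ z, HasDerivAt (fun z => g z * exp (-(G 0 * z))) 0 z := fun z => by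
      have h := (hg z).hasDerivAt.mul (((hasDerivAt_id z).const_mul (G 0)).neg.cexp)
      have hz : deriv g z = G 0 * g z := by
        rw [← hconst z]
        exact (div_mul_cancel₀ _ (h0 z)).symm
      refine h.congr_deriv ?_
      simp only [id, hz]
      ring
    have := is_const_of_deriv_eq_zero (fun z => (h z).differentiableAt) (fun z => (h z).deriv) z 0
    simp only [mul_zero, neg_zero, exp_zero, mul_one] at this
    rw [← this, mul_assoc, ← exp_add]
    simp

/-! ### The zeros of the theta functions -/

lemma differentiable_theta3 {τ : ℂ} (hτ : 0 < τ.im) : Differentiable ℂ (theta3 τ) :=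
  fun z => differentiableAt_jacobiTheta₂_fst z hτ

lemma differentiable_thetas {τ : ℂ} (hτ : 0 < τ.im) (k : Fin 4) :
    Differentiable ℂ (thetas τ k) := by
  have h3 := differentiable_theta3 hτ
  have h1 : Differentiable ℂ (theta1 τ) := by
    rw [funext (theta1_eq τ)]
    fun_prop
  fin_cases k
  · exact h1
  · exact h1.comp (differentiable_id.add_const _)
  · exact h3
  · exact h3.comp (differentiable_id.add_const _)

lemma jacobiTheta_ne_zero_of_one_le {τ : ℂ} (hτ : 1 ≤ τ.im) : jacobiTheta₂ 0 τ ≠ 0 := by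
  rw [← jacobiTheta_eq_jacobiTheta₂]
  intro h
  have hb := norm_jacobiTheta_sub_one_le (zero_lt_one.trans_le hτ)
  rw [h, zero_sub, norm_neg, norm_one] at hb
  have hr : Real.exp (-Real.pi * τ.im) < 1 / 4 := by
    have h1 : Real.pi * τ.im + 1 ≤ Real.exp (Real.pi * τ.im) := Real.add_one_le_exp _
    have h2 : 4 < Real.exp (Real.pi * τ.im) := by nlinarith [Real.pi_gt_three]
    rw [neg_mul, Real.exp_neg, one_div]
    exact inv_strictAnti₀ (by norm_num) h2
  have hp := Real.exp_pos (-Real.pi * τ.im)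
  rw [div_mul_eq_mul_div, le_div_iff₀ (by linarith)] at hb
  linarith

/-- If `ϑ₃` vanished for `τ`, so it would for `2τ` by the addition formulas, and so for
parameters of arbitrarily large imaginary part. -/
lemma exists_theta3_ne_zero {τ : ℂ} (hτ : 0 < τ.im) : ∃ z, theta3 τ z ≠ 0 := by
  by_contra! h
  have key : ∀ n : ℕ, ∀ z, theta3 (2 ^ n * τ) z = 0 := by
    intro n
    induction n with
    | zero => simpa using h
    | succ n ih =>
      intro z
      have him : 0 < (2 ^ n * τ).im := by
        have : (2 ^ n * τ : ℂ).im = 2 ^ n * τ.im := by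
          rw [← Complex.im_ofReal_mul]
          norm_cast
        rw [this]
        positivity
      have h3 := theta3_mul_theta3 him (z / 2) (z / 2)
      have h4 := theta4_mul_theta4 him (z / 2) (z / 2)
      simp only [theta4, ih, zero_mul] at h3 h4
      have h5 : thetaA (2 ^ n * τ) (z / 2) = 0 := by
        have : thetaA (2 ^ n * τ) (z / 2) ^ 2 = 0 := by linear_combination -(h3 + h4) / 2
        simpa using this
      rw [← h5, thetaA, theta3]
      ring_nf
  obtain ⟨n, hn⟩ := pow_unbounded_of_one_lt (1 / τ.im) (one_lt_two : (1 : ℝ) < 2)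
  refine jacobiTheta_ne_zero_of_one_le ?_ (key n 0)
  have : (2 ^ n * τ : ℂ).im = 2 ^ n * τ.im := by
    rw [← Complex.im_ofReal_mul]
    norm_cast
  rw [this]
  exact ((div_lt_iff₀ hτ).1 hn).le

lemma exists_thetas_ne_zero {τ : ℂ} (hτ : 0 < τ.im) (k : Fin 4) : ∃ z, thetas τ k z ≠ 0 := by
  obtain ⟨z, hz⟩ := exists_theta3_ne_zero hτ
  have h1 : theta1 τ (z - 1 / 2 - τ / 2) ≠ 0 := by
    rw [theta1_eq, show z - 1 / 2 - τ / 2 + 1 / 2 + τ / 2 = z by ring]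
    exact mul_ne_zero (mul_ne_zero (neg_ne_zero.2 I_ne_zero) (exp_ne_zero _)) hz
  fin_cases k
  · exact ⟨_, h1⟩
  · refine ⟨z - 1 / 2 - τ / 2 - 1 / 2, ?_⟩
    simpa [thetas, theta2] using h1
  · exact ⟨z, hz⟩
  · refine ⟨z - 1 / 2, ?_⟩
    simpa [thetas, theta4] using hz

lemma thetas_zero_mul {τ : ℂ} (hτ : 0 < τ.im) {k : Fin 4} (hk : k ≠ 0) (x y : ℂ) :
    thetas τ 0 (x + y) * thetas τ 0 (x - y) * thetas τ k 0 ^ 2 =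
      thetas τ 0 x ^ 2 * thetas τ k y ^ 2 - thetas τ k x ^ 2 * thetas τ 0 y ^ 2 := by
  have h := theta1_mul_theta1 hτ x y
  fin_cases k
  · exact absurd rfl hk
  all_goals
    simp only [thetas, Matrix.cons_val, Fin.reduceFinMk, Matrix.cons_val_zero, Fin.mk_one,
      Matrix.cons_val_one, h, theta1_sq hτ, theta2_sq hτ, theta3_sq hτ, theta4_sq hτ]
    ring

/-- The squares of two of the theta functions are not proportional, since the functions
themselves would be so but have different multipliers. -/
lemma thetas_sq_not_proportional {τ : ℂ} (hτ : 0 < τ.im) {i k : Fin 4} (hik : i ≠ k) (c : ℂ) :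
    ¬ ∀ x, thetas τ i x ^ 2 = c * thetas τ k x ^ 2 := by
  intro h
  obtain ⟨d, rfl⟩ : ∃ d, c = d ^ 2 := ⟨c ^ (1 / 2 : ℂ), by
    rw [← cpow_nat_mul]; simp⟩
  have hd := differentiable_thetas hτ
  obtain ⟨e, he⟩ : ∃ e, ∀ x, thetas τ i x = e * thetas τ k x := by
    have := entire_mul_eq_zero ((hd i).sub ((hd k).const_mul d))
      ((hd i).add ((hd k).const_mul d)) (fun z => by
        simp only [Pi.sub_apply, Pi.add_apply]
        linear_combination h z)
    rcases this with h | h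
    · exact ⟨d, fun x => sub_eq_zero.1 (h x)⟩
    · exact ⟨-d, fun x => by rw [neg_mul]; exact eq_neg_of_add_eq_zero_left (h x)⟩
  obtain ⟨z, hz⟩ := exists_thetas_ne_zero hτ i
  have h1 : signOne i = signOne k := by
    have h1 := thetas_add_one τ i z
    rw [he, thetas_add_one, mul_left_comm, ← he] at h1
    exact (mul_right_cancel₀ hz h1).symm
  have h2 : signTau i = signTau k := by
    have h1 := thetas_add_tau τ i z
    rw [he, thetas_add_tau, mul_left_comm, ← he] at h1
    exact (mul_right_cancel₀ (exp_ne_zero _) (mul_right_cancel₀ hz h1)).symm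
  revert h1 h2 hik
  fin_cases i <;> fin_cases k <;> norm_num [signOne, signTau]

lemma thetas_at_zero_ne_zero {τ : ℂ} (hτ : 0 < τ.im) {k : Fin 4} (hk : k ≠ 0) :
    thetas τ k 0 ≠ 0 := by
  intro h
  obtain ⟨y, hy⟩ := exists_thetas_ne_zero hτ k
  refine thetas_sq_not_proportional hτ hk.symm (thetas τ 0 y ^ 2 / thetas τ k y ^ 2) fun x => ?_
  have := thetas_zero_mul hτ hk x y
  rw [h] at this
  field_simp
  linear_combination -this

lemma theta1_zero (τ : ℂ) : theta1 τ 0 = 0 := self_eq_neg.1 (by simpa using theta1_neg τ 0)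

lemma theta1_sq_of_theta34 {τ : ℂ} (hτ : 0 < τ.im) (x : ℂ) :
    theta2 τ 0 ^ 2 * theta1 τ x ^ 2 =
      theta3 τ 0 ^ 2 * theta4 τ x ^ 2 - theta4 τ 0 ^ 2 * theta3 τ x ^ 2 := by
  simp only [theta1_sq hτ, theta2_sq hτ, theta3_sq hτ, theta4_sq hτ]
  ring

lemma theta1_sq_of_theta24 {τ : ℂ} (hτ : 0 < τ.im) (x : ℂ) :
    theta3 τ 0 ^ 2 * theta1 τ x ^ 2 =
      theta2 τ 0 ^ 2 * theta4 τ x ^ 2 - theta4 τ 0 ^ 2 * theta2 τ x ^ 2 := by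
  simp only [theta1_sq hτ, theta2_sq hτ, theta3_sq hτ, theta4_sq hτ]
  ring

lemma theta1_sq_of_theta23 {τ : ℂ} (hτ : 0 < τ.im) (x : ℂ) :
    theta4 τ 0 ^ 2 * theta1 τ x ^ 2 =
      theta2 τ 0 ^ 2 * theta3 τ x ^ 2 - theta3 τ 0 ^ 2 * theta2 τ x ^ 2 := by
  simp only [theta1_sq hτ, theta2_sq hτ, theta3_sq hτ, theta4_sq hτ]
  ring

/-- At a common zero of `ϑ₁` and another theta function, the product formula would make `ϑ₁`
vanish identically. -/
lemma thetas_ne_zero_of_theta1_eq_zero {τ : ℂ} (hτ : 0 < τ.im) {k : Fin 4} (hk : k ≠ 0) {x : ℂ}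
    (h1 : theta1 τ x = 0) : thetas τ k x ≠ 0 := by
  intro h
  have hprod : ∀ y, thetas τ 0 (x + y) * thetas τ 0 (x - y) = 0 := fun y => by
    have := thetas_zero_mul hτ hk x y
    rw [h, show thetas τ 0 x = 0 from h1] at this
    simpa [thetas_at_zero_ne_zero hτ hk] using this
  have hd := differentiable_thetas hτ 0
  obtain ⟨z, hz⟩ := exists_thetas_ne_zero hτ 0
  rcases entire_mul_eq_zero (f := fun y => thetas τ 0 (x + y)) (g := fun y => thetas τ 0 (x - y))
    (by fun_prop) (by fun_prop) hprod with h | h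
  · exact hz (by simpa using h (z - x))
  · exact hz (by simpa using h (x - z))

lemma thetas_no_common_zero {τ : ℂ} (hτ : 0 < τ.im) {i k : Fin 4} (hik : i ≠ k) {x : ℂ}
    (hi : thetas τ i x = 0) : thetas τ k x ≠ 0 := by
  intro hk
  have n2 := thetas_at_zero_ne_zero hτ (k := 1) (by decide)
  have n3 := thetas_at_zero_ne_zero hτ (k := 2) (by decide)
  have n4 := thetas_at_zero_ne_zero hτ (k := 3) (by decide)
  -- the square of `ϑ₁` is a combination of those of any other two
  have h1 : theta1 τ x = 0 := by
    have e2 := theta1_sq_of_theta34 hτ x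
    have e3 := theta1_sq_of_theta24 hτ x
    have e4 := theta1_sq_of_theta23 hτ x
    simp only [thetas, Matrix.cons_val, Matrix.cons_val_one] at n2 n3 n4
    fin_cases i <;> fin_cases k <;> first | exact absurd rfl hik | skip
    all_goals
      simp only [thetas, Matrix.cons_val, Fin.reduceFinMk, Matrix.cons_val_zero, Fin.mk_one,
        Matrix.cons_val_one, Fin.zero_eta] at hi hk
      first
      | exact hi
      | exact hk
      | simpa [hi, hk, n2] using e2
      | simpa [hi, hk, n3] using e3
      | simpa [hi, hk, n4] using e4
  by_cases h0 : i = 0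
  · exact thetas_ne_zero_of_theta1_eq_zero hτ (h0 ▸ hik).symm h1 hk
  · exact thetas_ne_zero_of_theta1_eq_zero hτ h0 h1 hi

/-- A common quasi-period of the four theta functions may be iterated. -/
lemma thetas_add_zsmul {τ v : ℂ} {s : Fin 4 → ℂ} (hs : ∀ k, s k ≠ 0)
    (h : ∀ z, ∃ μ : ℂ, μ ≠ 0 ∧ ∀ k, thetas τ k (z + v) = μ * s k * thetas τ k z) (n : ℤ) :
    ∀ z, ∃ μ : ℂ, μ ≠ 0 ∧ ∀ k, thetas τ k (z + n * v) = μ * s k ^ n * thetas τ k z := by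
  induction n with
  | zero => exact fun z => ⟨1, one_ne_zero, by simp⟩
  | succ n ih =>
    intro z
    obtain ⟨μ, hμ, h1⟩ := ih z
    obtain ⟨ν, hν, h2⟩ := h (z + n * v)
    push_cast at h1 ⊢
    refine ⟨μ * ν, mul_ne_zero hμ hν, fun k => ?_⟩
    rw [add_one_mul, ← add_assoc, h2, h1, zpow_add_one₀ (hs k)]
    ring
  | pred n ih =>
    intro z
    obtain ⟨μ, hμ, h1⟩ := ih z
    obtain ⟨ν, hν, h2⟩ := h (z + (-n - 1) * v)
    push_cast at h1 ⊢
    refine ⟨μ / ν, div_ne_zero hμ hν, fun k => ?_⟩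
    have h3 := h2 k
    rw [show z + (-(n : ℂ) - 1) * v + v = z + -n * v by ring, h1] at h3
    rw [zpow_sub_one₀ (hs k)]
    have := hs k
    field_simp
    linear_combination -h3

lemma signOne_mul_self (k : Fin 4) : signOne k * signOne k = 1 := by
  fin_cases k <;> simp [signOne]

lemma signTau_mul_self (k : Fin 4) : signTau k * signTau k = 1 := by
  fin_cases k <;> simp [signTau]

lemma signOne_ne_zero (k : Fin 4) : signOne k ≠ 0 :=
  left_ne_zero_of_mul_eq_one (signOne_mul_self k)

lemma signTau_ne_zero (k : Fin 4) : signTau k ≠ 0 :=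
  left_ne_zero_of_mul_eq_one (signTau_mul_self k)

lemma thetas_add_lattice (τ : ℂ) (m n : ℤ) (z : ℂ) : ∃ μ : ℂ, μ ≠ 0 ∧ ∀ k,
    thetas τ k (z + (m + n * τ)) = μ * (signOne k ^ m * signTau k ^ n) * thetas τ k z := by
  obtain ⟨μ, hμ, h1⟩ := thetas_add_zsmul (v := 1) signOne_ne_zero
    (fun z => ⟨1, one_ne_zero, fun k => by rw [thetas_add_one, one_mul]⟩) m z
  obtain ⟨ν, hν, h2⟩ := thetas_add_zsmul (v := τ) signTau_ne_zero
    (fun z => ⟨_, exp_ne_zero _, fun k => by rw [thetas_add_tau τ k z, mul_comm (signTau k)]⟩) n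
      (z + m * 1)
  refine ⟨μ * ν, mul_ne_zero hμ hν, fun k => ?_⟩
  rw [← add_assoc, ← mul_one (m : ℂ), h2, h1]
  ring

/-- The zeros of `ϑ₁` are the points of the lattice. If `ϑ₁` vanishes at `p`, then the product
formulas show that `ϑ₁(w + p)ϑ_k(w - p)` is a multiple of `ϑ₁(w)ϑ_k(w)` for all `k`, so that
`ϑ₁(w + p)/ϑ₁(w)` is an entire function without zeros, and hence an exponential. -/
theorem theta1_eq_zero_iff {τ : ℂ} (hτ : 0 < τ.im) (p : ℂ) :
    theta1 τ p = 0 ↔ p ∈ latticeL τ := by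
  constructor
  swap
  · rintro ⟨m, n, rfl⟩
    obtain ⟨μ, -, h⟩ := thetas_add_lattice τ m n 0
    have := h 0
    rwa [zero_add, show thetas τ 0 0 = 0 from theta1_zero τ, mul_zero] at this
  intro hp
  have hp' : theta1 τ (-p) = 0 := by rw [theta1_neg, hp, neg_zero]
  have n2 := thetas_at_zero_ne_zero hτ (k := 1) (by decide)
  have n3 := thetas_at_zero_ne_zero hτ (k := 2) (by decide)
  have n4 := thetas_at_zero_ne_zero hτ (k := 3) (by decide)
  have p2 := thetas_ne_zero_of_theta1_eq_zero hτ (k := 1) (by decide) hp'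
  have p3 := thetas_ne_zero_of_theta1_eq_zero hτ (k := 2) (by decide) hp'
  have p4 := thetas_ne_zero_of_theta1_eq_zero hτ (k := 3) (by decide) hp'
  have hd := differentiable_thetas hτ
  obtain ⟨c, hc0, hc⟩ : ∃ c : ℂ, c ≠ 0 ∧ ∀ w, thetas τ 0 (w + p) * thetas τ 1 (w - p) =
      c * (thetas τ 0 w * thetas τ 1 w) := by
    refine ⟨thetas τ 2 (-p) * thetas τ 3 (-p) / (thetas τ 2 0 * thetas τ 3 0),
      div_ne_zero (mul_ne_zero p3 p4) (mul_ne_zero n3 n4), fun w => ?_⟩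
    have h := (mixedAddition_one hτ).diff_mul w (-p)
    rw [hp', sub_neg_eq_add, ← sub_eq_add_neg, zero_mul, mul_zero, sub_zero] at h
    rw [div_mul_eq_mul_div, eq_div_iff (mul_ne_zero n3 n4)]
    exact h.trans (mul_comm _ _)
  obtain ⟨d, hd0, hd'⟩ : ∃ d : ℂ, d ≠ 0 ∧ ∀ w, thetas τ 0 (w + p) * thetas τ 2 (w - p) =
      d * (thetas τ 0 w * thetas τ 2 w) := by
    refine ⟨thetas τ 3 (-p) * thetas τ 1 (-p) / (thetas τ 3 0 * thetas τ 1 0),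
      div_ne_zero (mul_ne_zero p4 p2) (mul_ne_zero n4 n2), fun w => ?_⟩
    have h := (mixedAddition_two hτ).diff_mul w (-p)
    rw [hp', sub_neg_eq_add, ← sub_eq_add_neg, zero_mul, mul_zero, sub_zero] at h
    rw [div_mul_eq_mul_div, eq_div_iff (mul_ne_zero n4 n2)]
    exact h.trans (mul_comm _ _)
  have hcompat : ∀ w, c * thetas τ 1 w * thetas τ 2 (w - p) =
      d * thetas τ 2 w * thetas τ 1 (w - p) := by
    obtain ⟨z, hz⟩ := exists_thetas_ne_zero hτ 0
    have := entire_mul_eq_zero (f := thetas τ 0)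
      (g := fun w => c * thetas τ 1 w * thetas τ 2 (w - p) - d * thetas τ 2 w * thetas τ 1 (w - p))
      (hd 0) (by have := hd 1; have := hd 2; fun_prop) (fun w => by
        linear_combination -thetas τ 2 (w - p) * hc w + thetas τ 1 (w - p) * hd' w)
    exact fun w => sub_eq_zero.1 ((this.resolve_left fun h => hz (h z)) w)
  classical
  -- the quotient `ϑ₁(w + p)/ϑ₁(w)`
  set g : ℂ → ℂ := fun w => if thetas τ 1 (w - p) = 0 then d * thetas τ 2 w / thetas τ 2 (w - p)
    else c * thetas τ 1 w / thetas τ 1 (w - p) with hg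
  have g1 : ∀ w, thetas τ 1 (w - p) * g w = c * thetas τ 1 w := fun w => by
    by_cases h : thetas τ 1 (w - p) = 0
    · have h2 := thetas_no_common_zero hτ (i := 1) (k := 2) (by decide) h
      have := hcompat w
      rw [h, mul_zero, mul_eq_zero] at this
      rw [h, zero_mul, this.resolve_right h2]
    · simp only [hg, if_neg h]
      exact mul_div_cancel₀ _ h
  have g2 : ∀ w, thetas τ 2 (w - p) * g w = d * thetas τ 2 w := fun w => by
    by_cases h : thetas τ 1 (w - p) = 0
    · have h2 := thetas_no_common_zero hτ (i := 1) (k := 2) (by decide) h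
      simp only [hg, if_pos h]
      exact mul_div_cancel₀ _ h2
    · refine mul_left_cancel₀ h ?_
      linear_combination thetas τ 2 (w - p) * g1 w + hcompat w
  have hne : ∀ w, g w ≠ 0 := fun w h => by
    have e1 := g1 w
    have e2 := g2 w
    rw [h, mul_zero, eq_comm, mul_eq_zero] at e1 e2
    exact thetas_no_common_zero hτ (i := 1) (k := 2) (by decide) (e1.resolve_left hc0)
      (e2.resolve_left hd0)
  have hdiff : ∀ (k : Fin 4) (e w : ℂ), (∀ w, thetas τ k (w - p) * g w = e * thetas τ k w) →
      thetas τ k (w - p) ≠ 0 → DifferentiableAt ℂ g w := fun k e w he h => by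
    have hk := hd k
    have h1 : Differentiable ℂ fun w => thetas τ k (w - p) := by fun_prop
    have h2 : DifferentiableAt ℂ (fun w => e * thetas τ k w / thetas τ k (w - p)) w :=
      ((hk w).const_mul e).fun_div (h1 w) h
    refine h2.congr_of_eventuallyEq ?_
    filter_upwards [h1.continuous.continuousAt.eventually_ne h] with v hv
    rw [eq_div_iff hv, ← he, mul_comm]
  have hgd : Differentiable ℂ g := fun w => by
    by_cases h : thetas τ 1 (w - p) = 0
    · exact hdiff 2 d w g2 (thetas_no_common_zero hτ (by decide) h)
    · exact hdiff 1 c w g1 h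
  -- an equality may be checked after multiplication by `ϑ₂` or by `ϑ₃`
  have hcancel : ∀ {w x y : ℂ}, thetas τ 1 w * x = thetas τ 1 w * y →
      thetas τ 2 w * x = thetas τ 2 w * y → x = y := fun {w x y} h1 h2 => by
    by_cases h : thetas τ 1 w = 0
    · exact mul_left_cancel₀ (thetas_no_common_zero hτ (by decide) h) h2
    · exact mul_left_cancel₀ h h1
  have hper : ∀ w, g (w + 1) = 1 * g w := fun w => by
    have aux : ∀ k e, (∀ w, thetas τ k (w - p) * g w = e * thetas τ k w) →
        thetas τ k (w - p) * g (w + 1) = thetas τ k (w - p) * g w := fun k e he => by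
      have h1 := he (w + 1)
      rw [add_sub_right_comm, thetas_add_one, thetas_add_one] at h1
      refine mul_left_cancel₀ (signOne_ne_zero k) ?_
      rw [he]
      linear_combination h1
    rw [one_mul]
    exact hcancel (aux 1 c g1) (aux 2 d g2)
  have hqper : ∀ w, g (w + τ) = exp (-2 * Real.pi * I * p + 0 * w) * g w := fun w => by
    have aux : ∀ k e, (∀ w, thetas τ k (w - p) * g w = e * thetas τ k w) →
        thetas τ k (w - p) * g (w + τ) = thetas τ k (w - p) *
          (exp (-2 * Real.pi * I * p + 0 * w) * g w) := fun k e he => by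
      have h1 := he (w + τ)
      rw [add_sub_right_comm, thetas_add_tau, thetas_add_tau,
        show -(Real.pi : ℂ) * I * (τ + 2 * w) = -Real.pi * I * (τ + 2 * (w - p)) +
          (-2 * Real.pi * I * p + 0 * w) by ring, exp_add (_ * (_ + _))] at h1
      refine mul_left_cancel₀ (mul_ne_zero (signTau_ne_zero k)
        (exp_ne_zero (-Real.pi * I * (τ + 2 * (w - p))))) ?_
      rw [mul_left_comm (thetas τ k (w - p)), he]
      linear_combination h1
    exact hcancel (aux 1 c g1) (aux 2 d g2)
  obtain ⟨-, e, he⟩ := quasiperiodic_zero_free hτ hgd hper hqper hne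
  have e1 := hper 0
  rw [zero_add, he 1, one_mul, mul_one] at e1
  have e2 := hqper 0
  rw [zero_add, he τ, mul_zero, add_zero, mul_comm] at e2
  obtain ⟨m, hm⟩ := exp_eq_one_iff.1 (mul_left_cancel₀ (hne 0) (e1.trans (mul_one _).symm))
  obtain ⟨n, hn⟩ := exp_eq_exp_iff_exists_int.1 (mul_right_cancel₀ (hne 0) e2)
  refine ⟨n, -m, ?_⟩
  rw [hm] at hn
  have hpi : (2 * Real.pi * I : ℂ) ≠ 0 := two_pi_I_ne_zero
  refine mul_left_cancel₀ hpi ?_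
  push_cast
  linear_combination hn

/-! ### The modular function `ϑ₄(0)⁴ / ϑ₃(0)⁴` -/

open Filter Topology UpperHalfPlane ModularForm in
open scoped MatrixGroups Manifold in
/-- A holomorphic function on the upper half plane which is invariant under the modular group and
vanishes at `i∞` is zero: it is a modular form of weight zero. -/
lemma modular_function_eq_zero {F : ℂ → ℂ} (hd : ∀ τ : ℂ, 0 < τ.im → DifferentiableAt ℂ F τ)
    (hT : ∀ τ : ℂ, 0 < τ.im → F (τ + 1) = F τ) (hS : ∀ τ : ℂ, 0 < τ.im → F (-1 / τ) = F τ)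
    (h0 : Tendsto F (comap im atTop) (𝓝 0)) (τ : ℂ) (hτ : 0 < τ.im) : F τ = 0 := by
  set f : ℍ → ℂ := fun z => F z with hf
  have h0' : Tendsto f atImInfty (𝓝 0) := h0.comp tendsto_coe_atImInfty
  have fS : f ∣[(0 : ℤ)] ModularGroup.S = f := by
    ext z
    have := hS z z.2
    rw [SL_slash_apply, UpperHalfPlane.modular_S_smul]
    simpa [hf, neg_div] using this
  have fT : f ∣[(0 : ℤ)] ModularGroup.T = f := by
    ext z
    have := hT z z.2
    rw [SL_slash_apply, modular_T_smul]
    simpa [hf, add_comm] using this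
  let φ : ModularForm 𝒮ℒ 0 :=
    { toFun := f
      slash_action_eq' := by
        rintro A ⟨A, rfl⟩
        exact SlashInvariantForm.slash_action_generators_SL2Z fS fT A
      holo' := by
        rw [UpperHalfPlane.mdifferentiable_iff]
        refine DifferentiableOn.congr (f := F) (fun z hz => (hd z hz).differentiableWithinAt) ?_
        intro z hz
        simp [hf, ofComplex_apply_of_im_pos hz]
      bdd_at_cusps' := by
        intro c hc
        rw [Subgroup.IsArithmetic.isCusp_iff_isCusp_SL2Z] at hc
        rw [OnePoint.isBoundedAt_iff_forall_SL2Z hc]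
        intro γ _
        rw [SlashInvariantForm.slash_action_generators_SL2Z fS fT]
        exact h0'.isBigO_one ℝ }
  obtain ⟨c, hc⟩ := ModularFormClass.levelOne_weight_zero_const φ
  have hc' : f = Function.const _ c := hc
  have hc0 : c = 0 := by
    rw [hc'] at h0'
    exact tendsto_nhds_unique tendsto_const_nhds h0'
  exact (congr_fun hc' ⟨τ, hτ⟩).trans hc0

/-- `ϑ₃(0)⁴`, as a function of `τ`. -/
noncomputable def thetaX (τ : ℂ) : ℂ := theta3 τ 0 ^ 4

/-- `ϑ₄(0)⁴`, as a function of `τ`. -/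
noncomputable def thetaY (τ : ℂ) : ℂ := theta4 τ 0 ^ 4

lemma theta4_zero_eq (τ : ℂ) : theta4 τ 0 = theta3 (τ + 1) 0 := by
  refine tsum_congr fun n => ?_
  simp only [jacobiTheta₂_term]
  obtain ⟨k, hk⟩ : Even (n ^ 2 - n) := by
    rw [sq, ← mul_sub_one]
    exact Int.even_mul_pred_self n
  rw [exp_eq_exp_iff_exists_int]
  refine ⟨-k, ?_⟩
  have hk' : (n : ℂ) ^ 2 - n = k + k := by exact_mod_cast hk
  push_cast
  linear_combination -(Real.pi * I : ℂ) * hk'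

lemma thetaX_add_one (τ : ℂ) : thetaX (τ + 1) = thetaY τ := by
  rw [thetaX, thetaY, theta4_zero_eq]

lemma thetaY_add_one (τ : ℂ) : thetaY (τ + 1) = thetaX τ := by
  rw [thetaX, thetaY, theta4_zero_eq, add_assoc, one_add_one_eq_two, theta3,
    jacobiTheta₂_add_right, theta3]

lemma cpow_half_pow_four (τ : ℂ) : ((-I * τ) ^ (1 / 2 : ℂ)) ^ 4 = -τ ^ 2 := by
  have h : ((-I * τ) ^ (1 / 2 : ℂ)) ^ 2 = -I * τ := by
    rw [← cpow_nat_mul]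
    simp
  rw [show (4 : ℕ) = 2 * 2 by norm_num, pow_mul, h]
  linear_combination τ ^ 2 * I_sq

lemma neg_I_mul_cpow_ne_zero {τ : ℂ} (hτ : 0 < τ.im) : (-I * τ) ^ (1 / 2 : ℂ) ≠ 0 := by
  have h0 : τ ≠ 0 := by
    rintro rfl
    simp at hτ
  simp [cpow_eq_zero_iff, h0]

lemma thetaX_inv {τ : ℂ} (hτ : 0 < τ.im) : thetaX (-1 / τ) = -τ ^ 2 * thetaX τ := by
  have h := jacobiTheta₂_functional_equation 0 τ
  have h0 := neg_I_mul_cpow_ne_zero hτ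
  have h1 : jacobiTheta₂ 0 (-1 / τ) = (-I * τ) ^ (1 / 2 : ℂ) * jacobiTheta₂ 0 τ := by
    rw [h]
    simp only [ne_eq, OfNat.ofNat_ne_zero, not_false_eq_true, zero_pow, mul_zero, zero_div,
      exp_zero, mul_one]
    rw [← mul_assoc, mul_one_div_cancel h0, one_mul]
  rw [thetaX, thetaX, theta3, theta3, h1, mul_pow, cpow_half_pow_four]

lemma theta2_zero_pow_four {τ : ℂ} (hτ : 0 < τ.im) : theta2 τ 0 ^ 4 = thetaX τ - thetaY τ := by
  have h2 := theta2_sq hτ 0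
  have h3 := theta3_sq hτ 0
  have h4 := theta4_sq hτ 0
  rw [thetaX, thetaY, show (4 : ℕ) = 2 * 2 by norm_num, pow_mul, pow_mul, pow_mul, h2, h3, h4]
  ring

lemma thetaY_inv {τ : ℂ} (hτ : 0 < τ.im) :
    thetaY (-1 / τ) = -τ ^ 2 * (thetaX τ - thetaY τ) := by
  have h := jacobiTheta₂_functional_equation (τ / 2) τ
  have h0 := neg_I_mul_cpow_ne_zero hτ
  have ht : τ ≠ 0 := by
    rintro rfl
    simp at hτ
  have h1 : theta4 (-1 / τ) 0 = (-I * τ) ^ (1 / 2 : ℂ) * theta2 τ 0 := by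
    rw [theta2_eq, theta3, theta4, theta3, zero_add, zero_add, h,
      show τ / 2 / τ = 1 / 2 by field_simp,
      show -Real.pi * I * (τ / 2) ^ 2 / τ = -(Real.pi * I * τ / 4 + Real.pi * I * 0) by
        field_simp; ring, exp_neg]
    have := exp_ne_zero (Real.pi * I * τ / 4 + Real.pi * I * 0)
    field_simp
  rw [← theta2_zero_pow_four hτ, thetaY, h1, mul_pow, cpow_half_pow_four]

open Filter Topology in
lemma tendsto_thetaX : Tendsto thetaX (comap im atTop) (𝓝 1) := by
  have h : Tendsto (fun τ => jacobiTheta τ - 1) (comap im atTop) (𝓝 0) := by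
    refine isBigO_at_im_infty_jacobiTheta_sub_one.trans_tendsto ?_
    have h1 : Tendsto (fun t : ℝ => Real.exp (-Real.pi * t)) atTop (𝓝 0) :=
      Real.tendsto_exp_atBot.comp (tendsto_id.const_mul_atTop_of_neg (neg_lt_zero.2 Real.pi_pos))
    exact h1.comp tendsto_comap
  have h2 := (h.add_const 1).pow 4
  simp only [sub_add_cancel, zero_add, one_pow, jacobiTheta_eq_jacobiTheta₂] at h2
  exact h2

open Filter Topology in
lemma tendsto_thetaY : Tendsto thetaY (comap im atTop) (𝓝 1) := by
  have h : Tendsto (fun τ : ℂ => τ + 1) (comap im atTop) (comap im atTop) := by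
    rw [tendsto_comap_iff]
    refine tendsto_comap.congr fun τ => ?_
    simp
  exact (tendsto_thetaX.comp h).congr thetaX_add_one

lemma differentiableAt_thetaX {τ : ℂ} (hτ : 0 < τ.im) : DifferentiableAt ℂ thetaX τ :=
  (differentiableAt_jacobiTheta₂_snd 0 hτ).pow 4

lemma differentiableAt_thetaY {τ : ℂ} (hτ : 0 < τ.im) : DifferentiableAt ℂ thetaY τ :=
  (differentiableAt_jacobiTheta₂_snd _ hτ).pow 4

lemma thetaX_ne_zero {τ : ℂ} (hτ : 0 < τ.im) : thetaX τ ≠ 0 :=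
  pow_ne_zero _ (thetas_at_zero_ne_zero hτ (k := 2) (by decide))

lemma thetaY_ne_zero {τ : ℂ} (hτ : 0 < τ.im) : thetaY τ ≠ 0 :=
  pow_ne_zero _ (thetas_at_zero_ne_zero hτ (k := 3) (by decide))

lemma thetaX_sub_thetaY_ne_zero {τ : ℂ} (hτ : 0 < τ.im) : thetaX τ - thetaY τ ≠ 0 := by
  rw [← theta2_zero_pow_four hτ]
  exact pow_ne_zero _ (thetas_at_zero_ne_zero hτ (k := 1) (by decide))

open Filter Topology in
/-- The modular invariant takes every value. Otherwise its difference with that value would have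
an inverse which is holomorphic, invariant, and zero at `i∞`. -/
lemma exists_modular_invariant_eq (c : ℂ) : ∃ τ : ℂ, 0 < τ.im ∧
    (thetaX τ ^ 2 - thetaX τ * thetaY τ + thetaY τ ^ 2) ^ 3 =
      c * (thetaX τ * thetaY τ * (thetaX τ - thetaY τ)) ^ 2 := by
  by_contra! h
  set F : ℂ → ℂ := fun τ => (thetaX τ * thetaY τ * (thetaX τ - thetaY τ)) ^ 2 /
    ((thetaX τ ^ 2 - thetaX τ * thetaY τ + thetaY τ ^ 2) ^ 3 -
      c * (thetaX τ * thetaY τ * (thetaX τ - thetaY τ)) ^ 2) with hF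
  have key : ∀ τ : ℂ, 0 < τ.im → F τ = 0 := by
    refine modular_function_eq_zero (fun τ hτ => ?_) (fun τ hτ => ?_) (fun τ hτ => ?_) ?_
    · have := differentiableAt_thetaX hτ
      have := differentiableAt_thetaY hτ
      have := sub_ne_zero.2 (h τ hτ)
      fun_prop (disch := assumption)
    · simp only [hF, thetaX_add_one, thetaY_add_one]
      congr 1 <;> ring
    · have ht : τ ≠ 0 := by
        rintro rfl
        simp at hτ
      simp only [hF, thetaX_inv hτ, thetaY_inv hτ]
      refine Eq.trans ?_ (mul_div_mul_left _ _ (pow_ne_zero 12 ht))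
      congr 1 <;> ring
    · have hX := tendsto_thetaX
      have hY := tendsto_thetaY
      have hD := ((hX.mul hY).mul (hX.sub hY)).pow 2
      have hN := (((hX.pow 2).sub (hX.mul hY)).add (hY.pow 2)).pow 3
      have : Tendsto F (comap im atTop) _ := hD.div (hN.sub (hD.const_mul c)) (by simp)
      simpa using this
  have hI : 0 < I.im := by simp
  have hne : F I ≠ 0 := div_ne_zero (pow_ne_zero _ (mul_ne_zero (mul_ne_zero (thetaX_ne_zero hI)
    (thetaY_ne_zero hI)) (thetaX_sub_thetaY_ne_zero hI))) (sub_ne_zero.2 (h I hI))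
  exact hne (key I hI)

/-- The function `ϑ₄(0)⁴ / ϑ₃(0)⁴` takes all values except `0` and `1`: the modular invariant
determines it up to the action of the group of order six generated by `μ ↦ 1/μ` and `μ ↦ 1 - μ`,
which is realised by modular substitutions. -/
theorem exists_thetaY_eq_mul_thetaX {μ : ℂ} (h0 : μ ≠ 0) (h1 : μ ≠ 1) :
    ∃ τ : ℂ, 0 < τ.im ∧ thetaY τ = μ * thetaX τ := by
  obtain ⟨τ, hτ, h⟩ := exists_modular_invariant_eq ((1 - μ + μ ^ 2) ^ 3 / (μ * (1 - μ)) ^ 2)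
  have h1' : 1 - μ ≠ 0 := sub_ne_zero.2 h1.symm
  have hT : ∀ {τ : ℂ} {x : ℂ}, x ≠ 0 → (0 < τ.im ∧ thetaY τ = x * thetaX τ) →
      ∃ σ : ℂ, 0 < σ.im ∧ thetaY σ = x⁻¹ * thetaX σ := fun {τ x} hx ⟨ht, h⟩ => by
    refine ⟨τ + 1, by simpa using ht, ?_⟩
    rw [thetaX_add_one, thetaY_add_one, h]
    field_simp
  have hS : ∀ {τ : ℂ} {x : ℂ}, (0 < τ.im ∧ thetaY τ = x * thetaX τ) →
      ∃ σ : ℂ, 0 < σ.im ∧ thetaY σ = (1 - x) * thetaX σ := fun {τ x} ⟨ht, h⟩ => by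
    refine ⟨-1 / τ, ?_, ?_⟩
    · rw [neg_div, one_div, neg_im, inv_im]
      have : τ ≠ 0 := by
        rintro rfl
        simp at ht
      have := normSq_pos.2 this
      rw [neg_div, neg_neg]
      positivity
    · rw [thetaX_inv ht, thetaY_inv ht, h]
      ring
  set x := thetaX τ
  set y := thetaY τ
  have hx : x ≠ 0 := thetaX_ne_zero hτ
  rw [div_mul_eq_mul_div, eq_div_iff (pow_ne_zero _ (mul_ne_zero h0 h1'))] at h
  have hfac : (y - μ * x) * (y - (1 - μ) * x) * (μ * y - x) * ((1 - μ) * y - x) *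
      ((1 - μ) * y - -μ * x) * (μ * y - (μ - 1) * x) = 0 := by
    linear_combination h
  simp only [mul_eq_zero, sub_eq_zero] at hfac
  rcases hfac with ((((hc | hc) | hc) | hc) | hc) | hc
  · exact ⟨τ, hτ, hc⟩
  · obtain ⟨σ, hσ⟩ := hS ⟨hτ, hc⟩
    exact ⟨σ, by simpa using hσ⟩
  · obtain ⟨σ, hσ⟩ := hT (x := μ⁻¹) (inv_ne_zero h0)
      ⟨hτ, by rw [eq_inv_mul_iff_mul_eq₀ h0]; exact hc⟩
    exact ⟨σ, by simpa using hσ⟩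
  · obtain ⟨σ, hσ⟩ := hT (x := (1 - μ)⁻¹) (inv_ne_zero h1')
      ⟨hτ, by rw [eq_inv_mul_iff_mul_eq₀ h1']; exact hc⟩
    obtain ⟨ρ, hρ⟩ := hS hσ
    exact ⟨ρ, by simpa using hρ⟩
  · -- here `y = μ / (μ - 1) * x`
    obtain ⟨σ, hσ⟩ := hS (x := 1 - (1 - μ)⁻¹) ⟨hτ, by
      field_simp
      linear_combination hc⟩
    obtain ⟨ρ, hρ⟩ := hT (x := (1 - μ)⁻¹) (inv_ne_zero h1') (by simpa using hσ)
    obtain ⟨κ, hκ⟩ := hS hρ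
    exact ⟨κ, by simpa using hκ⟩
  · obtain ⟨σ, hσ⟩ := hS (x := 1 - μ⁻¹) ⟨hτ, by
      field_simp
      linear_combination hc⟩
    obtain ⟨ρ, hρ⟩ := hT (x := μ⁻¹) (inv_ne_zero h0) (by simpa using hσ)
    exact ⟨ρ, by simpa using hρ⟩

/-! ### The elliptic parametrization of the fibers -/

/-- A quadratic theta function has a zero, by its multipliers. -/
lemma exists_zero_thetas_sq {τ : ℂ} (hτ : 0 < τ.im) (i k : Fin 4) (α β : ℂ) :
    ∃ w, α * thetas τ i w ^ 2 + β * thetas τ k w ^ 2 = 0 := by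
  by_contra! h
  have hd := differentiable_thetas hτ
  have := (quasiperiodic_zero_free hτ (ε := 1) (a := -2 * Real.pi * I * τ) (b := -4 * Real.pi * I)
    (g := fun w => α * thetas τ i w ^ 2 + β * thetas τ k w ^ 2)
    (by have := hd i; have := hd k; fun_prop) (fun z => ?_) (fun z => ?_) h).1
  · simp [Real.pi_ne_zero] at this
  · simp only [thetas_add_one]
    linear_combination (α * thetas τ i z ^ 2) * signOne_mul_self i +
      (β * thetas τ k z ^ 2) * signOne_mul_self k
  · have he : exp (-2 * Real.pi * I * τ + -4 * Real.pi * I * z) =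
        exp (-Real.pi * I * (τ + 2 * z)) ^ 2 := by
      rw [← exp_nat_mul]
      push_cast
      ring_nf
    simp only [thetas_add_tau, he]
    linear_combination exp (-Real.pi * I * (τ + 2 * z)) ^ 2 *
      ((α * thetas τ i z ^ 2) * signTau_mul_self i + (β * thetas τ k z ^ 2) * signTau_mul_self k)

lemma Phi_sub (u : Fin 4 → ℂ) : Phi u 0 - Phi u 1 = (u 0 - u 3) * (u 2 - u 1) ∧
    Phi u 1 - Phi u 2 = (u 0 - u 1) * (u 3 - u 2) ∧
    Phi u 2 - Phi u 0 = (u 0 - u 2) * (u 1 - u 3) := by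
  simp only [Phi, Matrix.cons_val]
  refine ⟨?_, ?_, ?_⟩ <;> ring

lemma Generic.add_ne_zero {u : Fin 4 → ℂ} (hu : Generic u) {μ ν : Fin 4} (h : μ ≠ ν) :
    u μ + u ν ≠ 0 := fun h0 => (hu μ ν h).2 (eq_neg_of_add_eq_zero_left h0)

lemma Generic.sub_ne_zero {u : Fin 4 → ℂ} (hu : Generic u) {μ ν : Fin 4} (h : μ ≠ ν) :
    u μ - u ν ≠ 0 := fun h0 => (hu μ ν h).1 (sub_eq_zero.1 h0)

lemma Generic.Phi_ne_zero {u : Fin 4 → ℂ} (hu : Generic u) (i : Fin 3) : Phi u i ≠ 0 := by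
  fin_cases i
  · exact mul_ne_zero (hu.add_ne_zero (by decide)) (hu.add_ne_zero (by decide))
  · exact mul_ne_zero (hu.add_ne_zero (by decide)) (hu.add_ne_zero (by decide))
  · exact mul_ne_zero (hu.add_ne_zero (by decide)) (hu.add_ne_zero (by decide))

lemma Generic.Phi_ne {u : Fin 4 → ℂ} (hu : Generic u) :
    Phi u 0 ≠ Phi u 1 ∧ Phi u 1 ≠ Phi u 2 ∧ Phi u 2 ≠ Phi u 0 := by
  obtain ⟨h1, h2, h3⟩ := Phi_sub u
  refine ⟨?_, ?_, ?_⟩ <;> rw [← _root_.sub_ne_zero]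
  · exact h1 ▸ mul_ne_zero (hu.sub_ne_zero (by decide)) (hu.sub_ne_zero (by decide))
  · exact h2 ▸ mul_ne_zero (hu.sub_ne_zero (by decide)) (hu.sub_ne_zero (by decide))
  · exact h3 ▸ mul_ne_zero (hu.sub_ne_zero (by decide)) (hu.sub_ne_zero (by decide))

/-- Elliptic parameters exist: `τ` is determined by the cross-ratio
`(1/a - 1/b) / (1/a - 1/c) = ϑ₄(0)⁴ / ϑ₃(0)⁴`, and then `η` by the ratio of `a` and `b`. -/
theorem exists_isEllipticParam {u : Fin 4 → ℂ} (hu : Generic u) : ∃ τ η, IsEllipticParam u τ η := by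
  set a := Phi u 0 with ha'
  set b := Phi u 1 with hb'
  set c := Phi u 2 with hc'
  have ha : a ≠ 0 := hu.Phi_ne_zero 0
  have hb : b ≠ 0 := hu.Phi_ne_zero 1
  have hc : c ≠ 0 := hu.Phi_ne_zero 2
  obtain ⟨hab, hbc, hca⟩ := hu.Phi_ne
  have hab' : b - a ≠ 0 := _root_.sub_ne_zero.2 hab.symm
  have hca' : c - a ≠ 0 := _root_.sub_ne_zero.2 hca
  obtain ⟨τ, hτ, hXY⟩ := exists_thetaY_eq_mul_thetaX (μ := c * (b - a) / (b * (c - a)))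
    (div_ne_zero (mul_ne_zero hc hab') (mul_ne_zero hb hca')) (fun h => by
      rw [div_eq_one_iff_eq (mul_ne_zero hb hca')] at h
      have : a * (b - c) = 0 := by linear_combination h
      exact mul_ne_zero ha (_root_.sub_ne_zero.2 hbc) this)
  obtain ⟨η, hη⟩ := exists_zero_thetas_sq hτ 1 2 (a * theta3 τ 0 ^ 2) (-(b * theta2 τ 0 ^ 2))
  have n2 : theta2 τ 0 ≠ 0 := thetas_at_zero_ne_zero hτ (k := 1) (by decide)
  have n3 : theta3 τ 0 ≠ 0 := thetas_at_zero_ne_zero hτ (k := 2) (by decide)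
  have n4 : theta4 τ 0 ≠ 0 := thetas_at_zero_ne_zero hτ (k := 3) (by decide)
  replace hη : a * theta3 τ 0 ^ 2 * theta2 τ η ^ 2 = b * theta2 τ 0 ^ 2 * theta3 τ η ^ 2 := by
    simp only [thetas, Matrix.cons_val, Matrix.cons_val_one] at hη
    linear_combination hη
  have hno : theta2 τ η = 0 → theta3 τ η ≠ 0 :=
    fun h => thetas_no_common_zero hτ (i := 1) (k := 2) (by decide) h
  have h2 : theta2 τ η ≠ 0 := fun h => by
    rw [h] at hη
    have : b * theta2 τ 0 ^ 2 * theta3 τ η ^ 2 = 0 := by rw [← hη]; ring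
    exact mul_ne_zero (mul_ne_zero hb (pow_ne_zero 2 n2)) (pow_ne_zero 2 (hno h)) this
  have h3 : theta3 τ η ≠ 0 := fun h => by
    rw [h] at hη
    have : a * theta3 τ 0 ^ 2 * theta2 τ η ^ 2 = 0 := by rw [hη]; ring
    exact mul_ne_zero (mul_ne_zero ha (pow_ne_zero 2 n3)) (pow_ne_zero 2 h2) this
  have hY : b * (c - a) * theta4 τ 0 ^ 4 = c * (b - a) * theta3 τ 0 ^ 4 := by
    rw [thetaX, thetaY] at hXY
    rw [hXY]
    field_simp
  have hZ := theta2_zero_pow_four hτ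
  rw [thetaX, thetaY] at hZ
  -- the linear relation between the squares of `ϑ₂, ϑ₃, ϑ₄`
  have hrel : theta3 τ 0 ^ 2 * theta3 τ η ^ 2 =
      theta4 τ 0 ^ 2 * theta4 τ η ^ 2 + theta2 τ 0 ^ 2 * theta2 τ η ^ 2 := by
    refine mul_left_cancel₀ (pow_ne_zero 2 n3) ?_
    linear_combination (theta4 τ 0 ^ 2) * theta1_sq_of_theta34 hτ η -
      (theta2 τ 0 ^ 2) * theta1_sq_of_theta23 hτ η - theta3 τ η ^ 2 * hZ
  have h4 : c * theta2 τ 0 ^ 2 * theta4 τ η ^ 2 = a * theta4 τ 0 ^ 2 * theta2 τ η ^ 2 := by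
    refine mul_left_cancel₀ (mul_ne_zero (mul_ne_zero hb hca') (pow_ne_zero 2 n4)) ?_
    linear_combination -(c - a) * b * c * theta2 τ 0 ^ 2 * hrel -
      (c - a) * c * theta3 τ 0 ^ 2 * hη - b * c * (c - a) * theta2 τ η ^ 2 * hZ + theta2 τ η ^ 2 * (c - a) * hY
  have h4' : theta4 τ η ≠ 0 := fun h => by
    rw [h] at h4
    have : a * theta4 τ 0 ^ 2 * theta2 τ η ^ 2 = 0 := by rw [← h4]; ring
    exact mul_ne_zero (mul_ne_zero ha (pow_ne_zero 2 n4)) (pow_ne_zero 2 h2) this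
  refine ⟨τ, η, hτ, a * theta2 τ η ^ 2 / theta2 τ 0 ^ 2,
    div_ne_zero (mul_ne_zero ha (pow_ne_zero 2 h2)) (pow_ne_zero 2 n2), ?_⟩
  ext i
  fin_cases i
  · simp only [Pi.smul_apply, smul_eq_mul, Fin.zero_eta, Matrix.cons_val_zero, ← ha']
    field_simp
  · simp only [Pi.smul_apply, smul_eq_mul, Fin.mk_one, Matrix.cons_val_one, Matrix.cons_val_zero,
      ← hb']
    field_simp
    linear_combination -hη
  · simp only [Pi.smul_apply, smul_eq_mul, Fin.reduceFinMk, Matrix.cons_val, ← hc']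
    field_simp
    linear_combination h4

lemma psi_apply (τ η z : ℂ) (k : Fin 4) :
    psi τ η z k = thetas τ k (2 * z - η) / thetas τ k η := by
  have h : 2 * (z - η / 2) = 2 * z - η := by ring
  fin_cases k <;> simp only [psi, phiTheta, h] <;> rfl

lemma IsEllipticParam.theta_ne_zero {u : Fin 4 → ℂ} (hu : Generic u) {τ η : ℂ}
    (h : IsEllipticParam u τ η) (k : Fin 4) : thetas τ k η ≠ 0 := by
  obtain ⟨hτ, t, ht, h⟩ := h
  have e : ∀ i, Phi u i = t * _ := fun i => congr_fun h i
  have n2 : theta2 τ η ≠ 0 := fun h0 => hu.Phi_ne_zero 0 (by rw [e]; simp [h0])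
  have n3 : theta3 τ η ≠ 0 := fun h0 => hu.Phi_ne_zero 1 (by rw [e]; simp [h0])
  have n4 : theta4 τ η ≠ 0 := fun h0 => hu.Phi_ne_zero 2 (by rw [e]; simp [h0])
  have n1 : theta1 τ η ≠ 0 := fun h0 => hu.Phi_ne.2.1 (by
    rw [e, e]
    have := theta1_sq_of_theta34 hτ η
    rw [h0] at this
    simp only [Matrix.cons_val, Matrix.cons_val_one]
    field_simp
    linear_combination -this)
  fin_cases k
  exacts [n1, n2, n3, n4]

/-- `Z` satisfies the equations of the curve `F_u` in the coordinates `Z_μ`: the differences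
`Z₀² - Z_k²` are proportional to `(a, b, c)`. -/
def OnCurve (u Z : Fin 4 → ℂ) : Prop :=
  ∃ T : ℂ, Z 0 ^ 2 - Z 1 ^ 2 = T * Phi u 0 ∧ Z 0 ^ 2 - Z 2 ^ 2 = T * Phi u 1 ∧
    Z 0 ^ 2 - Z 3 ^ 2 = T * Phi u 2

lemma OnCurve.psi {u : Fin 4 → ℂ} (hu : Generic u) {τ η : ℂ} (h : IsEllipticParam u τ η) (z : ℂ) :
    OnCurve u (psi τ η z) := by
  have hn := h.theta_ne_zero hu
  obtain ⟨hτ, t, ht, h⟩ := h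
  have e : ∀ i, Phi u i = t * _ := fun i => congr_fun h i
  refine ⟨theta1 τ (2 * z - η + η) * theta1 τ (2 * z - η - η) / (theta1 τ η ^ 2 * t), ?_, ?_, ?_⟩
  · have h1 := thetas_zero_mul hτ (k := 1) (by decide) (2 * z - η) η
    have n0 := hn 0
    have n1 := hn 1
    rw [psi_apply, psi_apply, e]
    simp only [thetas, Matrix.cons_val_one, Matrix.cons_val_zero] at h1 n0 n1 ⊢
    field_simp
    linear_combination -h1
  · have h1 := thetas_zero_mul hτ (k := 2) (by decide) (2 * z - η) η
    have n0 := hn 0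
    have n1 := hn 2
    rw [psi_apply, psi_apply, e]
    simp only [thetas, Matrix.cons_val, Matrix.cons_val_zero] at h1 n0 n1 ⊢
    field_simp
    linear_combination -h1
  · have h1 := thetas_zero_mul hτ (k := 3) (by decide) (2 * z - η) η
    have n0 := hn 0
    have n1 := hn 3
    rw [psi_apply, psi_apply, e]
    simp only [thetas, Matrix.cons_val, Matrix.cons_val_zero] at h1 n0 n1 ⊢
    field_simp
    linear_combination -h1

lemma psi_ne_zero {u : Fin 4 → ℂ} (hu : Generic u) {τ η : ℂ} (h : IsEllipticParam u τ η) (z : ℂ) :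
    psi τ η z ≠ 0 := by
  intro h0
  have hn := h.theta_ne_zero hu
  have hk : ∀ k, thetas τ k (2 * z - η) = 0 := fun k => by
    have := congr_fun h0 k
    rw [psi_apply] at this
    simpa [hn k] using this
  exact thetas_no_common_zero h.1 (i := 0) (k := 1) (by decide) (hk 0) (hk 1)

/-- The signs by which `ϑ₁, …, ϑ₄` are multiplied under `z ↦ -z`. -/
def signNeg : Fin 4 → ℂ := ![-1, 1, 1, 1]

lemma thetas_neg (τ : ℂ) (k : Fin 4) (z : ℂ) : thetas τ k (-z) = signNeg k * thetas τ k z := by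
  fin_cases k
  · simp [thetas, signNeg, theta1_neg]
  · simp [thetas, signNeg, theta2_neg]
  · simp [thetas, signNeg, theta3_neg]
  · simp [thetas, signNeg, theta4_neg]

lemma eq_neg_one_pow {x : ℂ} (h : x = 1 ∨ x = -1) : ∃ n : ℕ, x = (-1) ^ n := by
  rcases h with rfl | rfl
  · exact ⟨0, by simp⟩
  · exact ⟨1, by simp⟩

/-- The half-periods and the reflection `z ↦ -z` realise all changes of sign of the four
coordinates. -/
lemma exists_thetas_signs (τ w : ℂ) {ε : Fin 4 → ℂ} (hε : ∀ k, ε k = 1 ∨ ε k = -1) :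
    ∃ w' μ : ℂ, μ ≠ 0 ∧ ∀ k, ε k * thetas τ k w = μ * thetas τ k w' := by
  have hmul : ∀ {x y : ℂ}, (x = 1 ∨ x = -1) → (y = 1 ∨ y = -1) → (x * y = 1 ∨ x * y = -1) := by
    rintro x y (rfl | rfl) (rfl | rfl) <;> simp
  have hsq : ∀ k, ε k * ε k = 1 := fun k => by rcases hε k with h | h <;> simp [h]
  obtain ⟨m, hm⟩ := eq_neg_one_pow (hmul (hε 1) (hε 2))
  obtain ⟨n, hn⟩ := eq_neg_one_pow (hmul (hε 3) (hε 2))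
  obtain ⟨j, hj⟩ := eq_neg_one_pow (hmul (hmul (hε 0) (hε 2)) (hmul (hε 1) (hε 3)))
  obtain ⟨ν, hν, h⟩ := thetas_add_lattice τ m n ((-1) ^ j * w)
  have hneg : ∀ k, thetas τ k ((-1) ^ j * w) = signNeg k ^ j * thetas τ k w := fun k => by
    rcases Nat.even_or_odd j with hj | hj
    · have : signNeg k ^ j = 1 := by
        fin_cases k <;> simp [signNeg, hj.neg_one_pow]
      rw [hj.neg_one_pow, this, one_mul, one_mul]
    · have : signNeg k ^ j = signNeg k := by
        fin_cases k <;> simp [signNeg, hj.neg_one_pow]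
      rw [hj.neg_one_pow, this, neg_one_mul, thetas_neg]
  refine ⟨(-1) ^ j * w + ((m : ℤ) + (n : ℤ) * τ), ε 2 / ν, div_ne_zero ?_ hν, fun k => ?_⟩
  · exact left_ne_zero_of_mul_eq_one (hsq 2)
  · rw [h, hneg, zpow_natCast, zpow_natCast]
    have key : ε k = ε 2 * (signOne k ^ m * signTau k ^ n * signNeg k ^ j) := by
      fin_cases k
      · change ε 0 = ε 2 * ((-1) ^ m * (-1) ^ n * (-1) ^ j)
        rw [← hm, ← hn, ← hj]
        linear_combination -ε 0 * ε 3 ^ 2 * ε 2 ^ 4 * hsq 1 - ε 0 * ε 2 ^ 4 * hsq 3 -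
          ε 0 * (ε 2 ^ 2 + 1) * hsq 2
      · change ε 1 = ε 2 * ((-1) ^ m * 1 ^ n * 1 ^ j)
        rw [← hm, one_pow, one_pow]
        linear_combination -ε 1 * hsq 2
      · simp [signOne, signTau, signNeg]
      · change ε 3 = ε 2 * (1 ^ m * (-1) ^ n * 1 ^ j)
        rw [← hn, one_pow, one_pow]
        linear_combination -ε 3 * hsq 2
    rw [key]
    field_simp

/-- Every point of the curve is in the image of `ψ`. The squares of its coordinates are on a line,
of which one coordinate ratio is a parameter, and that ratio is attained by the theta functions;
the signs of the coordinates may then be adjusted. -/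
lemma OnCurve.exists_psi {u : Fin 4 → ℂ} (hu : Generic u) {τ η : ℂ} (h : IsEllipticParam u τ η)
    {Z : Fin 4 → ℂ} (hZ : OnCurve u Z) (hZ0 : Z ≠ 0) :
    ∃ z μ : ℂ, μ ≠ 0 ∧ Z = μ • NCSphere.psi τ η z := by
  have hn := h.theta_ne_zero hu
  obtain ⟨w, hw⟩ := exists_zero_thetas_sq h.1 0 1 (Z 1 ^ 2 / thetas τ 0 η ^ 2)
    (-(Z 0 ^ 2 / thetas τ 1 η ^ 2))
  set x : Fin 4 → ℂ := fun k => thetas τ k w / thetas τ k η with hx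
  have hpsi : ∀ w, NCSphere.psi τ η ((w + η) / 2) = fun k => thetas τ k w / thetas τ k η :=
    fun w => by
      ext k
      rw [psi_apply]
      ring_nf
  obtain ⟨T', e1, e2, e3⟩ : OnCurve u x := by
    rw [hx, ← hpsi]
    exact OnCurve.psi hu h _
  obtain ⟨T, f1, f2, f3⟩ := hZ
  have hw' : Z 1 ^ 2 * x 0 ^ 2 = Z 0 ^ 2 * x 1 ^ 2 := by
    simp only [hx]
    linear_combination hw
  obtain ⟨l, l0, l1⟩ : ∃ l : ℂ, Z 0 ^ 2 = l * x 0 ^ 2 ∧ Z 1 ^ 2 = l * x 1 ^ 2 := by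
    by_cases h0 : x 0 = 0
    · have h1 : x 1 ≠ 0 := by
        have := thetas_no_common_zero h.1 (i := 0) (k := 1) (x := w) (by decide)
          (by simpa [hx, hn 0] using h0)
        exact div_ne_zero this (hn 1)
      refine ⟨Z 1 ^ 2 / x 1 ^ 2, ?_, by field_simp⟩
      field_simp
      linear_combination -hw'
    · refine ⟨Z 0 ^ 2 / x 0 ^ 2, by field_simp, ?_⟩
      field_simp
      linear_combination hw'
  have hT : T = l * T' := mul_right_cancel₀ (hu.Phi_ne_zero 0) (by
    linear_combination l0 - l1 - f1 + l * e1)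
  obtain ⟨r, rfl⟩ : ∃ r, l = r ^ 2 := ⟨l ^ (1 / 2 : ℂ), by
    rw [← cpow_nat_mul]; simp⟩
  have hsq : ∀ k, Z k ^ 2 = (r * x k) ^ 2 := by
    have l2 : Z 2 ^ 2 = (r * x 2) ^ 2 := by
      linear_combination l0 - f2 + r ^ 2 * e2 - Phi u 1 * hT
    have l3 : Z 3 ^ 2 = (r * x 3) ^ 2 := by
      linear_combination l0 - f3 + r ^ 2 * e3 - Phi u 2 * hT
    rw [← mul_pow] at l0 l1
    intro k
    fin_cases k
    exacts [l0, l1, l2, l3]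
  have hε : ∀ k, ∃ e : ℂ, (e = 1 ∨ e = -1) ∧ Z k = e * (r * x k) := fun k => by
    rcases sq_eq_sq_iff_eq_or_eq_neg.1 (hsq k) with h | h
    · exact ⟨1, .inl rfl, by rw [h, one_mul]⟩
    · exact ⟨-1, .inr rfl, by rw [h, neg_one_mul]⟩
  choose ε hε hZε using hε
  obtain ⟨w', μ, hμ, hw''⟩ := exists_thetas_signs τ w hε
  have hr : r ≠ 0 := by
    rintro rfl
    exact hZ0 (funext fun k => by simpa using hZε k)
  refine ⟨(w' + η) / 2, r * μ, mul_ne_zero hr hμ, ?_⟩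
  rw [hpsi]
  ext k
  rw [hZε, hx]
  simp only [Pi.smul_apply, smul_eq_mul]
  linear_combination (r / thetas τ k η) * hw'' k

/-- `σ` in homogeneous coordinates: `x` and `y` satisfy the six bilinear equations which the
relations of `A_u` in terms of the generators `Y_μ` define. -/
def GammaRel (u x y : Fin 4 → ℂ) : Prop :=
  ∀ k l m, IsCyclic123 k l m →
    x 0 * y k - x k * y 0 = x l * y m + x m * y l ∧
    x l * y m - x m * y l = -(J u k l m * (x 0 * y k + x k * y 0))

lemma J_mul_Phi {u : Fin 4 → ℂ} (hu : Generic u) : J u 1 2 3 * Phi u 0 = Phi u 1 - Phi u 2 ∧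
    J u 2 3 1 * Phi u 1 = Phi u 2 - Phi u 0 ∧ J u 3 1 2 * Phi u 2 = Phi u 0 - Phi u 1 := by
  refine ⟨?_, ?_, ?_⟩
  · exact div_mul_cancel₀ _ (hu.Phi_ne_zero 0)
  · exact div_mul_cancel₀ _ (hu.Phi_ne_zero 1)
  · exact div_mul_cancel₀ _ (hu.Phi_ne_zero 2)

/-- The differential addition formulas in the coordinates of `ψ`, where the points `s + t` and
`s - t` differ by `2t`. -/
lemma MixedAddition.rel {f g p r : ℂ → ℂ} {δ j : ℂ} (h : MixedAddition f g p r δ) {t : ℂ}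
    (hf : f t ≠ 0) (hg : g t ≠ 0) (hp : p t ≠ 0) (hr : r t ≠ 0)
    (hj : j * (f t * g t) ^ 2 = δ * (p t * r t) ^ 2) (s : ℂ) :
    p (s + t) / p t * (r (s - t) / r t) - r (s + t) / r t * (p (s - t) / p t) =
      f (s + t) / f t * (g (s - t) / g t) + g (s + t) / g t * (f (s - t) / f t) ∧
    f (s + t) / f t * (g (s - t) / g t) - g (s + t) / g t * (f (s - t) / f t) =
      -(j * (p (s + t) / p t * (r (s - t) / r t) + r (s + t) / r t * (p (s - t) / p t))) := by
  have h1 := h.sub_mul s t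
  have h2 := h.add_mul s t
  constructor
  · field_simp
    linear_combination h1
  · have hj' : j = δ * (p t * r t) ^ 2 / (f t * g t) ^ 2 := by
      field_simp
      linear_combination hj
    rw [hj']
    field_simp
    linear_combination h2

lemma GammaRel.psi {u : Fin 4 → ℂ} (hu : Generic u) {τ η : ℂ} (h : IsEllipticParam u τ η) (z : ℂ) :
    GammaRel u (psi τ η z) (NCSphere.psi τ η (z - η)) := by
  have n1 : theta1 τ η ≠ 0 := h.theta_ne_zero hu 0
  have n2 : theta2 τ η ≠ 0 := h.theta_ne_zero hu 1
  have n3 : theta3 τ η ≠ 0 := h.theta_ne_zero hu 2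
  have n4 : theta4 τ η ≠ 0 := h.theta_ne_zero hu 3
  have h0 := h
  obtain ⟨hτ, t, ht, h⟩ := h
  have z2 : theta2 τ 0 ≠ 0 := thetas_at_zero_ne_zero hτ (k := 1) (by decide)
  have z3 : theta3 τ 0 ≠ 0 := thetas_at_zero_ne_zero hτ (k := 2) (by decide)
  have z4 : theta4 τ 0 ≠ 0 := thetas_at_zero_ne_zero hτ (k := 3) (by decide)
  have a0 : Phi u 0 = t * (theta2 τ 0 ^ 2 / theta2 τ η ^ 2) := congr_fun h 0
  have a1 : Phi u 1 = t * (theta3 τ 0 ^ 2 / theta3 τ η ^ 2) := congr_fun h 1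
  have a2 : Phi u 2 = t * (theta4 τ 0 ^ 2 / theta4 τ η ^ 2) := congr_fun h 2
  obtain ⟨j1, j2, j3⟩ := J_mul_Phi hu
  rw [a0, a1, a2] at j1 j2 j3
  field_simp at j1 j2 j3
  have hp : ∀ k, NCSphere.psi τ η z k = thetas τ k (2 * z - 2 * η + η) / thetas τ k η := fun k => by
    rw [psi_apply]
    ring_nf
  have hq : ∀ k, NCSphere.psi τ η (z - η) k = thetas τ k (2 * z - 2 * η - η) / thetas τ k η :=
    fun k => by
      rw [psi_apply]
      ring_nf
  rintro k l m (h | h | h)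
  all_goals
    obtain ⟨rfl, rfl, rfl⟩ : _ ∧ _ ∧ _ := by simpa only [Prod.mk.injEq] using h
    simp only [hp, hq]
  · refine (mixedAddition_one hτ).rel n3 n4 n1 n2 ?_ _
    refine mul_left_cancel₀ (pow_ne_zero 2 z2) ?_
    linear_combination j1 - theta2 τ η ^ 2 * theta1_sq_of_theta34 hτ η
  · refine (mixedAddition_two hτ).rel n4 n2 n1 n3 ?_ _
    refine mul_left_cancel₀ (pow_ne_zero 2 z3) ?_
    linear_combination j2 + theta3 τ η ^ 2 * theta1_sq_of_theta24 hτ η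
  · refine (mixedAddition_three hτ).rel n2 n3 n1 n4 ?_ _
    refine mul_left_cancel₀ (pow_ne_zero 2 z4) ?_
    linear_combination j3 - theta4 τ η ^ 2 * theta1_sq_of_theta23 hτ η

/-- If the values of the theta functions at `x` and `y` are proportional, then `ϑ₁(x - y) = 0`,
since otherwise `ϑ₁` and `ϑ₂` would both vanish at `x + y`. -/
lemma theta1_sub_eq_zero {τ : ℂ} (hτ : 0 < τ.im) {x y μ : ℂ}
    (h : ∀ k, thetas τ k x = μ * thetas τ k y) : theta1 τ (x - y) = 0 := by
  by_contra h0
  have z2 : theta2 τ 0 ≠ 0 := thetas_at_zero_ne_zero hτ (k := 1) (by decide)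
  have z3 : theta3 τ 0 ≠ 0 := thetas_at_zero_ne_zero hτ (k := 2) (by decide)
  have z4 : theta4 τ 0 ≠ 0 := thetas_at_zero_ne_zero hτ (k := 3) (by decide)
  have e1 : theta1 τ x = μ * theta1 τ y := h 0
  have e2 : theta2 τ x = μ * theta2 τ y := h 1
  have e3 : theta3 τ x = μ * theta3 τ y := h 2
  have e4 : theta4 τ x = μ * theta4 τ y := h 3
  have f2 : theta2 τ (x + y) = 0 := by
    have := (mixedAddition_one hτ).diff_mul x y
    rw [e1, e2, e3, e4] at this
    have : theta1 τ (x - y) * theta2 τ (x + y) * (theta3 τ 0 * theta4 τ 0) = 0 := by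
      rw [this]
      ring
    simpa [h0, z3, z4] using this
  have f1 : theta1 τ (x + y) = 0 := by
    have : theta1 τ (x + y) * theta1 τ (x - y) * theta2 τ 0 ^ 2 =
      theta1 τ x ^ 2 * theta2 τ y ^ 2 - theta2 τ x ^ 2 * theta1 τ y ^ 2 :=
        thetas_zero_mul hτ (k := 1) (by decide) x y
    rw [e1, e2] at this
    have : theta1 τ (x + y) * theta1 τ (x - y) * theta2 τ 0 ^ 2 = 0 := by
      rw [this]
      ring
    simpa [h0, z2] using this
  exact thetas_ne_zero_of_theta1_eq_zero hτ (k := 1) (by decide) f1 f2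

lemma psi_proportional_iff {u : Fin 4 → ℂ} (hu : Generic u) {τ η : ℂ} (h : IsEllipticParam u τ η)
    (z w : ℂ) : (∃ μ : ℂ, μ ≠ 0 ∧ psi τ η z = μ • psi τ η w) ↔ z - w ∈ latticeL τ := by
  have hn := h.theta_ne_zero hu
  have hτ := h.1
  constructor
  · rintro ⟨μ, hμ, he⟩
    have hθ : ∀ k, thetas τ k (2 * z - η) = μ * thetas τ k (2 * w - η) := fun k => by
      have := congr_fun he k
      rw [Pi.smul_apply, psi_apply, psi_apply, smul_eq_mul, mul_div_assoc',
        div_left_inj' (hn k)] at this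
      exact this
    obtain ⟨m, n, hmn⟩ := (theta1_eq_zero_iff hτ _).1 (theta1_sub_eq_zero hτ hθ)
    obtain ⟨ν, hν, hl⟩ := thetas_add_lattice τ m n (2 * w - η)
    rw [← hmn, show 2 * w - η + (2 * z - η - (2 * w - η)) = 2 * z - η by ring] at hl
    -- two coordinates which are multiplied by opposite signs cannot both be nonzero
    have hs : ∀ i k, signOne i ^ m * signTau i ^ n = -(signOne k ^ m * signTau k ^ n) →
        thetas τ i (2 * w - η) = 0 ∨ thetas τ k (2 * w - η) = 0 := fun i k hs => by
      by_contra! hne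
      have h1 := mul_right_cancel₀ hne.1 ((hθ i).symm.trans (hl i))
      have h2 := mul_right_cancel₀ hne.2 ((hθ k).symm.trans (hl k))
      have : μ = 0 := by
        rw [hs] at h1
        linear_combination (h1 + h2) / 2
      exact hμ this
    -- so the four coordinates do not fall into two pairs of opposite signs
    have hpart : ∀ i i' k k' : Fin 4, i ≠ i' → k ≠ k' →
        signOne i ^ m * signTau i ^ n = -(signOne k ^ m * signTau k ^ n) →
        signOne i ^ m * signTau i ^ n = signOne i' ^ m * signTau i' ^ n →
        signOne k ^ m * signTau k ^ n = signOne k' ^ m * signTau k' ^ n → False := by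
      intro i i' k k' hi hk h1 h2 h3
      obtain ⟨a, ha, ha'⟩ : ∃ a, thetas τ a (2 * w - η) ≠ 0 ∧
          signOne a ^ m * signTau a ^ n = signOne i ^ m * signTau i ^ n := by
        by_cases h : thetas τ i (2 * w - η) = 0
        · exact ⟨i', thetas_no_common_zero hτ hi h, h2.symm⟩
        · exact ⟨i, h, rfl⟩
      obtain ⟨b, hb, hb'⟩ : ∃ b, thetas τ b (2 * w - η) ≠ 0 ∧
          signOne b ^ m * signTau b ^ n = signOne k ^ m * signTau k ^ n := by
        by_cases h : thetas τ k (2 * w - η) = 0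
        · exact ⟨k', thetas_no_common_zero hτ hk h, h3.symm⟩
        · exact ⟨k, h, rfl⟩
      exact (hs a b (by rw [ha', hb', h1])).elim ha hb
    rcases Int.even_or_odd m with hm | hm <;> rcases Int.even_or_odd n with hn' | hn'
    · obtain ⟨m', rfl⟩ := hm
      obtain ⟨n', rfl⟩ := hn'
      refine ⟨m', n', ?_⟩
      push_cast at hmn
      linear_combination hmn / 2
    · have hv : ∀ k, signOne k ^ m * signTau k ^ n = ![-1, 1, 1, -1] k := fun k => by
        fin_cases k <;> simp [signOne, signTau, hm.neg_one_zpow, hn'.neg_one_zpow]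
      exact (hpart 0 3 1 2 (by decide) (by decide)
        (by simp [hv]) (by simp [hv]) (by simp [hv])).elim
    · have hv : ∀ k, signOne k ^ m * signTau k ^ n = ![-1, -1, 1, 1] k := fun k => by
        fin_cases k <;> simp [signOne, signTau, hm.neg_one_zpow, hn'.neg_one_zpow]
      exact (hpart 0 1 2 3 (by decide) (by decide)
        (by simp [hv]) (by simp [hv]) (by simp [hv])).elim
    · have hv : ∀ k, signOne k ^ m * signTau k ^ n = ![1, -1, 1, -1] k := fun k => by
        fin_cases k <;> simp [signOne, signTau, hm.neg_one_zpow, hn'.neg_one_zpow]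
      exact (hpart 0 2 1 3 (by decide) (by decide)
        (by simp [hv]) (by simp [hv]) (by simp [hv])).elim
  · rintro ⟨m, n, hmn⟩
    obtain ⟨μ, hμ, hl⟩ := thetas_add_lattice τ (2 * m) (2 * n) (2 * w - η)
    refine ⟨μ, hμ, funext fun k => ?_⟩
    have h1 := hl k
    rw [zpow_mul, zpow_mul, zpow_ofNat, zpow_ofNat, sq, sq, signOne_mul_self, signTau_mul_self,
      one_zpow, one_zpow, mul_one, mul_one] at h1
    rw [Pi.smul_apply, psi_apply, psi_apply, smul_eq_mul, mul_div_assoc', ← h1]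
    congr 2
    push_cast
    linear_combination 2 * hmn

end Theta

/-! ### The cubic map and the six bilinear equations -/

section Cubic

variable {R S : Type*} [CommRing R] [CommRing S]

/-- The vector product of three vectors in dimension four: the signed maximal minors. -/
def cross4 (r s t : Fin 4 → R) : Fin 4 → R :=
  ![r 1 * (s 2 * t 3 - s 3 * t 2) - r 2 * (s 1 * t 3 - s 3 * t 1) + r 3 * (s 1 * t 2 - s 2 * t 1),
    -(r 0 * (s 2 * t 3 - s 3 * t 2) - r 2 * (s 0 * t 3 - s 3 * t 0) +
      r 3 * (s 0 * t 2 - s 2 * t 0)),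
    r 0 * (s 1 * t 3 - s 3 * t 1) - r 1 * (s 0 * t 3 - s 3 * t 0) + r 3 * (s 0 * t 1 - s 1 * t 0),
    -(r 0 * (s 1 * t 2 - s 2 * t 1) - r 1 * (s 0 * t 2 - s 2 * t 0) +
      r 2 * (s 0 * t 1 - s 1 * t 0))]

/-- A vector orthogonal to three vectors is proportional to their vector product (Cramer). -/
lemma cross4_proportional {r s t y : Fin 4 → R} (hr : ∑ i, r i * y i = 0)
    (hs : ∑ i, s i * y i = 0) (ht : ∑ i, t i * y i = 0) (i j : Fin 4) :
    y i * cross4 r s t j = y j * cross4 r s t i := by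
  have key : ∀ i j : Fin 4, i < j → y i * cross4 r s t j = y j * cross4 r s t i := by
    simp only [Fin.sum_univ_four] at hr hs ht
    intro i j hij
    fin_cases i <;> fin_cases j <;> first | exact absurd hij (by decide) | skip
    · change y 0 * cross4 r s t 1 = y 1 * cross4 r s t 0
      simp only [cross4, Matrix.cons_val_zero, Matrix.cons_val_one]
      linear_combination -(s 2 * t 3 - s 3 * t 2) * hr + (r 2 * t 3 - r 3 * t 2) * hs -
        (r 2 * s 3 - r 3 * s 2) * ht
    · change y 0 * cross4 r s t 2 = y 2 * cross4 r s t 0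
      simp only [cross4, Matrix.cons_val_zero, Matrix.cons_val]
      linear_combination (s 1 * t 3 - s 3 * t 1) * hr - (r 1 * t 3 - r 3 * t 1) * hs +
        (r 1 * s 3 - r 3 * s 1) * ht
    · change y 0 * cross4 r s t 3 = y 3 * cross4 r s t 0
      simp only [cross4, Matrix.cons_val_zero, Matrix.cons_val]
      linear_combination -(s 1 * t 2 - s 2 * t 1) * hr + (r 1 * t 2 - r 2 * t 1) * hs -
        (r 1 * s 2 - r 2 * s 1) * ht
    · change y 1 * cross4 r s t 2 = y 2 * cross4 r s t 1
      simp only [cross4, Matrix.cons_val_one, Matrix.cons_val_zero, Matrix.cons_val]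
      linear_combination -(s 0 * t 3 - s 3 * t 0) * hr + (r 0 * t 3 - r 3 * t 0) * hs -
        (r 0 * s 3 - r 3 * s 0) * ht
    · change y 1 * cross4 r s t 3 = y 3 * cross4 r s t 1
      simp only [cross4, Matrix.cons_val_one, Matrix.cons_val_zero, Matrix.cons_val]
      linear_combination (s 0 * t 2 - s 2 * t 0) * hr - (r 0 * t 2 - r 2 * t 0) * hs +
        (r 0 * s 2 - r 2 * s 0) * ht
    · change y 2 * cross4 r s t 3 = y 3 * cross4 r s t 2
      simp only [cross4, Matrix.cons_val]
      linear_combination -(s 0 * t 1 - s 1 * t 0) * hr + (r 0 * t 1 - r 1 * t 0) * hs -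
        (r 0 * s 1 - r 1 * s 0) * ht
  rcases lt_trichotomy i j with h | rfl | h
  · exact key i j h
  · rfl
  · exact (key j i h).symm

/-- The cubic map `x ↦ y` which solves the three equations
`x₀ y_k - x_k y₀ = x_l y_m + x_m y_l`, linear in `y`. -/
def cubicMap (x : Fin 4 → R) : Fin 4 → R :=
  ![x 0 * (x 0 ^ 2 - x 1 ^ 2 - x 2 ^ 2 - x 3 ^ 2) - 2 * x 1 * x 2 * x 3,
    x 1 * (x 0 ^ 2 - x 1 ^ 2 + x 2 ^ 2 + x 3 ^ 2) + 2 * x 0 * x 2 * x 3,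
    x 2 * (x 0 ^ 2 + x 1 ^ 2 - x 2 ^ 2 + x 3 ^ 2) + 2 * x 0 * x 1 * x 3,
    x 3 * (x 0 ^ 2 + x 1 ^ 2 + x 2 ^ 2 - x 3 ^ 2) + 2 * x 0 * x 1 * x 2]

/-- The linear form `y ↦ x₀ y₁ - x₁ y₀ - x₂ y₃ - x₃ y₂`. -/
def rowA (x : Fin 4 → R) : Fin 4 → R := ![-x 1, x 0, -x 3, -x 2]

lemma cubicMap_eq_cross4 (x : Fin 4 → R) :
    cubicMap x = cross4 (rowA x) ![-x 2, -x 3, x 0, -x 1] ![-x 3, -x 2, -x 1, x 0] := by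
  ext i
  fin_cases i <;> simp [cubicMap, cross4, rowA] <;> ring

/-- A second cubic map, in terms of one of the equations above and two of the equations
`x_l y_m - x_m y_l = -J_{lm} (x₀ y_k + x_k y₀)`. -/
def cubicMapAux (j₁ j₂ : R) (x : Fin 4 → R) : Fin 4 → R :=
  cross4 (rowA x) ![j₁ * x 1, j₁ * x 0, -x 3, x 2] ![j₂ * x 2, x 3, j₂ * x 0, -x 1]

lemma map_cubicMap (f : R →+* S) (x : Fin 4 → R) (i : Fin 4) :
    f (cubicMap x i) = cubicMap (f ∘ x) i := by
  fin_cases i <;> simp [cubicMap, map_ofNat f 2]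

lemma map_cubicMapAux (f : R →+* S) (j₁ j₂ : R) (x : Fin 4 → R) (i : Fin 4) :
    f (cubicMapAux j₁ j₂ x i) = cubicMapAux (f j₁) (f j₂) (f ∘ x) i := by
  fin_cases i <;> simp [cubicMapAux, cross4, rowA]

/-- The reflection `Z₀ ↦ -Z₀`. -/
def reflect (x : Fin 4 → R) : Fin 4 → R := ![-x 0, x 1, x 2, x 3]

lemma reflect_reflect (x : Fin 4 → R) : reflect (reflect x) = x := by
  ext i
  fin_cases i <;> simp [reflect]

/-- The reflection `x₀ ↦ -x₀` followed by twice the involution `M`. -/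
def cubicForms (x : Fin 4 → R) : Fin 4 → R :=
  ![-x 0 + x 1 + x 2 + x 3, -x 0 + x 1 - x 2 - x 3, -x 0 - x 1 + x 2 - x 3,
    -x 0 - x 1 - x 2 + x 3]

/-- Up to linear substitutions the cubic map is the standard Cremona transformation
`w ↦ (w₁w₂w₃, w₀w₂w₃, w₀w₁w₃, w₀w₁w₂)`. -/
lemma cubicForms_mul (x : Fin 4 → R) :
    cubicForms x 1 * cubicForms x 2 * cubicForms x 3 =
      -(cubicMap x 0 + cubicMap x 1 + cubicMap x 2 + cubicMap x 3) ∧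
    cubicForms x 0 * cubicForms x 2 * cubicForms x 3 =
      -(cubicMap x 0 + cubicMap x 1 - cubicMap x 2 - cubicMap x 3) ∧
    cubicForms x 0 * cubicForms x 1 * cubicForms x 3 =
      -(cubicMap x 0 - cubicMap x 1 + cubicMap x 2 - cubicMap x 3) ∧
    cubicForms x 0 * cubicForms x 1 * cubicForms x 2 =
      -(cubicMap x 0 - cubicMap x 1 - cubicMap x 2 + cubicMap x 3) := by
  simp only [cubicForms, cubicMap, Matrix.cons_val, Matrix.cons_val_zero, Matrix.cons_val_one]
  refine ⟨?_, ?_, ?_, ?_⟩ <;> ring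

/-- The inverse of the cubic map is its conjugate by the reflection. -/
lemma reflect_cubicMap_comp (x : Fin 4 → R) (i : Fin 4) :
    reflect (cubicMap (reflect (cubicMap x))) i =
      (cubicForms x 0 * cubicForms x 1 * cubicForms x 2 * cubicForms x 3) ^ 2 * x i := by
  fin_cases i <;> simp [reflect, cubicForms, cubicMap] <;> ring

end Cubic

open MvPolynomial in
/-- The cubic map, as a four-tuple of polynomials. -/
noncomputable def cubicPoly : Fin 4 → MvPolynomial (Fin 4) ℚ := cubicMap X

section Homogeneous

open MvPolynomial

variable {K : Type*} [CommRing K] {r s t x : Fin 4 → MvPolynomial (Fin 4) K}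

lemma isHomogeneous_cross4 (hr : ∀ i, (r i).IsHomogeneous 1) (hs : ∀ i, (s i).IsHomogeneous 1)
    (ht : ∀ i, (t i).IsHomogeneous 1) (i : Fin 4) : (cross4 r s t i).IsHomogeneous 3 := by
  have h2 : ∀ i j k, (r i * (s j * t k - s k * t j)).IsHomogeneous 3 := fun i j k =>
    (hr i).mul (((hs j).mul (ht k)).sub ((hs k).mul (ht j)))
  have h3 : ∀ a b c : MvPolynomial (Fin 4) K, a.IsHomogeneous 3 → b.IsHomogeneous 3 →
      c.IsHomogeneous 3 → (a - b + c).IsHomogeneous 3 := fun a b c ha hb hc => (ha.sub hb).add hc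
  fin_cases i
  · exact h3 _ _ _ (h2 _ _ _) (h2 _ _ _) (h2 _ _ _)
  · exact (h3 _ _ _ (h2 _ _ _) (h2 _ _ _) (h2 _ _ _)).neg
  · exact h3 _ _ _ (h2 _ _ _) (h2 _ _ _) (h2 _ _ _)
  · exact (h3 _ _ _ (h2 _ _ _) (h2 _ _ _) (h2 _ _ _)).neg

lemma isHomogeneous_cubicMap (hx : ∀ i, (x i).IsHomogeneous 1) (i : Fin 4) :
    (cubicMap x i).IsHomogeneous 3 := by
  rw [cubicMap_eq_cross4]
  refine isHomogeneous_cross4 ?_ ?_ ?_ i <;> intro i <;> fin_cases i <;>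
    simp [rowA, hx, (hx _).neg]

lemma isHomogeneous_cubicMapAux (j₁ j₂ : K) (hx : ∀ i, (x i).IsHomogeneous 1) (i : Fin 4) :
    (cubicMapAux (C j₁) (C j₂) x i).IsHomogeneous 3 := by
  refine isHomogeneous_cross4 ?_ ?_ ?_ i <;> intro i <;> fin_cases i <;>
    simp [rowA, hx, (hx _).neg, (hx _).C_mul]

lemma isHomogeneous_reflect {d : ℕ} (hx : ∀ i, (x i).IsHomogeneous d) (i : Fin 4) :
    (reflect x i).IsHomogeneous d := by
  fin_cases i <;> simp [reflect, hx, (hx _).neg]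

end Homogeneous

/-! ### Birationality of the cubic map -/

open MvPolynomial in
lemma bind₁_cubicMap (P x : Fin 4 → MvPolynomial (Fin 4) ℚ) (i : Fin 4) :
    bind₁ P (cubicMap x i) = cubicMap (fun j => bind₁ P (x j)) i :=
  map_cubicMap (bind₁ P : MvPolynomial (Fin 4) ℚ →+* MvPolynomial (Fin 4) ℚ) x i

open MvPolynomial in
/-- A polynomial which divides the four products of three of the variables is constant. -/
lemma isUnit_of_dvd_products {D : MvPolynomial (Fin 4) ℚ} (h0 : D ∣ X 1 * X 2 * X 3)
    (h1 : D ∣ X 0 * X 2 * X 3) (h2 : D ∣ X 0 * X 1 * X 3) (h3 : D ∣ X 0 * X 1 * X 2) :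
    IsUnit D := by
  have hX : ∀ i : Fin 4, Prime (X i : MvPolynomial (Fin 4) ℚ) := fun i => X_prime
  by_contra hD
  have hD0 : D ≠ 0 := by
    rintro rfl
    rw [zero_dvd_iff] at h0
    simp at h0
  obtain ⟨p, hp, hpD⟩ := WfDvdMonoid.exists_irreducible_factor hD hD0
  have hpp := hp.prime
  have hne : ∀ i j : Fin 4, i ≠ j → p ∣ X i → ¬ p ∣ X j := fun i j hij hi hj => by
    have h1 : Associated p (X i) := hp.associated_of_dvd (hX i).irreducible hi
    have h2 := h1.symm.dvd.trans hj
    exact hij (X_dvd_X.1 h2)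
  have hor : ∀ i j k : Fin 4, p ∣ X i * X j * X k → p ∣ X i ∨ p ∣ X j ∨ p ∣ X k :=
    fun i j k h => (hpp.dvd_or_dvd h).elim (fun h => (hpp.dvd_or_dvd h).elim .inl (.inr ∘ .inl))
      (.inr ∘ .inr)
  -- `p` divides one of the variables, and it does not divide the product of the other three
  have hcase : ∀ i j k l : Fin 4, i ≠ j → i ≠ k → i ≠ l → p ∣ X i → ¬ p ∣ X j * X k * X l :=
    fun i j k l hj hk hl hi h => (hor j k l h).elim (hne i j hj hi)
      fun h => h.elim (hne i k hk hi) (hne i l hl hi)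
  rcases hor 1 2 3 (hpD.trans h0) with h | h | h
  · exact hcase 1 0 2 3 (by decide) (by decide) (by decide) h (hpD.trans h1)
  · exact hcase 2 0 1 3 (by decide) (by decide) (by decide) h (hpD.trans h2)
  · exact hcase 3 0 1 2 (by decide) (by decide) (by decide) h (hpD.trans h3)

open MvPolynomial in
lemma cubicPoly_no_common_factor (D : MvPolynomial (Fin 4) ℚ) (hD : ∀ i, D ∣ cubicPoly i) :
    IsUnit D := by
  -- the linear substitution which turns the four linear forms into multiples of the variables
  set L : Fin 4 → MvPolynomial (Fin 4) ℚ :=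
    ![-(X 0 + X 1 + X 2 + X 3), X 0 + X 1 - X 2 - X 3, X 0 - X 1 + X 2 - X 3,
      X 0 - X 1 - X 2 + X 3] with hL
  have hC : (C 4⁻¹ : MvPolynomial (Fin 4) ℚ) * 4 = 1 := by
    rw [show (4 : MvPolynomial (Fin 4) ℚ) = C 4 from (map_ofNat C 4).symm, ← C_mul]
    norm_num
  have hforms : ∀ i, cubicForms L i = 4 * X i := fun i => by
    fin_cases i <;> simp [cubicForms, hL] <;> ring
  have hinv : ∀ i, bind₁ (fun i => C 4⁻¹ * cubicForms X i) (L i) = X i := fun i => by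
    fin_cases i <;> simp [cubicForms, hL]
    · linear_combination X 0 * hC
    · linear_combination X 1 * hC
    · linear_combination X 2 * hC
    · linear_combination X 3 * hC
  have hdvd : ∀ i, bind₁ L D ∣ cubicMap L i := fun i => by
    have := map_dvd (bind₁ L) (hD i)
    rw [cubicPoly, bind₁_cubicMap] at this
    simpa using this
  have h64 : IsUnit (4 * 4 * 4 : MvPolynomial (Fin 4) ℚ) := by
    have : IsUnit (4 : MvPolynomial (Fin 4) ℚ) := .of_mul_eq_one_right _ hC
    exact (this.mul this).mul this
  obtain ⟨e0, e1, e2, e3⟩ := cubicForms_mul L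
  simp only [hforms] at e0 e1 e2 e3
  have hu : IsUnit (bind₁ L D) := by
    refine isUnit_of_dvd_products ?_ ?_ ?_ ?_ <;> rw [← h64.dvd_mul_left]
    · rw [show (4 * 4 * 4 * (X 1 * X 2 * X 3) : MvPolynomial (Fin 4) ℚ) =
        (4 * X 1) * (4 * X 2) * (4 * X 3) by ring, e0, dvd_neg]
      exact (((hdvd 0).add (hdvd 1)).add (hdvd 2)).add (hdvd 3)
    · rw [show (4 * 4 * 4 * (X 0 * X 2 * X 3) : MvPolynomial (Fin 4) ℚ) =
        (4 * X 0) * (4 * X 2) * (4 * X 3) by ring, e1, dvd_neg]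
      exact (((hdvd 0).add (hdvd 1)).sub (hdvd 2)).sub (hdvd 3)
    · rw [show (4 * 4 * 4 * (X 0 * X 1 * X 3) : MvPolynomial (Fin 4) ℚ) =
        (4 * X 0) * (4 * X 1) * (4 * X 3) by ring, e2, dvd_neg]
      exact (((hdvd 0).sub (hdvd 1)).add (hdvd 2)).sub (hdvd 3)
    · rw [show (4 * 4 * 4 * (X 0 * X 1 * X 2) : MvPolynomial (Fin 4) ℚ) =
        (4 * X 0) * (4 * X 1) * (4 * X 2) by ring, e3, dvd_neg]
      exact (((hdvd 0).sub (hdvd 1)).sub (hdvd 2)).add (hdvd 3)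
  have := hu.map (bind₁ fun i => C 4⁻¹ * cubicForms (X : Fin 4 → MvPolynomial (Fin 4) ℚ) i)
  rw [bind₁_bind₁, funext hinv] at this
  simpa using this

open MvPolynomial in
lemma cubicForms_X_ne_zero (i : Fin 4) :
    cubicForms (X : Fin 4 → MvPolynomial (Fin 4) ℚ) i ≠ 0 := fun h => by
  have := congr_arg (eval (Pi.single i 1)) h
  revert this
  fin_cases i <;> simp [cubicForms]

open MvPolynomial in
theorem isBirationalAut_cubicPoly : IsBirationalAut 3 cubicPoly := by
  have hb : ∀ P : Fin 4 → MvPolynomial (Fin 4) ℚ, ∀ x i,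
      bind₁ P (reflect x i) = reflect (fun j => bind₁ P (x j)) i := fun P x i => by
    fin_cases i <;> simp [reflect]
  have hr := isHomogeneous_reflect
    (isHomogeneous_cubicMap (isHomogeneous_reflect (isHomogeneous_X ℚ (σ := Fin 4))))
  set N : MvPolynomial (Fin 4) ℚ := (cubicForms X 0 * cubicForms X 1 * cubicForms X 2 *
    cubicForms X 3) ^ 2 with hN
  have hN0 : N ≠ 0 := pow_ne_zero _ (mul_ne_zero (mul_ne_zero (mul_ne_zero (cubicForms_X_ne_zero 0)
    (cubicForms_X_ne_zero 1)) (cubicForms_X_ne_zero 2)) (cubicForms_X_ne_zero 3))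
  have hX : ∀ P : Fin 4 → MvPolynomial (Fin 4) ℚ, (fun j => bind₁ P (X j)) = P :=
    fun P => funext fun j => bind₁_X_right _ _
  refine ⟨isHomogeneous_cubicMap (isHomogeneous_X ℚ), cubicPoly_no_common_factor, 3,
    reflect (cubicMap (reflect X)), N, bind₁ (reflect X) N, hr, hN0, ?_, fun i => ?_, fun i => ?_⟩
  · intro h
    have := congr_arg (bind₁ (reflect (X : Fin 4 → MvPolynomial (Fin 4) ℚ))) h
    rw [bind₁_bind₁, map_zero] at this
    simp only [hb, hX, reflect_reflect] at this
    exact hN0 (by simpa using this)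
  · rw [hb, funext (bind₁_cubicMap _ _), funext (hb _ _), hX]
    exact reflect_cubicMap_comp _ _
  · rw [cubicPoly, bind₁_cubicMap, hX]
    have h := congr_arg reflect
      (funext (reflect_cubicMap_comp (reflect (X : Fin 4 → MvPolynomial (Fin 4) ℚ))))
    rw [reflect_reflect] at h
    rw [h]
    simp only [hN, map_pow, map_mul]
    have hf : ∀ P : Fin 4 → MvPolynomial (Fin 4) ℚ, ∀ i,
        bind₁ P (cubicForms X i) = cubicForms P i := fun P i => by
      fin_cases i <;> simp [cubicForms]
    simp only [hf]
    fin_cases i <;> simp [reflect]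

/-! ### The equations of `Γ` in coordinates -/

section Components

variable {u x y : Fin 4 → ℂ}

lemma gammaRel_iff : GammaRel u x y ↔
    (x 0 * y 1 - x 1 * y 0 = x 2 * y 3 + x 3 * y 2 ∧
      x 0 * y 2 - x 2 * y 0 = x 3 * y 1 + x 1 * y 3 ∧
      x 0 * y 3 - x 3 * y 0 = x 1 * y 2 + x 2 * y 1) ∧
    x 2 * y 3 - x 3 * y 2 = -(J u 1 2 3 * (x 0 * y 1 + x 1 * y 0)) ∧
      x 3 * y 1 - x 1 * y 3 = -(J u 2 3 1 * (x 0 * y 2 + x 2 * y 0)) ∧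
      x 1 * y 2 - x 2 * y 1 = -(J u 3 1 2 * (x 0 * y 3 + x 3 * y 0)) := by
  constructor
  · intro h
    have h1 := h 1 2 3 (.inl rfl)
    have h2 := h 2 3 1 (.inr (.inl rfl))
    have h3 := h 3 1 2 (.inr (.inr rfl))
    exact ⟨⟨h1.1, h2.1, h3.1⟩, h1.2, h2.2, h3.2⟩
  · rintro ⟨⟨h1, h2, h3⟩, h4, h5, h6⟩ k l m (h | h | h) <;> cases h
    exacts [⟨h1, h4⟩, ⟨h2, h5⟩, ⟨h3, h6⟩]

lemma GammaRel.smul (h : GammaRel u x y) (c d : ℂ) : GammaRel u (c • x) (d • y) :=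
  fun k l m hk => by
    obtain ⟨h1, h2⟩ := h k l m hk
    simp only [Pi.smul_apply, smul_eq_mul]
    exact ⟨by linear_combination c * d * h1, by linear_combination c * d * h2⟩

/-- The equations are symmetric under the exchange of the two points, up to a reflection. -/
lemma GammaRel.reflect_swap (h : GammaRel u x y) : GammaRel u (reflect y) (reflect x) := by
  rw [gammaRel_iff] at h ⊢
  obtain ⟨⟨h1, h2, h3⟩, h4, h5, h6⟩ := h
  simp only [reflect, Matrix.cons_val, Matrix.cons_val_zero, Matrix.cons_val_one]
  refine ⟨⟨?_, ?_, ?_⟩, ?_, ?_, ?_⟩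
  · linear_combination h1
  · linear_combination h2
  · linear_combination h3
  · linear_combination -h4
  · linear_combination -h5
  · linear_combination -h6

lemma GammaRel.cubicMap_proportional (h : GammaRel u x y) (i j : Fin 4) :
    y i * cubicMap x j = y j * cubicMap x i := by
  obtain ⟨⟨h1, h2, h3⟩, -⟩ := gammaRel_iff.1 h
  rw [cubicMap_eq_cross4]
  refine cross4_proportional ?_ ?_ ?_ i j <;>
    simp only [rowA, Fin.sum_univ_four, Matrix.cons_val, Matrix.cons_val_zero, Matrix.cons_val_one]
  · linear_combination h1
  · linear_combination h2
  · linear_combination h3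

lemma GammaRel.cubicMapAux_proportional (h : GammaRel u x y) (i j : Fin 4) :
    y i * cubicMapAux (J u 1 2 3) (J u 2 3 1) x j =
      y j * cubicMapAux (J u 1 2 3) (J u 2 3 1) x i := by
  obtain ⟨⟨h1, h2, h3⟩, h4, h5, h6⟩ := gammaRel_iff.1 h
  refine cross4_proportional ?_ ?_ ?_ i j <;>
    simp only [rowA, Fin.sum_univ_four, Matrix.cons_val, Matrix.cons_val_zero, Matrix.cons_val_one]
  · linear_combination h1
  · linear_combination h4
  · linear_combination h5

/-- Proportional vectors, the second one being nonzero. -/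
lemma exists_smul_eq_of_proportional {y v : Fin 4 → ℂ} (hv : v ≠ 0)
    (h : ∀ i j, y i * v j = y j * v i) : ∃ c : ℂ, y = c • v := by
  obtain ⟨i, hi⟩ := Function.ne_iff.1 hv
  refine ⟨y i / v i, funext fun j => ?_⟩
  have := h i j
  simp only [Pi.smul_apply, smul_eq_mul, Pi.zero_apply] at hi ⊢
  field_simp
  linear_combination -this

end Components

/-! ### The points of the characteristic variety -/

section Fiber

variable {x₀ x₁ x₂ x₃ a b c j₁ j₂ j₃ : ℂ}

/-- If two of the quadrics `x₀ x_k + x_l x_m` vanish, `x` is on one of the six lines or on a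
coordinate axis. -/
lemma axis_of_two_quadrics (h1 : x₀ * x₁ + x₂ * x₃ = 0) (h2 : x₀ * x₂ + x₃ * x₁ = 0)
    (hj : j₃ ≠ 0)
    (h3 : x₀ * x₃ + x₁ * x₂ = 0 ∨ x₁ ^ 2 - x₂ ^ 2 + j₃ * (x₀ ^ 2 - x₃ ^ 2) = 0)
    (hP : x₀ * (x₀ ^ 2 - x₁ ^ 2 - x₂ ^ 2 - x₃ ^ 2) - 2 * x₁ * x₂ * x₃ ≠ 0 ∨
      x₁ * (x₀ ^ 2 - x₁ ^ 2 + x₂ ^ 2 + x₃ ^ 2) + 2 * x₀ * x₂ * x₃ ≠ 0 ∨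
      x₂ * (x₀ ^ 2 + x₁ ^ 2 - x₂ ^ 2 + x₃ ^ 2) + 2 * x₀ * x₁ * x₃ ≠ 0 ∨
      x₃ * (x₀ ^ 2 + x₁ ^ 2 + x₂ ^ 2 - x₃ ^ 2) + 2 * x₀ * x₁ * x₂ ≠ 0) :
    (x₁ = 0 ∧ x₂ = 0 ∧ x₃ = 0) ∨ (x₀ = 0 ∧ x₂ = 0 ∧ x₃ = 0) ∨ (x₀ = 0 ∧ x₁ = 0 ∧ x₃ = 0) ∨
      (x₀ = 0 ∧ x₁ = 0 ∧ x₂ = 0) := by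
  have e1 : (x₀ + x₃) * (x₁ + x₂) = 0 := by linear_combination h1 + h2
  have e2 : (x₀ - x₃) * (x₁ - x₂) = 0 := by linear_combination h1 - h2
  rcases mul_eq_zero.1 e1 with e1 | e1 <;> rcases mul_eq_zero.1 e2 with e2 | e2
  · obtain rfl : x₀ = 0 := by linear_combination (e1 + e2) / 2
    obtain rfl : x₃ = 0 := by linear_combination e1
    grind
  · grind
  · grind
  · obtain rfl : x₁ = 0 := by linear_combination (e1 + e2) / 2
    obtain rfl : x₂ = 0 := by linear_combination e1
    grind

/-- Two of the quadrics `x_l² - x_m² + J_{lm} (x₀² - x_k²)` determine the ratios of the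
`x₀² - x_k²`, except when they are proportional. -/
lemma exists_proportional_of_two_pencils (ha : a ≠ 0) (hj1 : j₁ * a = b - c) (hj2 : j₂ * b = c - a)
    (h1 : x₂ ^ 2 - x₃ ^ 2 + j₁ * (x₀ ^ 2 - x₁ ^ 2) = 0)
    (h2 : x₃ ^ 2 - x₁ ^ 2 + j₂ * (x₀ ^ 2 - x₂ ^ 2) = 0) (hc : a + b ≠ c) :
    ∃ T, x₀ ^ 2 - x₁ ^ 2 = T * a ∧ x₀ ^ 2 - x₂ ^ 2 = T * b ∧ x₀ ^ 2 - x₃ ^ 2 = T * c := by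
  have e1 : a * (x₂ ^ 2 - x₃ ^ 2) + (b - c) * (x₀ ^ 2 - x₁ ^ 2) = 0 := by
    linear_combination a * h1 - hj1 * (x₀ ^ 2 - x₁ ^ 2)
  have e2 : b * (x₃ ^ 2 - x₁ ^ 2) + (c - a) * (x₀ ^ 2 - x₂ ^ 2) = 0 := by
    linear_combination b * h2 - hj2 * (x₀ ^ 2 - x₂ ^ 2)
  have hc' : a + b - c ≠ 0 := sub_ne_zero.2 hc
  have e3 : b * (x₀ ^ 2 - x₁ ^ 2) = a * (x₀ ^ 2 - x₂ ^ 2) := by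
    apply mul_left_cancel₀ hc'
    linear_combination b * e1 + a * e2
  refine ⟨(x₀ ^ 2 - x₁ ^ 2) / a, ?_, ?_, ?_⟩
  · field_simp
  · field_simp
    linear_combination -e3
  · field_simp
    linear_combination -e3 + e1

/-- In the exceptional case `c = a + b`, the common zeros with the quadric of the third product are
on the six lines. -/
lemma false_of_pencil_of_quadric (ha : a ≠ 0) (hj1 : j₁ * a = b - c)
    (h1 : x₂ ^ 2 - x₃ ^ 2 + j₁ * (x₀ ^ 2 - x₁ ^ 2) = 0) (hc : a + b = c)
    (h3 : x₀ * x₃ + x₁ * x₂ = 0)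
    (hP : x₀ * (x₀ ^ 2 - x₁ ^ 2 - x₂ ^ 2 - x₃ ^ 2) - 2 * x₁ * x₂ * x₃ ≠ 0 ∨
      x₁ * (x₀ ^ 2 - x₁ ^ 2 + x₂ ^ 2 + x₃ ^ 2) + 2 * x₀ * x₂ * x₃ ≠ 0 ∨
      x₂ * (x₀ ^ 2 + x₁ ^ 2 - x₂ ^ 2 + x₃ ^ 2) + 2 * x₀ * x₁ * x₃ ≠ 0 ∨
      x₃ * (x₀ ^ 2 + x₁ ^ 2 + x₂ ^ 2 - x₃ ^ 2) + 2 * x₀ * x₁ * x₂ ≠ 0) : False := by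
  obtain rfl : j₁ = -1 := by
    apply mul_right_cancel₀ ha
    linear_combination hj1 + hc
  have e1 : (x₀ + x₃ - (x₁ - x₂)) * (x₀ + x₃ + (x₁ - x₂)) = 0 := by
    linear_combination -h1 + 2 * h3
  have e2 : (x₀ - x₃ - (x₁ + x₂)) * (x₀ - x₃ + (x₁ + x₂)) = 0 := by
    linear_combination -h1 - 2 * h3
  rcases mul_eq_zero.1 e1 with e1 | e1 <;> rcases mul_eq_zero.1 e2 with e2 | e2
  · obtain rfl : x₀ = x₁ := by linear_combination (e1 + e2) / 2
    obtain rfl : x₃ = -x₂ := by linear_combination e1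
    grind
  · obtain rfl : x₀ = -x₂ := by linear_combination (e1 + e2) / 2
    obtain rfl : x₃ = x₁ := by linear_combination e1
    grind
  · obtain rfl : x₀ = x₂ := by linear_combination (e1 + e2) / 2
    obtain rfl : x₃ = -x₁ := by linear_combination e1
    grind
  · obtain rfl : x₀ = -x₁ := by linear_combination (e1 + e2) / 2
    obtain rfl : x₃ = x₂ := by linear_combination e1
    grind

variable {y₀ y₁ y₂ y₃ s t δ : ℂ}

/-- On the line `x_k = δ x₀`, `x_m = -δ x_l` the six equations have a solution `y ≠ 0` at most in
the points with `x₀² = x_l²`. -/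
lemma sq_eq_of_line (ha : a ≠ 0) (hj1 : j₁ * a = b - c)
    (hbc : b ≠ c)
    (hj2 : j₂ * b = c - a) (hj3 : j₃ * c = a - b) (hδ : δ = 1 ∨ δ = -1)
    (hx0 : x₀ = s) (hx1 : x₁ = δ * s) (hx2 : x₂ = t) (hx3 : x₃ = -(δ * t))
    (hx : s ≠ 0 ∨ t ≠ 0) (hy : y₀ ≠ 0 ∨ y₁ ≠ 0 ∨ y₂ ≠ 0 ∨ y₃ ≠ 0)
    (A1 : x₀ * y₁ - x₁ * y₀ = x₂ * y₃ + x₃ * y₂) (A2 : x₀ * y₂ - x₂ * y₀ = x₃ * y₁ + x₁ * y₃)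
    (B1 : x₂ * y₃ - x₃ * y₂ = -(j₁ * (x₀ * y₁ + x₁ * y₀)))
    (B2 : x₃ * y₁ - x₁ * y₃ = -(j₂ * (x₀ * y₂ + x₂ * y₀)))
    (B3 : x₁ * y₂ - x₂ * y₁ = -(j₃ * (x₀ * y₃ + x₃ * y₀))) : s ^ 2 = t ^ 2 := by
  by_contra hst
  have hst' : s ^ 2 - t ^ 2 ≠ 0 := sub_ne_zero.2 hst
  have hδ2 : δ * δ = 1 := by rcases hδ with rfl | rfl <;> norm_num
  have hδ0 : δ ≠ 0 := by rintro rfl; simp at hδ2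
  subst hx0 hx1 hx2 hx3
  obtain rfl : y₁ = δ * y₀ := by
    apply mul_left_cancel₀ hst'
    linear_combination x₀ * A1 - δ * x₂ * A2 + (x₂ ^ 2 * y₁ - x₀ * x₂ * y₃) * hδ2
  obtain rfl : y₃ = δ * y₂ := by
    apply mul_left_cancel₀ hst'
    linear_combination x₂ * A1 - δ * x₀ * A2 + (δ * x₀ * x₂ * y₀ - x₀ ^ 2 * y₃) * hδ2
  have e1 : x₂ * y₂ = -j₁ * (x₀ * y₀) := by
    apply mul_left_cancel₀ hδ0
    linear_combination B1 / 2
  have e2 : (j₂ - 1) * (x₀ * y₂ + x₂ * y₀) = 0 := by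
    linear_combination B2 + (x₂ * y₀ + x₀ * y₂) * hδ2
  have e3 : (j₃ + 1) * (x₀ * y₂ - x₂ * y₀) = 0 := by
    apply mul_left_cancel₀ hδ0
    linear_combination B3
  have hj1' : j₁ ≠ 0 := by
    rintro rfl
    exact hbc (by linear_combination -hj1)
  have hy' : y₀ ≠ 0 ∨ y₂ ≠ 0 := by
    by_contra! h
    simp [h] at hy
  rcases mul_eq_zero.1 e2 with h2 | h2 <;> rcases mul_eq_zero.1 e3 with h3 | h3
  · exact ha (by linear_combination (c * h3 - hj3 - b * h2 + hj2) / 2)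
  · have : j₁ = -1 := mul_right_cancel₀ ha (by linear_combination hj1 + hj2 - b * h2)
    grind
  · have : j₁ = 1 := mul_right_cancel₀ ha (by linear_combination hj1 + hj3 - c * h3)
    grind
  · grind

end Fiber

variable {u x y : Fin 4 → ℂ}

lemma cubicMap_ne_zero_iff : cubicMap x ≠ 0 ↔
    x 0 * (x 0 ^ 2 - x 1 ^ 2 - x 2 ^ 2 - x 3 ^ 2) - 2 * x 1 * x 2 * x 3 ≠ 0 ∨
      x 1 * (x 0 ^ 2 - x 1 ^ 2 + x 2 ^ 2 + x 3 ^ 2) + 2 * x 0 * x 2 * x 3 ≠ 0 ∨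
      x 2 * (x 0 ^ 2 + x 1 ^ 2 - x 2 ^ 2 + x 3 ^ 2) + 2 * x 0 * x 1 * x 3 ≠ 0 ∨
      x 3 * (x 0 ^ 2 + x 1 ^ 2 + x 2 ^ 2 - x 3 ^ 2) + 2 * x 0 * x 1 * x 2 ≠ 0 := by
  rw [Function.ne_iff]
  simp [Fin.exists_fin_succ, cubicMap]

lemma ne_zero_iff_components : x ≠ 0 ↔ x 0 ≠ 0 ∨ x 1 ≠ 0 ∨ x 2 ≠ 0 ∨ x 3 ≠ 0 := by
  rw [Function.ne_iff]
  simp [Fin.exists_fin_succ]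

/-- `x` is a multiple of one of the four vectors of the standard basis. -/
def OnAxis (x : Fin 4 → ℂ) : Prop := ∃ ν, ∀ i, i ≠ ν → x i = 0

lemma onAxis_of_components (h : (x 1 = 0 ∧ x 2 = 0 ∧ x 3 = 0) ∨ (x 0 = 0 ∧ x 2 = 0 ∧ x 3 = 0) ∨
    (x 0 = 0 ∧ x 1 = 0 ∧ x 3 = 0) ∨ (x 0 = 0 ∧ x 1 = 0 ∧ x 2 = 0)) : OnAxis x := by
  rcases h with h | h | h | h
  · exact ⟨0, fun i hi => by fin_cases i <;> simp_all⟩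
  · exact ⟨1, fun i hi => by fin_cases i <;> simp_all⟩
  · exact ⟨2, fun i hi => by fin_cases i <;> simp_all⟩
  · exact ⟨3, fun i hi => by fin_cases i <;> simp_all⟩

lemma J_ne_zero (hu : Generic u) : J u 1 2 3 ≠ 0 ∧ J u 2 3 1 ≠ 0 ∧ J u 3 1 2 ≠ 0 := by
  obtain ⟨j1, j2, j3⟩ := J_mul_Phi hu
  obtain ⟨h1, h2, h3⟩ := hu.Phi_ne
  refine ⟨fun h => h2 ?_, fun h => h3 ?_, fun h => h1 ?_⟩
  · linear_combination Phi u 0 * h - j1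
  · linear_combination Phi u 1 * h - j2
  · linear_combination Phi u 2 * h - j3

lemma GammaRel.smul_iff {c : ℂ} (hc : c ≠ 0) : GammaRel u x (c • y) ↔ GammaRel u x y := by
  refine ⟨fun h => ?_, fun h => by simpa using h.smul 1 c⟩
  simpa [smul_smul, hc] using h.smul 1 c⁻¹

/-- With `y = cubicMap x` three of the six equations hold identically, and the other three
factor. -/
lemma gammaRel_cubicMap_iff : GammaRel u x (cubicMap x) ↔
    (x 0 * x 1 + x 2 * x 3) * (x 2 ^ 2 - x 3 ^ 2 + J u 1 2 3 * (x 0 ^ 2 - x 1 ^ 2)) = 0 ∧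
    (x 0 * x 2 + x 3 * x 1) * (x 3 ^ 2 - x 1 ^ 2 + J u 2 3 1 * (x 0 ^ 2 - x 2 ^ 2)) = 0 ∧
    (x 0 * x 3 + x 1 * x 2) * (x 1 ^ 2 - x 2 ^ 2 + J u 3 1 2 * (x 0 ^ 2 - x 3 ^ 2)) = 0 := by
  rw [gammaRel_iff]
  simp only [cubicMap, Matrix.cons_val, Matrix.cons_val_zero, Matrix.cons_val_one]
  constructor
  · rintro ⟨-, h1, h2, h3⟩
    exact ⟨by linear_combination h1 / 2, by linear_combination h2 / 2,
      by linear_combination h3 / 2⟩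
  · rintro ⟨h1, h2, h3⟩
    exact ⟨⟨by ring, by ring, by ring⟩, by linear_combination 2 * h1,
      by linear_combination 2 * h2, by linear_combination 2 * h3⟩

lemma onCurve_or_onAxis_of_cubicMap_ne_zero (hu : Generic u) (hP : cubicMap x ≠ 0)
    (h : GammaRel u x (cubicMap x)) : OnCurve u x ∨ OnAxis x := by
  obtain ⟨j1, j2, j3⟩ := J_mul_Phi hu
  obtain ⟨n1, n2, n3⟩ := J_ne_zero hu
  have a := hu.Phi_ne_zero
  rw [cubicMap_ne_zero_iff] at hP
  obtain ⟨h1, h2, h3⟩ := gammaRel_cubicMap_iff.1 h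
  rw [mul_eq_zero] at h1 h2 h3
  have hP2 : x 0 * (x 0 ^ 2 - x 2 ^ 2 - x 3 ^ 2 - x 1 ^ 2) - 2 * x 2 * x 3 * x 1 ≠ 0 ∨
      x 2 * (x 0 ^ 2 - x 2 ^ 2 + x 3 ^ 2 + x 1 ^ 2) + 2 * x 0 * x 3 * x 1 ≠ 0 ∨
      x 3 * (x 0 ^ 2 + x 2 ^ 2 - x 3 ^ 2 + x 1 ^ 2) + 2 * x 0 * x 2 * x 1 ≠ 0 ∨
      x 1 * (x 0 ^ 2 + x 2 ^ 2 + x 3 ^ 2 - x 1 ^ 2) + 2 * x 0 * x 2 * x 3 ≠ 0 := by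
    rcases hP with h | h | h | h
    · exact .inl fun h' => h (by linear_combination h')
    · exact .inr (.inr (.inr fun h' => h (by linear_combination h')))
    · exact .inr (.inl fun h' => h (by linear_combination h'))
    · exact .inr (.inr (.inl fun h' => h (by linear_combination h')))
  have hP3 : x 0 * (x 0 ^ 2 - x 3 ^ 2 - x 1 ^ 2 - x 2 ^ 2) - 2 * x 3 * x 1 * x 2 ≠ 0 ∨
      x 3 * (x 0 ^ 2 - x 3 ^ 2 + x 1 ^ 2 + x 2 ^ 2) + 2 * x 0 * x 1 * x 2 ≠ 0 ∨
      x 1 * (x 0 ^ 2 + x 3 ^ 2 - x 1 ^ 2 + x 2 ^ 2) + 2 * x 0 * x 3 * x 2 ≠ 0 ∨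
      x 2 * (x 0 ^ 2 + x 3 ^ 2 + x 1 ^ 2 - x 2 ^ 2) + 2 * x 0 * x 3 * x 1 ≠ 0 := by
    rcases hP with h | h | h | h
    · exact .inl fun h' => h (by linear_combination h')
    · exact .inr (.inr (.inl fun h' => h (by linear_combination h')))
    · exact .inr (.inr (.inr fun h' => h (by linear_combination h')))
    · exact .inr (.inl fun h' => h (by linear_combination h'))
  by_cases c12 : x 0 * x 1 + x 2 * x 3 = 0 ∧ x 0 * x 2 + x 3 * x 1 = 0
  · exact .inr (onAxis_of_components (axis_of_two_quadrics c12.1 c12.2 n3 h3 hP))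
  by_cases c23 : x 0 * x 2 + x 3 * x 1 = 0 ∧ x 0 * x 3 + x 1 * x 2 = 0
  · refine .inr (onAxis_of_components ?_)
    have := axis_of_two_quadrics c23.1 c23.2 n1 h1 hP2
    rcases this with ⟨h1, h2, h3⟩ | ⟨h1, h2, h3⟩ | ⟨h1, h2, h3⟩ | ⟨h1, h2, h3⟩
    exacts [.inl ⟨h3, h1, h2⟩, .inr (.inr (.inl ⟨h1, h3, h2⟩)), .inr (.inr (.inr ⟨h1, h3, h2⟩)),
      .inr (.inl ⟨h1, h2, h3⟩)]
  by_cases c31 : x 0 * x 3 + x 1 * x 2 = 0 ∧ x 0 * x 1 + x 2 * x 3 = 0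
  · refine .inr (onAxis_of_components ?_)
    have := axis_of_two_quadrics c31.1 c31.2 n2 h2 hP3
    rcases this with ⟨h1, h2, h3⟩ | ⟨h1, h2, h3⟩ | ⟨h1, h2, h3⟩ | ⟨h1, h2, h3⟩
    exacts [.inl ⟨h2, h3, h1⟩, .inr (.inr (.inr ⟨h1, h2, h3⟩)), .inr (.inl ⟨h1, h3, h2⟩),
      .inr (.inr (.inl ⟨h1, h3, h2⟩))]
  left
  by_cases d1 : x 0 * x 1 + x 2 * x 3 = 0
  · have h2' := h2.resolve_left fun h => c12 ⟨d1, h⟩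
    have h3' := h3.resolve_left fun h => c31 ⟨h, d1⟩
    by_cases hs : Phi u 1 + Phi u 2 = Phi u 0
    · exact (false_of_pencil_of_quadric (a 1) j2 h2' hs d1 hP2).elim
    · obtain ⟨T, t2, t3, t1⟩ := exists_proportional_of_two_pencils (a 1) j2 j3 h2' h3' hs
      exact ⟨T, t1, t2, t3⟩
  have h1' := h1.resolve_left d1
  by_cases d2 : x 0 * x 2 + x 3 * x 1 = 0
  · have h3' := h3.resolve_left fun h => c23 ⟨d2, h⟩
    by_cases hs : Phi u 2 + Phi u 0 = Phi u 1
    · exact (false_of_pencil_of_quadric (a 2) j3 h3' hs d2 hP3).elim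
    · obtain ⟨T, t3, t1, t2⟩ := exists_proportional_of_two_pencils (a 2) j3 j1 h3' h1' hs
      exact ⟨T, t1, t2, t3⟩
  have h2' := h2.resolve_left d2
  by_cases hs : Phi u 0 + Phi u 1 = Phi u 2
  · by_cases d3 : x 0 * x 3 + x 1 * x 2 = 0
    · exact (false_of_pencil_of_quadric (a 0) j1 h1' hs d3 hP).elim
    have h3' := h3.resolve_left d3
    have hs' : Phi u 1 + Phi u 2 ≠ Phi u 0 := fun h => a 1 (by linear_combination (h + hs) / 2)
    obtain ⟨T, t2, t3, t1⟩ := exists_proportional_of_two_pencils (a 1) j2 j3 h2' h3' hs'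
    exact ⟨T, t1, t2, t3⟩
  · exact exists_proportional_of_two_pencils (a 0) j1 j2 h1' h2' hs

/-- The common zeros of the components of the cubic map form six lines. -/
lemma lines_of_cubicMap_eq_zero (h : cubicMap x = 0) : ∃ δ : ℂ, (δ = 1 ∨ δ = -1) ∧
    ((x 1 = δ * x 0 ∧ x 3 = -(δ * x 2)) ∨ (x 2 = δ * x 0 ∧ x 1 = -(δ * x 3)) ∨
      (x 3 = δ * x 0 ∧ x 2 = -(δ * x 1))) := by
  obtain ⟨h0, h1, h2, h3⟩ := cubicForms_mul x
  simp only [h, Pi.zero_apply, add_zero, sub_zero, neg_zero, mul_eq_zero] at h0 h1 h2 h3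
  have w01 : cubicForms x 0 = 0 → cubicForms x 1 = 0 → x 1 = 1 * x 0 ∧ x 3 = -(1 * x 2) := by
    simp only [cubicForms, Matrix.cons_val_zero, Matrix.cons_val_one]
    exact fun a b => ⟨by linear_combination (a + b) / 2, by linear_combination (a - b) / 2⟩
  have w02 : cubicForms x 0 = 0 → cubicForms x 2 = 0 → x 2 = 1 * x 0 ∧ x 1 = -(1 * x 3) := by
    simp only [cubicForms, Matrix.cons_val, Matrix.cons_val_zero]
    exact fun a b => ⟨by linear_combination (a + b) / 2, by linear_combination (a - b) / 2⟩
  have w03 : cubicForms x 0 = 0 → cubicForms x 3 = 0 → x 3 = 1 * x 0 ∧ x 2 = -(1 * x 1) := by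
    simp only [cubicForms, Matrix.cons_val, Matrix.cons_val_zero]
    exact fun a b => ⟨by linear_combination (a + b) / 2, by linear_combination (a - b) / 2⟩
  have w23 : cubicForms x 2 = 0 → cubicForms x 3 = 0 → x 1 = -1 * x 0 ∧ x 3 = -(-1 * x 2) := by
    simp only [cubicForms, Matrix.cons_val]
    exact fun a b => ⟨by linear_combination -(a + b) / 2, by linear_combination (b - a) / 2⟩
  have w13 : cubicForms x 1 = 0 → cubicForms x 3 = 0 → x 2 = -1 * x 0 ∧ x 1 = -(-1 * x 3) := by
    simp only [cubicForms, Matrix.cons_val, Matrix.cons_val_zero, Matrix.cons_val_one]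
    exact fun a b => ⟨by linear_combination -(a + b) / 2, by linear_combination (a - b) / 2⟩
  have w12 : cubicForms x 1 = 0 → cubicForms x 2 = 0 → x 3 = -1 * x 0 ∧ x 2 = -(-1 * x 1) := by
    simp only [cubicForms, Matrix.cons_val, Matrix.cons_val_zero, Matrix.cons_val_one]
    exact fun a b => ⟨by linear_combination -(a + b) / 2, by linear_combination (b - a) / 2⟩
  by_cases c0 : cubicForms x 0 = 0
  · refine ⟨1, .inl rfl, ?_⟩
    rcases h0 with (h | h) | h
    exacts [.inl (w01 c0 h), .inr (.inl (w02 c0 h)), .inr (.inr (w03 c0 h))]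
  · refine ⟨-1, .inr rfl, ?_⟩
    simp only [c0, false_or] at h1 h2 h3
    rcases h1 with h1 | h1 <;> rcases h2 with h2 | h2
    exacts [.inr (.inr (w12 h2 h1)), .inl (w23 h1 h2), .inr (.inl (w13 h2 h1)),
      h3.elim (fun h => .inr (.inl (w13 h h1))) fun h => .inl (w23 h h1)]

/-- The first projection of `Γ` consists of the curve and of four more points. -/
theorem GammaRel.onCurve_or_onAxis (hu : Generic u) (hx : x ≠ 0) (hy : y ≠ 0)
    (h : GammaRel u x y) : OnCurve u x ∨ OnAxis x := by
  by_cases hP : cubicMap x = 0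
  · left
    obtain ⟨j1, j2, j3⟩ := J_mul_Phi hu
    obtain ⟨n1, n2, n3⟩ := hu.Phi_ne
    have a := hu.Phi_ne_zero
    obtain ⟨⟨A1, A2, A3⟩, B1, B2, B3⟩ := gammaRel_iff.1 h
    obtain ⟨δ, hδ, hl⟩ := lines_of_cubicMap_eq_zero hP
    have hδ2 : δ ^ 2 = 1 := by rcases hδ with rfl | rfl <;> norm_num
    rw [ne_zero_iff_components] at hx hy
    suffices x 0 ^ 2 = x 1 ^ 2 ∧ x 0 ^ 2 = x 2 ^ 2 ∧ x 0 ^ 2 = x 3 ^ 2 from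
      ⟨0, by simp [this.1], by simp [this.2.1], by simp [this.2.2]⟩
    rcases hl with ⟨h1, h2⟩ | ⟨h1, h2⟩ | ⟨h1, h2⟩
    · have := sq_eq_of_line (a 0) j1 n2 j2 j3 hδ rfl h1 rfl h2
        (by by_contra! h; simp [h1, h2, h] at hx) hy A1 A2 B1 B2 B3
      rw [h1, h2, neg_sq, mul_pow, mul_pow, hδ2]
      simpa using this
    · have := sq_eq_of_line (a 1) j2 n3 j3 j1 hδ rfl h1 rfl h2
        (by by_contra! h; simp [h1, h2, h] at hx) (y₁ := y 2) (y₂ := y 3) (y₃ := y 1) (by tauto)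
        A2 A3 B2 B3 B1
      rw [h1, h2, neg_sq, mul_pow, mul_pow, hδ2]
      simpa using this
    · have := sq_eq_of_line (a 2) j3 n1 j1 j2 hδ rfl h1 rfl h2
        (by by_contra! h; simp [h1, h2, h] at hx) (y₁ := y 3) (y₂ := y 1) (y₃ := y 2) (by tauto)
        A3 A1 B3 B1 B2
      rw [h1, h2, neg_sq, mul_pow, mul_pow, hδ2]
      simpa using this
  · obtain ⟨c, hc⟩ := exists_smul_eq_of_proportional hP h.cubicMap_proportional
    have hc0 : c ≠ 0 := by
      rintro rfl
      exact hy (by simpa using hc)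
    rw [hc, GammaRel.smul_iff hc0] at h
    exact onCurve_or_onAxis_of_cubicMap_ne_zero hu hP h

/-! ### The fibers of the projections of `Γ` -/

variable {u x y y' : Fin 4 → ℂ}

/-- On the curve the components of the cubic map vanish only at the points
`(1, ε₁, ε₂, ε₃)` with `ε_k = ±1` and `ε₁ε₂ε₃ = -1`. -/
lemma OnCurve.signs_of_cubicMap_eq_zero (hu : Generic u) (h : OnCurve u x)
    (hP : cubicMap x = 0) : ∃ e f : ℂ, (e = 1 ∨ e = -1) ∧ (f = 1 ∨ f = -1) ∧
      x 1 = e * x 0 ∧ x 2 = f * x 0 ∧ x 3 = -(e * f * x 0) := by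
  obtain ⟨T, t1, t2, t3⟩ := h
  obtain ⟨δ, hδ, hl⟩ := lines_of_cubicMap_eq_zero hP
  have hδ2 : δ ^ 2 = 1 := by rcases hδ with rfl | rfl <;> norm_num
  have hT : ∀ i : Fin 3, ∀ z : ℂ, z = δ * x 0 → x 0 ^ 2 - z ^ 2 = T * Phi u i → T = 0 := by
    rintro i _ rfl h
    rw [mul_pow, hδ2, one_mul, sub_self, zero_eq_mul] at h
    exact h.resolve_right (hu.Phi_ne_zero i)
  have hsgn : ∀ z : ℂ, ∀ i, T = 0 → x 0 ^ 2 - z ^ 2 = T * Phi u i →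
      ∃ f : ℂ, (f = 1 ∨ f = -1) ∧ z = f * x 0 := by
    rintro z i rfl h
    rw [zero_mul, sub_eq_zero, sq_eq_sq_iff_eq_or_eq_neg] at h
    rcases h with h | h
    · exact ⟨1, .inl rfl, by rw [h, one_mul]⟩
    · exact ⟨-1, .inr rfl, by rw [h]; ring⟩
  have hmul : ∀ f : ℂ, (f = 1 ∨ f = -1) → (-(δ * f) = 1 ∨ -(δ * f) = -1) := by
    rintro f (rfl | rfl) <;> rcases hδ with rfl | rfl <;> norm_num
  rcases hl with ⟨h1, h2⟩ | ⟨h1, h2⟩ | ⟨h1, h2⟩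
  · obtain ⟨f, hf, h3⟩ := hsgn (x 2) 1 (hT 0 _ h1 t1) t2
    exact ⟨δ, f, hδ, hf, h1, h3, by rw [h2, h3]; ring⟩
  · obtain ⟨f, hf, h3⟩ := hsgn (x 3) 2 (hT 1 _ h1 t2) t3
    exact ⟨-(δ * f), δ, hmul f hf, hδ, by rw [h2, h3]; ring, h1,
      by rw [h3]; linear_combination -f * x 0 * hδ2⟩
  · obtain ⟨f, hf, h3⟩ := hsgn (x 1) 0 (hT 2 _ h1 t3) t1
    exact ⟨f, -(δ * f), hf, hmul f hf, h3, by rw [h2, h3]; ring,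
      by rcases hf with rfl | rfl <;> rw [h1] <;> ring⟩

lemma OnAxis.cubicMap_ne_zero (hx : x ≠ 0) (h : OnAxis x) : cubicMap x ≠ 0 := by
  obtain ⟨ν, hν⟩ := h
  rw [ne_zero_iff_components] at hx
  rw [cubicMap_ne_zero_iff]
  fin_cases ν
  · have h1 := hν 1 (by decide)
    have h2 := hν 2 (by decide)
    have h3 := hν 3 (by decide)
    exact .inl (by simpa [h1, h2, h3] using hx)
  · have h1 := hν 0 (by decide)
    have h2 := hν 2 (by decide)
    have h3 := hν 3 (by decide)
    exact .inr (.inl (by simpa [h1, h2, h3] using hx))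
  · have h1 := hν 0 (by decide)
    have h2 := hν 1 (by decide)
    have h3 := hν 3 (by decide)
    exact .inr (.inr (.inl (by simpa [h1, h2, h3] using hx)))
  · have h1 := hν 0 (by decide)
    have h2 := hν 1 (by decide)
    have h3 := hν 2 (by decide)
    exact .inr (.inr (.inr (by simpa [h1, h2, h3] using hx)))

/-- The two cubic maps have no common zero on the characteristic variety. -/
lemma cubicMapAux_ne_zero (hu : Generic u) (hx : x ≠ 0) (h : OnCurve u x ∨ OnAxis x)
    (hP : cubicMap x = 0) : cubicMapAux (J u 1 2 3) (J u 2 3 1) x ≠ 0 := by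
  obtain ⟨e, f, he, hf, h1, h2, h3⟩ :=
    (h.resolve_right fun h => h.cubicMap_ne_zero hx hP).signs_of_cubicMap_eq_zero hu hP
  have he2 : e ^ 2 = 1 := by rcases he with rfl | rfl <;> norm_num
  have hf2 : f ^ 2 = 1 := by rcases hf with rfl | rfl <;> norm_num
  have hx0 : x 0 ^ 3 ≠ 0 := by
    refine pow_ne_zero _ fun h0 => hx (funext fun i => ?_)
    fin_cases i <;> simp [h0, h1, h2, h3]
  obtain ⟨j1, j2, -⟩ := J_mul_Phi hu
  intro h
  have hQ : ∀ i, cubicMapAux (J u 1 2 3) (J u 2 3 1) x i = 0 := fun i => congr_fun h i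
  have q0 := hQ 0
  have q1 := hQ 1
  have q2 := hQ 2
  have q3 := hQ 3
  simp only [cubicMapAux, cross4, rowA, Matrix.cons_val, Matrix.cons_val_zero,
    Matrix.cons_val_one, h1, h2, h3] at q0 q1 q2 q3
  generalize J u 1 2 3 = p at *
  generalize J u 2 3 1 = q at *
  have r0 : p - q - p * q - 3 = 0 := mul_left_cancel₀ hx0 (by
    rcases he with rfl | rfl <;> rcases hf with rfl | rfl <;>
      first | linear_combination q0 | linear_combination -q0)
  have r1 : 1 + 3 * q + p - p * q = 0 := mul_left_cancel₀ hx0 (by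
    rcases he with rfl | rfl <;> rcases hf with rfl | rfl <;>
      first | linear_combination q1 | linear_combination -q1)
  have r2 : 3 * p - 1 + q + p * q = 0 := mul_left_cancel₀ hx0 (by
    rcases he with rfl | rfl <;> rcases hf with rfl | rfl <;> linear_combination q2)
  have r3 : 3 * p * q + 1 - q + p = 0 := mul_left_cancel₀ hx0 (by
    rcases he with rfl | rfl <;> rcases hf with rfl | rfl <;>
      first | linear_combination q3 | linear_combination -q3)
  have hpq : q = -p := by linear_combination (r1 + r2) / 4
  subst hpq
  have hp : p = 1 := by linear_combination (3 * r0 + r3) / 8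
  subst hp
  exact hu.Phi_ne_zero 2 (by linear_combination (j1 - j2) / 2)

/-- The linear forms which cut out the fiber of `Γ` over `x` have rank three. -/
theorem GammaRel.unique (hu : Generic u) (hx : x ≠ 0) (hy : y ≠ 0) (hy' : y' ≠ 0)
    (h : GammaRel u x y) (h' : GammaRel u x y') : ∃ c : ℂ, c ≠ 0 ∧ y' = c • y := by
  have key : ∀ v : Fin 4 → ℂ, v ≠ 0 → (∀ i j, y i * v j = y j * v i) →
      (∀ i j, y' i * v j = y' j * v i) → ∃ c : ℂ, c ≠ 0 ∧ y' = c • y := fun v hv h1 h2 => by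
    obtain ⟨c, rfl⟩ := exists_smul_eq_of_proportional hv h1
    obtain ⟨d, rfl⟩ := exists_smul_eq_of_proportional hv h2
    have hc := left_ne_zero_of_smul hy
    have hd := left_ne_zero_of_smul hy'
    exact ⟨d / c, div_ne_zero hd hc, by rw [smul_smul, div_mul_cancel₀ _ hc]⟩
  by_cases hP : cubicMap x = 0
  · exact key _ (cubicMapAux_ne_zero hu hx (h.onCurve_or_onAxis hu hx hy) hP)
      h.cubicMapAux_proportional h'.cubicMapAux_proportional
  · exact key _ hP h.cubicMap_proportional h'.cubicMap_proportional

lemma GammaRel.of_onAxis (h : OnAxis x) : GammaRel u x x := by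
  obtain ⟨ν, hν⟩ := h
  have key : ∀ i j, i ≠ j → x i * x j = 0 := fun i j hij => by
    rcases eq_or_ne i ν with rfl | hi
    · rw [hν j hij.symm, mul_zero]
    · rw [hν i hi, zero_mul]
  have h01 := key 0 1 (by decide)
  have h02 := key 0 2 (by decide)
  have h03 := key 0 3 (by decide)
  have h12 := key 1 2 (by decide)
  have h13 := key 1 3 (by decide)
  have h23 := key 2 3 (by decide)
  simp [gammaRel_iff, mul_comm (x 1) (x 0), mul_comm (x 2) (x 0), mul_comm (x 3) (x 0),
    mul_comm (x 2) (x 1), mul_comm (x 3) (x 1), mul_comm (x 3) (x 2), h01, h02, h03, h12, h13, h23]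

lemma OnCurve.gammaRel_cubicMap (hu : Generic u) (h : OnCurve u x) :
    GammaRel u x (cubicMap x) := by
  obtain ⟨j1, j2, j3⟩ := J_mul_Phi hu
  obtain ⟨T, t1, t2, t3⟩ := h
  rw [gammaRel_cubicMap_iff, t1, t2, t3]
  refine ⟨?_, ?_, ?_⟩
  · linear_combination (x 0 * x 1 + x 2 * x 3) * (T * j1 + t3 - t2)
  · linear_combination (x 0 * x 2 + x 3 * x 1) * (T * j2 + t1 - t3)
  · linear_combination (x 0 * x 3 + x 1 * x 2) * (T * j3 + t2 - t1)

/-- The image of a point `(1, ε₁, ε₂, ε₃)`, `ε₁ε₂ε₃ = -1`, of the curve. -/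
lemma exists_gammaRel_of_signs (hu : Generic u) {e f : ℂ} (he : e = 1 ∨ e = -1)
    (hf : f = 1 ∨ f = -1) (h1 : x 1 = e * x 0) (h2 : x 2 = f * x 0)
    (h3 : x 3 = -(e * f * x 0)) : ∃ y, y ≠ 0 ∧ GammaRel u x y := by
  obtain ⟨j1, j2, j3⟩ := J_mul_Phi hu
  obtain ⟨n1, n2, n3⟩ := hu.Phi_ne
  have ha := hu.Phi_ne_zero 0
  have hb := hu.Phi_ne_zero 1
  have hc := hu.Phi_ne_zero 2
  simp only [gammaRel_iff, h1, h2, h3]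
  generalize Phi u 0 = a at *
  generalize Phi u 1 = b at *
  generalize Phi u 2 = c at *
  generalize J u 1 2 3 = j₁ at *
  generalize J u 2 3 1 = j₂ at *
  generalize J u 3 1 2 = j₃ at *
  -- the equations say that `y = (w, e (p - w), f (q - w), -e f (r - w))` with `4 w = p + q + r`
  -- and `r - q = j₁ p`, `p - r = j₂ q`, `q - p = j₃ r`
  obtain ⟨p, hp⟩ : ∃ p, p = a * (b + c - a) := ⟨_, rfl⟩
  obtain ⟨q, hq⟩ : ∃ q, q = b * (c + a - b) := ⟨_, rfl⟩
  obtain ⟨r, hr⟩ : ∃ r, r = c * (a + b - c) := ⟨_, rfl⟩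
  have k1 : r - q = j₁ * p := by rw [hp, hq, hr]; linear_combination -(b + c - a) * j1
  have k2 : p - r = j₂ * q := by rw [hp, hq, hr]; linear_combination -(c + a - b) * j2
  have k3 : q - p = j₃ * r := by rw [hp, hq, hr]; linear_combination -(a + b - c) * j3
  refine ⟨![(p + q + r) / 4, e * (p - (p + q + r) / 4), f * (q - (p + q + r) / 4),
    -(e * f * (r - (p + q + r) / 4))], ?_, ?_⟩
  · intro h
    have w0 := congr_fun h 0
    have w1 := congr_fun h 1
    have w2 := congr_fun h 2
    simp only [Matrix.cons_val, Matrix.cons_val_zero, Matrix.cons_val_one, Pi.zero_apply]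
      at w0 w1 w2
    have he0 : e ≠ 0 := by rcases he with rfl | rfl <;> norm_num
    have hf0 : f ≠ 0 := by rcases hf with rfl | rfl <;> norm_num
    rw [w0] at w1 w2
    simp only [sub_zero, mul_eq_zero, he0, hf0, false_or] at w1 w2
    rw [w1, eq_comm, mul_eq_zero] at hp
    rw [w2, eq_comm, mul_eq_zero] at hq
    have hp' := hp.resolve_left ha
    have hq' := hq.resolve_left hb
    exact hc (by linear_combination (hp' + hq') / 2)
  · simp only [Matrix.cons_val, Matrix.cons_val_zero, Matrix.cons_val_one]
    have he2 : e * e = 1 := by rcases he with rfl | rfl <;> norm_num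
    have hf2 : f * f = 1 := by rcases hf with rfl | rfl <;> norm_num
    refine ⟨⟨?_, ?_, ?_⟩, ?_, ?_, ?_⟩
    · linear_combination e * x 0 * (p + q + r - 2 * ((p + q + r) / 4) - p) * hf2
    · linear_combination f * x 0 * (p + q + r - 2 * ((p + q + r) / 4) - q) * he2
    · ring
    · linear_combination (-e * x 0) * k1 + e * x 0 * (q - r) * hf2
    · linear_combination (-f * x 0) * k2 + f * x 0 * (r - p) * he2
    · linear_combination (e * f * x 0) * k3

/-- Every point of the curve and every one of the four further points has an image. -/
theorem exists_gammaRel (hu : Generic u) (hx : x ≠ 0) (h : OnCurve u x ∨ OnAxis x) :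
    ∃ y, y ≠ 0 ∧ GammaRel u x y := by
  rcases h with h | h
  · by_cases hP : cubicMap x = 0
    · obtain ⟨e, f, he, hf, h1, h2, h3⟩ := h.signs_of_cubicMap_eq_zero hu hP
      exact exists_gammaRel_of_signs hu he hf h1 h2 h3
    · exact ⟨_, hP, h.gammaRel_cubicMap hu⟩
  · exact ⟨x, hx, .of_onAxis h⟩

/-! ### Points of projective space -/

section Projective

variable {u v w : Fin 4 → ℂ} {x y : P3}

lemma represents_iff : Represents x v ↔ ∃ c : ℂ, c ≠ 0 ∧ v = c • x.rep := by
  constructor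
  · rintro ⟨hv, rfl⟩
    obtain ⟨c, hc⟩ := Projectivization.exists_smul_eq_mk_rep ℂ v hv
    refine ⟨(c⁻¹ : ℂˣ), Units.ne_zero _, ?_⟩
    rw [← hc]
    simp [Units.smul_def]
  · rintro ⟨c, hc, rfl⟩
    refine ⟨smul_ne_zero hc x.rep_nonzero, ?_⟩
    conv_lhs => rw [← x.mk_rep]
    rw [Projectivization.mk_eq_mk_iff']
    exact ⟨c⁻¹, by rw [smul_smul, inv_mul_cancel₀ hc, one_smul]⟩

lemma represents_rep (x : P3) : Represents x x.rep := ⟨x.rep_nonzero, x.mk_rep.symm⟩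

lemma Represents.ne_zero (h : Represents x v) : v ≠ 0 := h.1

lemma Represents.eq (h : Represents x v) (h' : Represents y v) : x = y := by
  obtain ⟨_, rfl⟩ := h
  obtain ⟨_, rfl⟩ := h'
  rfl

lemma Represents.smul (h : Represents x v) {c : ℂ} (hc : c ≠ 0) : Represents x (c • v) := by
  obtain ⟨d, hd, rfl⟩ := represents_iff.1 h
  exact represents_iff.2 ⟨c * d, mul_ne_zero hc hd, smul_smul _ _ _⟩

lemma Represents.exists_smul (h : Represents x v) (h' : Represents x w) :
    ∃ c : ℂ, c ≠ 0 ∧ w = c • v := by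
  obtain ⟨c, hc, rfl⟩ := represents_iff.1 h
  obtain ⟨d, hd, rfl⟩ := represents_iff.1 h'
  exact ⟨d / c, div_ne_zero hd hc, by rw [smul_smul, div_mul_cancel₀ _ hc]⟩

lemma OnCurve.smul (h : OnCurve u v) (c : ℂ) : OnCurve u (c • v) := by
  obtain ⟨T, h1, h2, h3⟩ := h
  refine ⟨c ^ 2 * T, ?_, ?_, ?_⟩ <;> simp only [Pi.smul_apply, smul_eq_mul]
  · linear_combination c ^ 2 * h1
  · linear_combination c ^ 2 * h2
  · linear_combination c ^ 2 * h3

lemma OnAxis.smul (h : OnAxis v) (c : ℂ) : OnAxis (c • v) := by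
  obtain ⟨ν, h⟩ := h
  exact ⟨ν, fun i hi => by simp [h i hi]⟩

lemma Represents.onCurve_iff (h : Represents x v) : OnCurve u x.rep ↔ OnCurve u v := by
  obtain ⟨c, hc, hv⟩ := represents_iff.1 h
  refine ⟨fun h => hv ▸ h.smul c, fun h => ?_⟩
  have := h.smul c⁻¹
  rwa [hv, smul_smul, inv_mul_cancel₀ hc, one_smul] at this

lemma Represents.gammaRel_iff (h : Represents x v) (h' : Represents y w) :
    GammaRel u x.rep y.rep ↔ GammaRel u v w := by
  obtain ⟨c, hc, hv⟩ := represents_iff.1 h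
  obtain ⟨d, hd, hw⟩ := represents_iff.1 h'
  refine ⟨fun h => hv ▸ hw ▸ h.smul c d, fun h => ?_⟩
  have := h.smul c⁻¹ d⁻¹
  rwa [hv, hw, smul_smul, smul_smul, inv_mul_cancel₀ hc, inv_mul_cancel₀ hd, one_smul,
    one_smul] at this

lemma onCurve_reflect (h : OnCurve u v) : OnCurve u (reflect v) := by
  obtain ⟨T, h1, h2, h3⟩ := h
  exact ⟨T, by simpa [reflect] using h1, by simpa [reflect] using h2, by simpa [reflect] using h3⟩

lemma onAxis_reflect (h : OnAxis v) : OnAxis (reflect v) := by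
  obtain ⟨ν, h⟩ := h
  refine ⟨ν, fun i hi => ?_⟩
  have := h i hi
  fin_cases i <;> simpa [reflect] using this

lemma reflect_ne_zero (hv : v ≠ 0) : reflect v ≠ 0 := by
  rw [ne_zero_iff_components] at hv ⊢
  simpa [reflect] using hv

lemma mem_pointsE_iff : x ∈ pointsE ↔ OnAxis x.rep := by
  constructor
  · rintro ⟨ν, h⟩
    obtain ⟨c, -, hc⟩ := h.exists_smul (represents_rep x)
    exact hc ▸ OnAxis.smul ⟨ν, fun i hi => Pi.single_eq_of_ne hi 1⟩ c
  · rintro ⟨ν, h⟩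
    refine ⟨ν, represents_iff.2 ⟨(x.rep ν)⁻¹, inv_ne_zero fun h0 => x.rep_nonzero ?_, ?_⟩⟩
    · ext i
      rcases eq_or_ne i ν with rfl | hi
      exacts [h0, h i hi]
    · have h0 : x.rep ν ≠ 0 := fun h0 => x.rep_nonzero (by
        ext i
        rcases eq_or_ne i ν with rfl | hi
        exacts [h0, h i hi])
      ext i
      rcases eq_or_ne i ν with rfl | hi
      · simp [h0]
      · simp [hi, h i hi]

lemma Phi_smul (c : ℂ) : Phi (c • v) = c ^ 2 • Phi v := by
  ext i
  fin_cases i <;> simp [Phi] <;> ring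

/-- The base points of `Φ`. -/
lemma mem_baseS_iff : x ∈ baseS ↔ Phi x.rep = 0 := by
  constructor
  · rintro ⟨j, h | h⟩ <;> obtain ⟨c, -, hc⟩ := h.exists_smul (represents_rep x) <;>
      rw [hc, Phi_smul] <;> refine smul_eq_zero_of_right _ ?_ <;> ext i <;> fin_cases i <;>
      fin_cases j <;> simp [Phi]
  · intro h
    have hx := x.rep_nonzero
    have hr := represents_rep x
    generalize x.rep = v at *
    have key : ∀ w : Fin 4 → ℂ, ∀ c : ℂ, v = c • w → Represents x w := fun w c hc => by
      have hc0 : c ≠ 0 := by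
        rintro rfl
        exact hx (by simpa using hc)
      have := hr.smul (inv_ne_zero hc0)
      rwa [hc, smul_smul, inv_mul_cancel₀ hc0, one_smul] at this
    have h1 : (v 0 + v 1) * (v 2 + v 3) = 0 := congr_fun h 0
    have h2 : (v 0 + v 2) * (v 3 + v 1) = 0 := congr_fun h 1
    have h3 : (v 0 + v 3) * (v 1 + v 2) = 0 := congr_fun h 2
    rcases mul_eq_zero.1 h1 with h1 | h1 <;> rcases mul_eq_zero.1 h2 with h2 | h2 <;>
      rcases mul_eq_zero.1 h3 with h3 | h3
    · exact ⟨0, .inr (key _ (v 1) (funext fun i => by fin_cases i <;> simp <;> grind))⟩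
    · exact ⟨3, .inl (key _ (v 3) (funext fun i => by fin_cases i <;> simp <;> grind))⟩
    · exact ⟨2, .inl (key _ (v 2) (funext fun i => by fin_cases i <;> simp <;> grind))⟩
    · exact ⟨1, .inr (key _ (v 0) (funext fun i => by fin_cases i <;> simp <;> grind))⟩
    · exact ⟨1, .inl (key _ (v 1) (funext fun i => by fin_cases i <;> simp <;> grind))⟩
    · exact ⟨2, .inr (key _ (v 0) (funext fun i => by fin_cases i <;> simp <;> grind))⟩
    · exact ⟨3, .inr (key _ (v 0) (funext fun i => by fin_cases i <;> simp <;> grind))⟩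
    · exact ⟨0, .inl (key _ (v 0) (funext fun i => by fin_cases i <;> simp <;> grind))⟩

end Projective

variable {u : Fin 4 → ℂ}

/-! ### The fibers of `Φ` in the coordinates `Z` -/

lemma matM_apply (v : Fin 4 → ℂ) : Matrix.toLin' matM v =
    ![(v 0 + v 1 + v 2 + v 3) / 2, (v 0 + v 1 - v 2 - v 3) / 2, (v 0 - v 1 + v 2 - v 3) / 2,
      (v 0 - v 1 - v 2 + v 3) / 2] := by
  ext i
  fin_cases i <;> simp [matM, Matrix.mulVec, dotProduct, Fin.sum_univ_four] <;> ring

lemma onCurve_matM_iff (v : Fin 4 → ℂ) :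
    OnCurve u (Matrix.toLin' matM v) ↔ ∃ T : ℂ, Phi v = T • Phi u := by
  have h : ∀ Z, Z = Matrix.toLin' matM v → Z 0 ^ 2 - Z 1 ^ 2 = Phi v 0 ∧
      Z 0 ^ 2 - Z 2 ^ 2 = Phi v 1 ∧ Z 0 ^ 2 - Z 3 ^ 2 = Phi v 2 := by
    rintro _ rfl
    rw [matM_apply]
    simp only [Phi, Matrix.cons_val, Matrix.cons_val_zero, Matrix.cons_val_one]
    refine ⟨?_, ?_, ?_⟩ <;> ring
  obtain ⟨h1, h2, h3⟩ := h _ rfl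
  simp only [OnCurve, h1, h2, h3, funext_iff, Fin.forall_fin_succ, Pi.smul_apply, smul_eq_mul]
  simp

lemma mem_fiberF_iff {x : P3} : x ∈ fiberF u ↔ ∃ T : ℂ, Phi x.rep = T • Phi u := by
  constructor
  · rintro (h | ⟨-, t, -, h⟩)
    · exact ⟨0, by rw [mem_baseS_iff.1 h, zero_smul]⟩
    · exact ⟨t, h⟩
  · rintro ⟨T, hT⟩
    by_cases hx : x ∈ baseS
    · exact .inl hx
    · refine .inr ⟨hx, T, ?_, hT⟩
      rintro rfl
      exact hx (mem_baseS_iff.2 (by simpa using hT))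

lemma projM_projM (x : P3) : projM (projM x) = x := by
  induction x using Projectivization.ind with
  | h v hv =>
    simp only [projM, Projectivization.map_mk]
    congr 1
    rw [← Matrix.toLin'_mul_apply, matM_mul_self, Matrix.toLin'_one]
    rfl

lemma represents_projM (x : P3) : Represents (projM x) (Matrix.toLin' matM x.rep) := by
  refine ⟨?_, ?_⟩
  · rw [Ne, LinearMap.map_eq_zero_iff _ matM_injective]
    exact x.rep_nonzero
  · conv_lhs => rw [← x.mk_rep]
    rfl

/-- In the coordinates `Z` the variety `F_u` is the intersection of the quadrics
`(Z₀² - Z₁², Z₀² - Z₂², Z₀² - Z₃²) ∈ ℂ (a, b, c)`. -/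
lemma projM_image_fiberF : projM '' fiberF u = {x | OnCurve u x.rep} := by
  have key : ∀ x, x ∈ fiberF u ↔ OnCurve u (projM x).rep := fun x => by
    rw [(represents_projM x).onCurve_iff, onCurve_matM_iff, mem_fiberF_iff]
  ext x
  constructor
  · rintro ⟨y, hy, rfl⟩
    exact (key y).1 hy
  · intro hx
    refine ⟨projM x, (key _).2 ?_, projM_projM x⟩
    rwa [projM_projM]

/-! ### The relations in terms of the generators `Y` -/

section Relations

variable {d₁₂ d₂₃ d₃₁ s₁ s₂ s₃ : ℂ}

lemma changeScale_ne_zero (hu : Generic u) (h12 : d₁₂ ^ 2 = u 1 - u 2) (h23 : d₂₃ ^ 2 = u 2 - u 3)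
    (h31 : d₃₁ ^ 2 = u 3 - u 1) (h1 : s₁ ^ 2 = u 0 + u 1) (h2 : s₂ ^ 2 = u 0 + u 2)
    (h3 : s₃ ^ 2 = u 0 + u 3) (μ : Fin 4) : changeScale d₁₂ d₂₃ d₃₁ s₁ s₂ s₃ μ ≠ 0 := by
  have hs : ∀ {d : ℂ} {i j : Fin 4}, d ^ 2 = u i - u j → i ≠ j → d ≠ 0 := by
    rintro _ i j h hij rfl
    exact hu.sub_ne_zero hij (by simpa using h.symm)
  have ha : ∀ {d : ℂ} {i j : Fin 4}, d ^ 2 = u i + u j → i ≠ j → d ≠ 0 := by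
    rintro _ i j h hij rfl
    exact hu.add_ne_zero hij (by simpa using h.symm)
  have n12 := hs h12 (by decide)
  have n23 := hs h23 (by decide)
  have n31 := hs h31 (by decide)
  have n1 := ha h1 (by decide)
  have n2 := ha h2 (by decide)
  have n3 := ha h3 (by decide)
  fin_cases μ <;> simp [changeScale, *]

lemma changeScale_mul (h12 : d₁₂ ^ 2 = u 1 - u 2) (h23 : d₂₃ ^ 2 = u 2 - u 3)
    (h31 : d₃₁ ^ 2 = u 3 - u 1) (h1 : s₁ ^ 2 = u 0 + u 1) (h2 : s₂ ^ 2 = u 0 + u 2)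
    (h3 : s₃ ^ 2 = u 0 + u 3) {k l m : Fin 4} (hk : IsCyclic123 k l m) :
    (u l - u m) * (changeScale d₁₂ d₂₃ d₃₁ s₁ s₂ s₃ l * changeScale d₁₂ d₂₃ d₃₁ s₁ s₂ s₃ m) =
      (u k + u 0) *
        (changeScale d₁₂ d₂₃ d₃₁ s₁ s₂ s₃ 0 * changeScale d₁₂ d₂₃ d₃₁ s₁ s₂ s₃ k) := by
  rcases hk with h | h | h <;> cases h <;>
    simp only [changeScale, Matrix.cons_val, Matrix.cons_val_zero, Matrix.cons_val_one]
  · rw [← h23, add_comm, ← h1]; ring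
  · rw [← h31, add_comm, ← h2]; ring
  · rw [← h12, add_comm, ← h3]; ring

lemma J_mul (hu : Generic u) {k l m : Fin 4} (hk : IsCyclic123 k l m) :
    (u k - u 0) * (u l - u m) = J u k l m * ((u 0 + u k) * (u l + u m)) := by
  have h : (u 0 + u k) * (u l + u m) ≠ 0 := by
    rcases hk with h | h | h <;> cases h <;>
      exact mul_ne_zero (hu.add_ne_zero (by decide)) (hu.add_ne_zero (by decide))
  rw [J, div_mul_cancel₀ _ h]
  ring

lemma uRel_eq_span (hu : Generic u) {Y : Fin 4 → (Fin 4 → ℂ)} {ρ : Fin 4 → ℂ}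
    (hY : ∀ μ, yGen μ = ρ μ • Y μ) (hρ : ∀ μ, ρ μ ≠ 0)
    (hmul : ∀ k l m, IsCyclic123 k l m →
      (u l - u m) * (ρ l * ρ m) = (u k + u 0) * (ρ 0 * ρ k)) :
    uRel u = Submodule.span ℂ (yRelations u Y) := by
  have hne : ∀ k l m, IsCyclic123 k l m → (u k + u 0) * (ρ 0 * ρ k) ≠ 0 ∧
      (u l + u m) * (ρ l * ρ m) ≠ 0 := fun k l m hk => by
    rcases hk with h | h | h <;> cases h <;>
      exact ⟨mul_ne_zero (hu.add_ne_zero (by decide)) (mul_ne_zero (hρ _) (hρ _)),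
        mul_ne_zero (hu.add_ne_zero (by decide)) (mul_ne_zero (hρ _) (hρ _))⟩
  -- `S₁`, `S₂` in terms of the sum and the difference of the relations `R₁`, `R₂`
  have e1 : ∀ k l m, IsCyclic123 k l m →
      (u k • (yGen 0 ⊗ₜ[ℂ] yGen k) - u 0 • (yGen k ⊗ₜ[ℂ] yGen 0)
        + u m • (yGen l ⊗ₜ[ℂ] yGen m) - u l • (yGen m ⊗ₜ[ℂ] yGen l)) -
      (u k • (yGen k ⊗ₜ[ℂ] yGen 0) - u 0 • (yGen 0 ⊗ₜ[ℂ] yGen k)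
        + u l • (yGen l ⊗ₜ[ℂ] yGen m) - u m • (yGen m ⊗ₜ[ℂ] yGen l)) =
      ((u k + u 0) * (ρ 0 * ρ k)) • (comm (Y 0) (Y k) - acomm (Y l) (Y m)) :=
    fun k l m hk => by
      simp only [hY, TensorProduct.smul_tmul_smul, comm, acomm]
      have h := hmul k l m hk
      rw [smul_sub]
      nth_rw 2 [← h]
      module
  have e2 : ∀ k l m, IsCyclic123 k l m →
      (u k • (yGen 0 ⊗ₜ[ℂ] yGen k) - u 0 • (yGen k ⊗ₜ[ℂ] yGen 0)
        + u m • (yGen l ⊗ₜ[ℂ] yGen m) - u l • (yGen m ⊗ₜ[ℂ] yGen l)) +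
      (u k • (yGen k ⊗ₜ[ℂ] yGen 0) - u 0 • (yGen 0 ⊗ₜ[ℂ] yGen k)
        + u l • (yGen l ⊗ₜ[ℂ] yGen m) - u m • (yGen m ⊗ₜ[ℂ] yGen l)) =
      ((u l + u m) * (ρ l * ρ m)) • (comm (Y l) (Y m) + J u k l m • acomm (Y 0) (Y k)) :=
    fun k l m hk => by
      have h := hmul k l m hk
      have hJ : (u l + u m) * (ρ l * ρ m) * J u k l m = (u k - u 0) * (ρ 0 * ρ k) := by
        have hk0 : u 0 + u k ≠ 0 := by
          rcases hk with h | h | h <;> cases h <;> exact hu.add_ne_zero (by decide)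
        apply mul_left_cancel₀ hk0
        linear_combination -(ρ l * ρ m) * J_mul hu hk + (u k - u 0) * h
      simp only [hY, TensorProduct.smul_tmul_smul, comm, acomm]
      rw [smul_add, smul_smul _ (J u k l m), hJ]
      module
  apply le_antisymm <;> rw [uRel, Submodule.span_le]
  · have hS : ∀ k l m, IsCyclic123 k l m →
        comm (Y 0) (Y k) - acomm (Y l) (Y m) ∈ Submodule.span ℂ (yRelations u Y) ∧
        comm (Y l) (Y m) + J u k l m • acomm (Y 0) (Y k) ∈
          Submodule.span ℂ (yRelations u Y) := fun k l m hk =>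
      ⟨Submodule.subset_span ⟨k, l, m, hk, .inl rfl⟩,
        Submodule.subset_span ⟨k, l, m, hk, .inr rfl⟩⟩
    rintro ω ⟨k, l, m, hk, rfl | rfl⟩
    · have h := Submodule.smul_mem _ (1 / 2 : ℂ) (Submodule.sub_mem _
        (Submodule.smul_mem _ ((u l + u m) * (ρ l * ρ m)) (hS k l m hk).2)
        (Submodule.smul_mem _ ((u k + u 0) * (ρ 0 * ρ k)) (hS k l m hk).1))
      rw [← e1 k l m hk, ← e2 k l m hk] at h
      rw [SetLike.mem_coe]
      convert h using 1
      module
    · have h := Submodule.smul_mem _ (1 / 2 : ℂ) (Submodule.add_mem _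
        (Submodule.smul_mem _ ((u l + u m) * (ρ l * ρ m)) (hS k l m hk).2)
        (Submodule.smul_mem _ ((u k + u 0) * (ρ 0 * ρ k)) (hS k l m hk).1))
      rw [← e1 k l m hk, ← e2 k l m hk] at h
      rw [SetLike.mem_coe]
      convert h using 1
      module
  · rintro ω ⟨k, l, m, hk, rfl | rfl⟩
    · rw [SetLike.mem_coe, ← Submodule.smul_mem_iff _ (hne k l m hk).1, ← e1 k l m hk]
      exact Submodule.sub_mem _ (Submodule.subset_span ⟨k, l, m, hk, .inr rfl⟩)
        (Submodule.subset_span ⟨k, l, m, hk, .inl rfl⟩)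
    · rw [SetLike.mem_coe, ← Submodule.smul_mem_iff _ (hne k l m hk).2, ← e2 k l m hk]
      exact Submodule.add_mem _ (Submodule.subset_span ⟨k, l, m, hk, .inr rfl⟩)
        (Submodule.subset_span ⟨k, l, m, hk, .inl rfl⟩)

end Relations

section Quadratic

variable {V : Type} [AddCommGroup V] [Module ℂ V]

lemma mkAlgHom_toTensorAlgebra (R : Submodule ℂ (V ⊗[ℂ] V)) {ω : V ⊗[ℂ] V} (hω : ω ∈ R) :
    (RingQuot.mkAlgHom ℂ _ (toTensorAlgebra ω) : QuadraticAlg R) = 0 := by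
  rw [RingQuot.mkAlgHom_rel ℂ (y := 0) ⟨⟨ω, hω, rfl⟩, rfl⟩, map_zero]

lemma mkAlgHom_toTensorAlgebra_tmul (R : Submodule ℂ (V ⊗[ℂ] V)) (v w : V) :
    (RingQuot.mkAlgHom ℂ _ (toTensorAlgebra (v ⊗ₜ[ℂ] w)) : QuadraticAlg R) =
      gen R v * gen R w := by
  have h : toTensorAlgebra (v ⊗ₜ[ℂ] w) = TensorAlgebra.ι ℂ v * TensorAlgebra.ι ℂ w := by
    simp [toTensorAlgebra]
  rw [h, map_mul, gen, gen]

end Quadratic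

lemma gen_relations {Y : Fin 4 → (Fin 4 → ℂ)}
    (hY : uRel u = Submodule.span ℂ (yRelations u Y)) {k l m : Fin 4} (hk : IsCyclic123 k l m) :
    gen (uRel u) (Y 0) * gen (uRel u) (Y k) - gen (uRel u) (Y k) * gen (uRel u) (Y 0) =
      gen (uRel u) (Y l) * gen (uRel u) (Y m) + gen (uRel u) (Y m) * gen (uRel u) (Y l) ∧
    gen (uRel u) (Y l) * gen (uRel u) (Y m) - gen (uRel u) (Y m) * gen (uRel u) (Y l) =
      -(J u k l m • (gen (uRel u) (Y 0) * gen (uRel u) (Y k) +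
        gen (uRel u) (Y k) * gen (uRel u) (Y 0))) := by
  have h1 : comm (Y 0) (Y k) - acomm (Y l) (Y m) ∈ uRel u :=
    hY ▸ Submodule.subset_span ⟨k, l, m, hk, .inl rfl⟩
  have h2 : comm (Y l) (Y m) + J u k l m • acomm (Y 0) (Y k) ∈ uRel u :=
    hY ▸ Submodule.subset_span ⟨k, l, m, hk, .inr rfl⟩
  have h1 := mkAlgHom_toTensorAlgebra _ h1
  have h2 := mkAlgHom_toTensorAlgebra _ h2
  simp only [comm, acomm, map_sub, map_add, map_smul, mkAlgHom_toTensorAlgebra_tmul] at h1 h2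
  exact ⟨sub_eq_zero.1 h1, eq_neg_of_add_eq_zero_left h2⟩

/-! ### The graph in homogeneous coordinates -/

lemma represents_homCoord (Y : Module.Basis (Fin 4) ℂ (Fin 4 → ℂ))
    (α : Projectivization ℂ (Module.Dual ℂ (Fin 4 → ℂ))) :
    Represents (homCoord Y α) (fun μ => α.rep (Y μ)) := by
  have h : (fun μ => α.rep (Y μ)) = (Y.constr ℂ).symm.toLinearMap α.rep := by
    ext μ
    simp [Module.Basis.constr_symm_apply]
  rw [h]
  refine ⟨?_, ?_⟩
  · simpa using α.rep_nonzero
  · conv_lhs => rw [← α.mk_rep]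
    rfl

lemma homCoord_surjective (Y : Module.Basis (Fin 4) ℂ (Fin 4 → ℂ)) :
    Function.Surjective (homCoord Y) := by
  intro x
  have hx : (Y.constr ℂ) x.rep ≠ 0 := by simpa using x.rep_nonzero
  refine ⟨Projectivization.mk ℂ ((Y.constr ℂ) x.rep) hx, ?_⟩
  rw [homCoord, Projectivization.map_mk]
  conv_rhs => rw [← x.mk_rep]
  congr 1
  simp

lemma mem_charGraphIn_iff {Y : Module.Basis (Fin 4) ℂ (Fin 4 → ℂ)}
    (hY : uRel u = Submodule.span ℂ (yRelations u Y)) {x y : P3} :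
    (x, y) ∈ charGraphIn Y (uRel u) ↔ GammaRel u x.rep y.rep := by
  have key : ∀ α β, (α, β) ∈ charGraph (uRel u) ↔
      GammaRel u (homCoord Y α).rep (homCoord Y β).rep := fun α β => by
    rw [(represents_homCoord Y α).gammaRel_iff (represents_homCoord Y β), charGraph,
      Set.mem_ofPred_eq]
    have hker : (∀ ω ∈ uRel u, TensorProduct.dualDistrib ℂ _ _ (α.rep ⊗ₜ[ℂ] β.rep) ω = 0) ↔
        ∀ ω ∈ yRelations u Y, TensorProduct.dualDistrib ℂ _ _ (α.rep ⊗ₜ[ℂ] β.rep) ω = 0 := by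
      rw [hY]
      exact Submodule.span_le (p := LinearMap.ker
        (TensorProduct.dualDistrib ℂ _ _ (α.rep ⊗ₜ[ℂ] β.rep)))
    rw [hker]
    constructor
    · intro h k l m hk
      have h1 := h _ ⟨k, l, m, hk, .inl rfl⟩
      have h2 := h _ ⟨k, l, m, hk, .inr rfl⟩
      simp only [comm, acomm, map_sub, map_add, map_smul, TensorProduct.dualDistrib_apply,
        smul_eq_mul] at h1 h2
      exact ⟨by linear_combination h1, by linear_combination h2⟩
    · rintro h ω ⟨k, l, m, hk, rfl | rfl⟩ <;> obtain ⟨h1, h2⟩ := h k l m hk <;>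
        simp only [comm, acomm, map_sub, map_add, map_smul, TensorProduct.dualDistrib_apply,
          smul_eq_mul]
      · linear_combination h1
      · linear_combination h2
  constructor
  · rintro ⟨⟨α, β⟩, h, hxy⟩
    obtain ⟨rfl, rfl⟩ := Prod.mk.inj hxy
    exact (key α β).1 h
  · intro h
    obtain ⟨α, rfl⟩ := homCoord_surjective Y x
    obtain ⟨β, rfl⟩ := homCoord_surjective Y y
    exact ⟨(α, β), (key α β).2 h, rfl⟩

/-! ### The automorphism of the characteristic variety -/

/-- A relation which is functional in both directions on `E` is the graph of a permutation. -/
lemma exists_perm_of_graph {α : Type*} {E : Set α} {r : α → α → Prop}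
    (hl : ∀ x y, r x y → x ∈ E) (hr : ∀ x y, r x y → y ∈ E) (hex : ∀ x ∈ E, ∃ y, r x y)
    (hex' : ∀ y ∈ E, ∃ x, r x y) (hun : ∀ x y y', r x y → r x y' → y = y')
    (hun' : ∀ x x' y, r x y → r x' y → x = x') :
    ∃ σ : Equiv.Perm E, ∀ x y, r x y ↔ ∃ hx : x ∈ E, (σ ⟨x, hx⟩ : α) = y := by
  choose f hf using hex
  choose g hg using hex'
  refine ⟨⟨fun x => ⟨f x x.2, hr _ _ (hf x x.2)⟩, fun y => ⟨g y y.2, hl _ _ (hg y y.2)⟩,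
    fun x => Subtype.ext (hun' _ _ _ (hg _ _) (hf _ _)),
    fun y => Subtype.ext (hun _ _ _ (hf _ _) (hg _ _))⟩, fun x y => ⟨fun h => ?_, ?_⟩⟩
  · exact ⟨hl _ _ h, hun _ _ _ (hf _ _) h⟩
  · rintro ⟨hx, rfl⟩
    exact hf x hx

variable {u v : Fin 4 → ℂ} {x y y' : P3}

lemma GammaRel.point_unique (hu : Generic u) (h : GammaRel u x.rep y.rep)
    (h' : GammaRel u x.rep y'.rep) : y = y' := by
  obtain ⟨c, hc, hcy⟩ := h.unique hu x.rep_nonzero y.rep_nonzero y'.rep_nonzero h'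
  exact ((represents_rep y').eq (hcy ▸ (represents_rep y).smul hc)).symm

lemma GammaRel.point_unique_left (hu : Generic u) (h : GammaRel u x.rep y'.rep)
    (h' : GammaRel u y.rep y'.rep) : x = y := by
  obtain ⟨c, hc, hcy⟩ := h.reflect_swap.unique hu (reflect_ne_zero y'.rep_nonzero)
    (reflect_ne_zero x.rep_nonzero) (reflect_ne_zero y.rep_nonzero) h'.reflect_swap
  have : y.rep = c • x.rep := by
    rw [← reflect_reflect y.rep, hcy]
    ext i
    fin_cases i <;> simp [reflect]
  exact ((represents_rep y).eq (this ▸ (represents_rep x).smul hc)).symm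

/-- The common zeros of the quadrics, and the four points `e_ν`. -/
def curveUnion (u : Fin 4 → ℂ) : Set P3 := {x | OnCurve u x.rep ∨ OnAxis x.rep}

lemma GammaRel.left_mem (hu : Generic u) (h : GammaRel u x.rep y.rep) : x ∈ curveUnion u :=
  h.onCurve_or_onAxis hu x.rep_nonzero y.rep_nonzero

lemma GammaRel.right_mem (hu : Generic u) (h : GammaRel u x.rep y.rep) : y ∈ curveUnion u := by
  rw [curveUnion, Set.mem_ofPred_eq, ← reflect_reflect y.rep]
  exact (h.reflect_swap.onCurve_or_onAxis hu (reflect_ne_zero y.rep_nonzero)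
    (reflect_ne_zero x.rep_nonzero)).imp onCurve_reflect onAxis_reflect

lemma exists_point_right (hu : Generic u) (hx : x ∈ curveUnion u) :
    ∃ y : P3, GammaRel u x.rep y.rep := by
  obtain ⟨w, hw, h⟩ := exists_gammaRel hu x.rep_nonzero hx
  exact ⟨.mk ℂ w hw, ((represents_rep x).gammaRel_iff ⟨hw, rfl⟩).2 h⟩

lemma exists_point_left (hu : Generic u) (hx : x ∈ curveUnion u) :
    ∃ y : P3, GammaRel u y.rep x.rep := by
  obtain ⟨w, hw, h⟩ := exists_gammaRel hu (reflect_ne_zero x.rep_nonzero)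
    (hx.imp onCurve_reflect onAxis_reflect)
  refine ⟨.mk ℂ _ (reflect_ne_zero hw), (Represents.gammaRel_iff ⟨_, rfl⟩ (represents_rep x)).2 ?_⟩
  simpa only [reflect_reflect] using h.reflect_swap

lemma represents_of_proportional {w : Fin 4 → ℂ} (hw : w ≠ 0)
    (h : ∀ i j, v i * w j = v j * w i) (hy : Represents y v) : Represents y w := by
  obtain ⟨c, hc⟩ := exists_smul_eq_of_proportional hw h
  have hc0 : c ≠ 0 := by
    rintro rfl
    exact hy.ne_zero (by simpa using hc)
  have := hy.smul (inv_ne_zero hc0)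
  rwa [hc, smul_smul, inv_mul_cancel₀ hc0, one_smul] at this

open MvPolynomial in
lemma eval_cubicMap (v : Fin 4 → ℂ) (p : Fin 4 → MvPolynomial (Fin 4) ℂ) (i : Fin 4) :
    eval v (cubicMap p i) = cubicMap (fun j => eval v (p j)) i :=
  map_cubicMap (eval v) p i

open MvPolynomial in
lemma eval_cubicMapAux (v : Fin 4 → ℂ) (j₁ j₂ : ℂ) (p : Fin 4 → MvPolynomial (Fin 4) ℂ)
    (i : Fin 4) : eval v (cubicMapAux (C j₁) (C j₂) p i) =
      cubicMapAux j₁ j₂ (fun j => eval v (p j)) i := by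
  rw [map_cubicMapAux (eval v), eval_C, eval_C]
  rfl

open MvPolynomial in
lemma eval_reflect (v : Fin 4 → ℂ) (p : Fin 4 → MvPolynomial (Fin 4) ℂ) (i : Fin 4) :
    eval v (reflect p i) = reflect (fun j => eval v (p j)) i := by
  fin_cases i <;> simp [reflect]

open MvPolynomial in
lemma evalTuple_cubicPoly (v : Fin 4 → ℂ) : evalTuple cubicPoly v = cubicMap v := by
  ext i
  rw [evalTuple, cubicPoly]
  refine (map_cubicMap (aeval v : MvPolynomial (Fin 4) ℚ →ₐ[ℚ] ℂ).toRingHom X i).trans ?_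
  congr 1
  exact _root_.funext fun j => aeval_X v j

/-- Near every point of the characteristic variety `σ` is given by one of the two cubic maps. -/
lemma exists_local_cubicMap (hu : Generic u) {w : Fin 4 → ℂ} (hw : w ≠ 0)
    (h : OnCurve u w ∨ OnAxis w) : ∃ F : Fin 4 → MvPolynomial (Fin 4) ℂ,
      (∀ i, (F i).IsHomogeneous 3) ∧ (fun i => MvPolynomial.eval w (F i)) ≠ 0 ∧
      ∀ x y, GammaRel u x y → ∀ i j,
        y i * MvPolynomial.eval x (F j) = y j * MvPolynomial.eval x (F i) := by
  have hX := MvPolynomial.isHomogeneous_X ℂ (σ := Fin 4)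
  by_cases hP : cubicMap w = 0
  · refine ⟨cubicMapAux (.C (J u 1 2 3)) (.C (J u 2 3 1)) .X,
      isHomogeneous_cubicMapAux _ _ hX, ?_, fun x y hxy i j => ?_⟩
    · simp only [eval_cubicMapAux, MvPolynomial.eval_X]
      exact cubicMapAux_ne_zero hu hw h hP
    · simp only [eval_cubicMapAux, MvPolynomial.eval_X]
      exact hxy.cubicMapAux_proportional i j
  · refine ⟨cubicMap .X, isHomogeneous_cubicMap hX, ?_, fun x y hxy i j => ?_⟩
    · simp only [eval_cubicMap, MvPolynomial.eval_X]
      exact hP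
    · simp only [eval_cubicMap, MvPolynomial.eval_X]
      exact hxy.cubicMap_proportional i j

lemma isRegularMap_of_gammaRel (hu : Generic u) {f : curveUnion u → curveUnion u}
    (hf : ∀ x, GammaRel u x.1.rep (f x).1.rep) : IsRegularMap f := by
  intro x
  obtain ⟨F, hF, hF0, h⟩ := exists_local_cubicMap hu x.1.rep_nonzero x.2
  exact ⟨3, F, hF, hF0, fun y hy =>
    represents_of_proportional hy (h _ _ (hf y)) (represents_rep _)⟩

lemma reflect_smul (c : ℂ) (v : Fin 4 → ℂ) : reflect (c • v) = c • reflect v := by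
  ext i
  fin_cases i <;> simp [reflect]

open MvPolynomial in
/-- The inverse of `σ` is regular since it is conjugate to `σ` under the reflection. -/
lemma isRegularMap_of_gammaRel_symm (hu : Generic u) {f : curveUnion u → curveUnion u}
    (hf : ∀ x, GammaRel u (f x).1.rep x.1.rep) : IsRegularMap f := by
  intro x
  obtain ⟨F, hF, hF0, h⟩ := exists_local_cubicMap hu (reflect_ne_zero x.1.rep_nonzero)
    (x.2.imp onCurve_reflect onAxis_reflect)
  -- composition with the reflection on both sides
  have hb : ∀ (v : Fin 4 → ℂ) i, eval v (reflect (fun j => bind₁ (reflect X) (F j)) i) =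
      reflect (fun j => eval (reflect v) (F j)) i := fun v i => by
    rw [eval_reflect]
    congr 1
    ext j
    have he : eval (reflect v) = (aeval (reflect v) : MvPolynomial (Fin 4) ℂ →ₐ[ℂ] ℂ) :=
      (coe_aeval_eq_eval _).symm
    have he' : eval v = (aeval v : MvPolynomial (Fin 4) ℂ →ₐ[ℂ] ℂ) :=
      (coe_aeval_eq_eval _).symm
    have hr : (fun i => aeval v (reflect X i)) = reflect v := _root_.funext fun i => by
      rw [aeval_eq_eval, eval_reflect]
      simp
    rw [he, he', RingHom.coe_coe, RingHom.coe_coe, aeval_bind₁, hr]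
  refine ⟨3, reflect (fun j => bind₁ (reflect X) (F j)), isHomogeneous_reflect fun i => ?_,
    ?_, fun y hy => ?_⟩
  · exact (hF i).aeval _ (isHomogeneous_reflect (isHomogeneous_X ℂ))
  · simp only [hb]
    exact reflect_ne_zero hF0
  · simp only [hb] at hy ⊢
    have hy' : (fun i => eval (reflect y.1.rep) (F i)) ≠ 0 := fun h0 => hy (by
      rw [h0]
      ext i
      fin_cases i <;> simp [reflect])
    obtain ⟨c, hc⟩ := exists_smul_eq_of_proportional hy' (h _ _ (hf y).reflect_swap)
    have hfy : (f y).1.rep = c • reflect fun i => eval (reflect y.1.rep) (F i) := by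
      rw [← reflect_smul, ← hc, reflect_reflect]
    exact represents_of_proportional hy (fun i j => by
      rw [hfy]
      simp only [Pi.smul_apply, smul_eq_mul]
      ring) (represents_rep _)

/-- On the characteristic variety the components of the cubic map have at most four common
zeros. -/
lemma finite_cubicMap_eq_zero (hu : Generic u) :
    {x : P3 | x ∈ curveUnion u ∧ cubicMap x.rep = 0}.Finite := by
  have hne : ∀ e f : ℂ, (![1, e, f, -(e * f)] : Fin 4 → ℂ) ≠ 0 := fun e f h => by
    simpa using congr_fun h 0
  refine ((Set.toFinite ({1, -1} ×ˢ {1, -1} : Set (ℂ × ℂ))).image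
    fun p => Projectivization.mk ℂ _ (hne p.1 p.2)).subset ?_
  rintro x ⟨hx, hP⟩
  have hc := hx.resolve_right fun h => h.cubicMap_ne_zero x.rep_nonzero hP
  obtain ⟨e, f, he, hf, h1, h2, h3⟩ := hc.signs_of_cubicMap_eq_zero hu hP
  have hx0 : x.rep 0 ≠ 0 := fun h0 => x.rep_nonzero (funext fun i => by
    fin_cases i <;> simp [h0, h1, h2, h3])
  refine ⟨(e, f), ⟨he, hf⟩, ?_⟩
  have : x.rep = x.rep 0 • ![1, e, f, -(e * f)] := funext fun i => by
    fin_cases i <;> simp [h1, h2, h3] <;> ring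
  exact (this ▸ represents_rep x).eq (Represents.smul ⟨hne e f, rfl⟩ hx0) |>.symm

end NCSphere

open NCSphere
theorem mainTheorem5 :
    ∃ P : Fin 4 → MvPolynomial (Fin 4) ℚ, IsBirationalAut 3 P ∧
      ∀ u : Fin 4 → ℂ, Generic u →
      ∀ d₁₂ d₂₃ d₃₁ s₁ s₂ s₃ : ℂ,
        d₁₂ ^ 2 = u 1 - u 2 → d₂₃ ^ 2 = u 2 - u 3 → d₃₁ ^ 2 = u 3 - u 1 →
        s₁ ^ 2 = u 0 + u 1 → s₂ ^ 2 = u 0 + u 2 → s₃ ^ 2 = u 0 + u 3 →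
      -- the change of generators
      ∃ Y : Module.Basis (Fin 4) ℂ (Fin 4 → ℂ),
        (∀ μ, yGen μ = changeScale d₁₂ d₂₃ d₃₁ s₁ s₂ s₃ μ • Y μ) ∧
        -- 1) the relations of `A_u` in terms of the `Y_μ`
        uRel u = Submodule.span ℂ (yRelations u Y) ∧
        (∀ k l m, IsCyclic123 k l m →
          gen (uRel u) (Y 0) * gen (uRel u) (Y k) - gen (uRel u) (Y k) * gen (uRel u) (Y 0) =
            gen (uRel u) (Y l) * gen (uRel u) (Y m) + gen (uRel u) (Y m) * gen (uRel u) (Y l) ∧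
          gen (uRel u) (Y l) * gen (uRel u) (Y m) - gen (uRel u) (Y m) * gen (uRel u) (Y l) =
            -(J u k l m • (gen (uRel u) (Y 0) * gen (uRel u) (Y k) + gen (uRel u) (Y k) * gen (uRel u) (Y 0)))) ∧
        -- 2) the characteristic variety in the coordinates `Z_μ`
        charVariety Y (uRel u) = projM '' fiberF u ∪ pointsE ∧
        Prod.snd '' charGraphIn Y (uRel u) = charVariety Y (uRel u) ∧
        -- the automorphism `σ` of the characteristic variety with graph `Γ`
        ∃ σ : Equiv.Perm (charVariety Y (uRel u)),
          (∀ p q : P3, (p, q) ∈ charGraphIn Y (uRel u) ↔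
            ∃ hp : p ∈ charVariety Y (uRel u), (σ ⟨p, hp⟩ : P3) = q) ∧
          IsRegularMap σ ∧ IsRegularMap σ.symm ∧
          -- 3) `σ` is a translation on `F_u ≃ ℂ / L` and the identity on the points `e_ν`
          (∃ τ η : ℂ, IsEllipticParam u τ η) ∧
          (∀ τ η : ℂ, IsEllipticParam u τ η →
            (∀ z, psi τ η z ≠ 0) ∧
            projM '' fiberF u = {x | ∃ z, Represents x (psi τ η z)} ∧
            (∀ z w, (∃ x, Represents x (psi τ η z) ∧ Represents x (psi τ η w)) ↔
              z - w ∈ latticeL τ) ∧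
            (∀ z, ∀ p : charVariety Y (uRel u), Represents p (psi τ η z) →
              Represents (σ p) (psi τ η (z - η)))) ∧
          (∀ p : charVariety Y (uRel u), (p : P3) ∈ pointsE → σ p = p) ∧
          -- 4) `σ` is the restriction of the rational map `P`
          {x : P3 | x ∈ charVariety Y (uRel u) ∧ evalTuple P x.rep = 0}.Finite ∧
          (∀ p : charVariety Y (uRel u), evalTuple P (p : P3).rep ≠ 0 →
            Represents (σ p) (evalTuple P (p : P3).rep)) := by
  refine ⟨cubicPoly, isBirationalAut_cubicPoly,
    fun u hu d₁₂ d₂₃ d₃₁ s₁ s₂ s₃ h12 h23 h31 h1 h2 h3 => ?_⟩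
  have hρ := changeScale_ne_zero hu h12 h23 h31 h1 h2 h3
  set ρ := changeScale d₁₂ d₂₃ d₃₁ s₁ s₂ s₃
  obtain ⟨Y, hY⟩ : ∃ Y : Module.Basis (Fin 4) ℂ (Fin 4 → ℂ), ∀ μ, yGen μ = ρ μ • Y μ :=
    ⟨(Pi.basisFun ℂ (Fin 4)).isUnitSMul fun μ => (inv_ne_zero (hρ μ)).isUnit, fun μ => by
      rw [Module.Basis.isUnitSMul_apply, smul_smul, mul_inv_cancel₀ (hρ μ), one_smul,
        Pi.basisFun_apply, yGen]⟩
  have hR := uRel_eq_span hu hY hρ fun k l m hk => changeScale_mul h12 h23 h31 h1 h2 h3 hk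
  have hΓ : ∀ x y : P3, (x, y) ∈ charGraphIn Y (uRel u) ↔ GammaRel u x.rep y.rep :=
    fun x y => mem_charGraphIn_iff hR
  have hE : charVariety Y (uRel u) = curveUnion u := by
    ext x
    constructor
    · rintro ⟨⟨x, y⟩, h, rfl⟩
      exact ((hΓ x y).1 h).left_mem hu
    · intro hx
      obtain ⟨y, hy⟩ := exists_point_right hu hx
      exact ⟨(x, y), (hΓ x y).2 hy, rfl⟩
  have hE' : Prod.snd '' charGraphIn Y (uRel u) = curveUnion u := by
    ext y
    constructor
    · rintro ⟨⟨x, y⟩, h, rfl⟩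
      exact ((hΓ x y).1 h).right_mem hu
    · intro hy
      obtain ⟨x, hx⟩ := exists_point_left hu hy
      exact ⟨(x, y), (hΓ x y).2 hx, rfl⟩
  refine ⟨Y, hY, hR, fun k l m hk => gen_relations hR hk, ?_, ?_⟩
  · rw [hE, projM_image_fiberF]
    ext x
    exact or_congr_right mem_pointsE_iff.symm
  rw [hE, hE']
  refine ⟨rfl, ?_⟩
  obtain ⟨σ, hσ⟩ := exists_perm_of_graph (r := fun x y : P3 => GammaRel u x.rep y.rep)
    (fun _ _ h => h.left_mem hu) (fun _ _ h => h.right_mem hu)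
    (fun _ hx => exists_point_right hu hx) (fun _ hx => exists_point_left hu hx)
    (fun _ _ _ h h' => h.point_unique hu h') (fun _ _ _ h h' => h.point_unique_left hu h')
  -- `Γ` is the graph of `σ`; everything else follows from this
  have hσ1 : ∀ p : curveUnion u, GammaRel u p.1.rep (σ p).1.rep :=
    fun p => (hσ _ _).2 ⟨p.2, rfl⟩
  have hσ2 : ∀ p : curveUnion u, GammaRel u (σ.symm p).1.rep p.1.rep := fun p => by
    simpa using hσ1 (σ.symm p)
  refine ⟨σ, fun p q => (hΓ p q).trans (hσ p q), isRegularMap_of_gammaRel hu hσ1,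
    isRegularMap_of_gammaRel_symm hu hσ2, exists_isEllipticParam hu, fun τ η h =>
    ⟨psi_ne_zero hu h, ?_, fun z w => ?_, fun z p hp => ?_⟩, fun p hp => ?_, ?_, fun p hp => ?_⟩
  · rw [projM_image_fiberF]
    ext x
    constructor
    · intro hx
      obtain ⟨z, μ, hμ, hz⟩ := OnCurve.exists_psi hu h hx x.rep_nonzero
      refine ⟨z, represents_iff.2 ⟨μ⁻¹, inv_ne_zero hμ, ?_⟩⟩
      rw [hz, smul_smul, inv_mul_cancel₀ hμ, one_smul]
    · rintro ⟨z, hz⟩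
      exact hz.onCurve_iff.2 (OnCurve.psi hu h z)
  · rw [← psi_proportional_iff hu h]
    constructor
    · rintro ⟨x, hz, hw⟩
      exact hw.exists_smul hz
    · rintro ⟨μ, hμ, hz⟩
      have hw : Represents (.mk ℂ _ (psi_ne_zero hu h w)) (psi τ η w) := ⟨_, rfl⟩
      exact ⟨_, hz ▸ hw.smul hμ, hw⟩
  · have hq : Represents (.mk ℂ _ (psi_ne_zero hu h (z - η))) (psi τ η (z - η)) := ⟨_, rfl⟩
    have := (hp.gammaRel_iff hq).2 (GammaRel.psi hu h z)
    rw [(hσ1 p).point_unique hu this]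
    exact hq
  · exact Subtype.ext ((hσ1 p).point_unique hu (.of_onAxis (mem_pointsE_iff.1 hp)))
  · simpa only [evalTuple_cubicPoly] using finite_cubicMap_eq_zero hu
  · rw [evalTuple_cubicPoly] at hp ⊢
    exact represents_of_proportional hp (hσ1 p).cubicMap_proportional (represents_rep _)
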